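/- **Setting.** Let $T>0$, let $m\ge 1$ be an integer, let $\mathbb T=\mathbb R/2\pi\mathbb Z$, $I^+=(0,1)$, $I^-=(-1,0)$, $\Omega_0^\pm=\mathbb T^2\times I^\pm$ (variable $y=(y',y_3)$) and $\Gamma_0=\mathbb T^2\times\{0\}$. The fast variables are $\theta\in\mathbb T$ and $Y_3$, with $\pm Y_3\ge 0$. For a function $f$ of $\theta$ (and of other variables), $\mathbf c_0 f=\widehat f(0)=\frac1{2\pi}\int_{\mathbb T}f\,d\theta$. Repeated indices $j\in\{1,2\}$ and $\alpha\in\{1,2,3\}$ are summed. Let $\xi=(\xi_1,\xi_2)\in\mathbb R^2$ and let $\chi\in C^\infty(\mathbb R)$ satisfy $\chi=1$ on $[-\frac13,\frac13]$ and $\chi=0$ outside $[-\frac23,\frac23]$. *Function spaces.* $\underline S^\pm=H^\infty([0,T]\times\mathbb T^2\times I^\pm\times\mathbb T)$ (functions of $(t,y,\theta)$, smooth up to the boundary); $S_\star^\pm$ is the set of functions of $(t,y,Y_3,\theta)$, smooth up to the boundary for $t\in[0,T]$, $y\in\mathbb T^2\times\overline{I^\pm}$, $\pm Y_3\ge0$,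 $\theta\in\mathbb T$, which decay exponentially in $|Y_3|$ together with all their derivatives, at one common rate $\delta>0$; $S^\pm=\underline S^\pm\oplus S_\star^\pm$. *Fronts.* $\psi^0=\psi^1=0$ and $\psi^2,\dots,\psi^{m+1}\in H^\infty([0,T]\times\mathbb T^2\times\mathbb T)$ are functions of $(t,y',\theta)$. Let $x_3=y_3+\sum_{\ell\ge2}\varepsilon^\ell(\cdots)$ be the solution, as a formal series in $\varepsilon$, of $y_3=x_3-\chi(x_3)\sum_{\ell}\varepsilon^\ell\psi^\ell(t,y',\theta)$, and let $\chi^{[\ell]}(t,y,\theta)$ and $\dot\chi^{[\ell]}(t,y,\theta)$ be the coefficients of $\varepsilon^\ell$ in the (Taylor expanded) formal series $\chi(x_3)$ and $\chi'(x_3)$. In the sums below the fronts $\psi^\ell$ with $\ell>m+1$, and the profiles below of order $>m$, occur only multiplied by zero. *Profiles.* For each sign $\pm$ let $V^{\ell,\pm}=\underline V^{\ell,\pm}+V_\star^{\ell,\pm}$, where $V$ stands for $u$ (velocity) or $H$ (magnetic field), be $\mathbb R^3$-valued profiles such that $V^{0,\pm}$ is a constant vector with $V^{0,\pm}_3=0$,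 and for $1\le\ell\le m$ the components of $\underline V^{\ell,\pm}$ and $V_\star^{\ell,\pm}$ belong to $\underline S^\pm$ and $S_\star^\pm$. Put $$\begin{aligned}F^{k,\pm}[V]={}&-\partial_{y_\alpha}V_\alpha^{k,\pm}+\sum_{\ell_1+\ell_2=k+2}\partial_\theta\psi^{\ell_1}\,\xi_j\partial_{Y_3}V_j^{\ell_2,\pm}+\sum_{\ell_1+\ell_2=k+1}\partial_{y_j}\psi^{\ell_1}\,\partial_{Y_3}V_j^{\ell_2,\pm}\\&+\sum_{\ell_1+\ell_2+\ell_3=k+1}\chi^{[\ell_1]}\partial_\theta\psi^{\ell_2}\,\xi_j\partial_{y_3}V_j^{\ell_3,\pm}+\sum_{\ell_1+\ell_2+\ell_3=k}\chi^{[\ell_1]}\partial_{y_j}\psi^{\ell_2}\,\partial_{y_3}V_j^{\ell_3,\pm}+\sum_{\ell_1+\ell_2+\ell_3=k}\dot\chi^{[\ell_1]}\psi^{\ell_2}\,\partial_{y_3}V_3^{\ell_3,\pm},\end{aligned}$$ and $F_7^{k,\pm}=F^{k,\pm}[u]$, $F_8^{k,\pm}=F^{k,\pm}[H]$. Assume that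 the fast divergence constraints hold: for $\mu=1,\dots,m$, $$\partial_{Y_3}u_3^{\mu,\pm}+\xi_j\partial_\theta u_j^{\mu,\pm}=F_7^{\mu-1,\pm},\qquad \partial_{Y_3}H_3^{\mu,\pm}+\xi_j\partial_\theta H_j^{\mu,\pm}=F_8^{\mu-1,\pm},$$ and that there exist functions $\widehat u_{3,\star}^{m+1,\pm}(0)$ and $\widehat H_{3,\star}^{m+1,\pm}(0)$ in $S_\star^\pm$, independent of $\theta$, with $$\partial_{Y_3}\widehat u_{3,\star}^{m+1,\pm}(0)=\mathbf c_0F_7^{m,\pm},\qquad \partial_{Y_3}\widehat H_{3,\star}^{m+1,\pm}(0)=\mathbf c_0F_8^{m,\pm}$$ (they are then unique). *Source terms.* For $V=u$, resp. $V=H$, define $\mathbb F_7^{m,\pm}$, resp. $\mathbb F_8^{m,\pm}$, as $$\mathbf c_0\Big\{\sum_{\ell_1+\ell_2+\ell_3=m+2}\chi^{[\ell_1]}\partial_\theta\psi^{\ell_2}\,\xi_j\partial_{y_3}\underline V_j^{\ell_3,\pm}+\sum_{\ell_1+\ell_2+\ell_3=m+1}\chi^{[\ell_1]}\partial_{y_j}\psi^{\ell_2}\,\partial_{y_3}\underline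 V_j^{\ell_3,\pm}+\sum_{\ell_1+\ell_2+\ell_3=m+1}\dot\chi^{[\ell_1]}\psi^{\ell_2}\,\partial_{y_3}\underline V_3^{\ell_3,\pm}\Big\},$$ and set $$\mathbb G_1^{m,\pm}=\partial_t\widehat\psi^{m+1}(0)+\mathcal G^{m,\pm}[u]-\widehat u_{3,\star}^{m+1,\pm}(0)\big|_{y_3=Y_3=0},\qquad \mathbb G_2^{m,\pm}=\mathcal G^{m,\pm}[H]-\widehat H_{3,\star}^{m+1,\pm}(0)\big|_{y_3=Y_3=0},$$ $$\mathcal G^{m,\pm}[V]=V_j^{0,\pm}\partial_{y_j}\widehat\psi^{m+1}(0)+\mathbf c_0\Big\{\sum_{\substack{\ell_1+\ell_2=m+2\\ \ell_2\ge1}}\partial_\theta\psi^{\ell_1}\,\xi_jV_j^{\ell_2,\pm}+\sum_{\substack{\ell_1+\ell_2=m+1\\ \ell_2\ge1}}\partial_{y_j}\psi^{\ell_1}\,V_j^{\ell_2,\pm}\Big\}\Big|_{y_3=Y_3=0}.$$ **Statement.** For both signs and for all $t\in[0,T]$, $$\int_{\Omega_0^\pm}\mathbb F_7^{m,\pm}\,dy\pm\int_{\Gamma_0}\mathbb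 G_1^{m,\pm}\,dy'=\pm\int_{\Gamma_0}\partial_t\widehat\psi^{m+1}(0)\,dy',\qquad \int_{\Omega_0^\pm}\mathbb F_8^{m,\pm}\,dy\pm\int_{\Gamma_0}\mathbb G_2^{m,\pm}\,dy'=0.$$ Consequently the Fredholm condition for the slow mean pressure Laplace problem, $$\frac{d}{dt}\Big(\int_{\Omega_0^\pm}\mathbb F_7^{m,\pm}\,dy\pm\int_{\Gamma_0}\mathbb G_1^{m,\pm}\,dy'\Big)=0\quad\text{on }[0,T],$$ holds on both sides if and only if $$\frac{d^2}{dt^2}\int_{\Gamma_0\times\mathbb T}\psi^{m+1}(t,y',\theta)\,dy'\,d\theta=0\quad\text{on }[0,T],$$ and already its validity on one of the two sides (either one) is equivalent to this. -/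

import Mathlib

open scoped ContDiff

noncomputable section

namespace VortexSheet

/-- The two sides of the flat sheet `y₃ = 0`. -/
inductive Side where
  | plus : Side
  | minus : Side

/-- The sign `±1` attached to a side. -/
def Side.sgn : Side → ℝ
  | .plus => 1
  | .minus => -1

/-- Lower end point of `I⁺ = (0,1)`, resp. `I⁻ = (-1,0)`. -/
def Side.lo : Side → ℝ
  | .plus => 0
  | .minus => -1

/-- Upper end point of `I⁺ = (0,1)`, resp. `I⁻ = (-1,0)`. -/
def Side.hi : Side → ℝ
  | .plus => 1
  | .minus => 0

/-! ### Functions on the slow and fast variables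

Functions on the torus `ℝ / 2πℤ` are `2π`-periodic functions on `ℝ`. -/

/-- Functions of `(t, y₁, y₂, θ)`. -/
abbrev FrontFun := ℝ → ℝ → ℝ → ℝ → ℝ

/-- Functions of `(t, y₁, y₂, y₃, θ)`. -/
abbrev ResFun := ℝ → ℝ → ℝ → ℝ → ℝ → ℝ

/-- Functions of `(t, y₁, y₂, y₃, Y₃, θ)`. -/
abbrev StarFun := ℝ → ℝ → ℝ → ℝ → ℝ → ℝ → ℝ

/-- `[0,T] × 𝕋² × 𝕋` (periodic directions unfolded). -/
def frontDomain (T : ℝ) : Set (ℝ × ℝ × ℝ × ℝ) :=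
  {p | p.1 ∈ Set.Icc 0 T}

/-- `[0,T] × 𝕋² × closure I^± × 𝕋` (periodic directions unfolded). -/
def resDomain (σ : Side) (T : ℝ) : Set (ℝ × ℝ × ℝ × ℝ × ℝ) :=
  {p | p.1 ∈ Set.Icc 0 T ∧ p.2.2.2.1 ∈ Set.Icc σ.lo σ.hi}

/-- `[0,T] × 𝕋² × closure I^± × {± Y₃ ≥ 0} × 𝕋` (periodic directions unfolded). -/
def starDomain (σ : Side) (T : ℝ) : Set (ℝ × ℝ × ℝ × ℝ × ℝ × ℝ) :=
  {p | p.1 ∈ Set.Icc 0 T ∧ p.2.2.2.1 ∈ Set.Icc σ.lo σ.hi ∧ 0 ≤ σ.sgn * p.2.2.2.2.1}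

/-- The uncurried form of a function of `(t, y₁, y₂, y₃, Y₃, θ)`. -/
def StarFun.uncurried (f : StarFun) : ℝ × ℝ × ℝ × ℝ × ℝ × ℝ → ℝ :=
  fun p => f p.1 p.2.1 p.2.2.1 p.2.2.2.1 p.2.2.2.2.1 p.2.2.2.2.2

/-- `H^∞([0,T] × 𝕋² × 𝕋)`, that is (Sobolev embedding) the smooth functions up to the boundary. -/
structure MemFront (T : ℝ) (f : FrontFun) : Prop where
  smooth : ContDiffOn ℝ ∞ (fun p : ℝ × ℝ × ℝ × ℝ => f p.1 p.2.1 p.2.2.1 p.2.2.2) (frontDomain T)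
  periodic_y₁ : ∀ t ∈ Set.Icc 0 T, ∀ y₁ y₂ θ, f t (y₁ + 2 * Real.pi) y₂ θ = f t y₁ y₂ θ
  periodic_y₂ : ∀ t ∈ Set.Icc 0 T, ∀ y₁ y₂ θ, f t y₁ (y₂ + 2 * Real.pi) θ = f t y₁ y₂ θ
  periodic_θ : ∀ t ∈ Set.Icc 0 T, ∀ y₁ y₂ θ, f t y₁ y₂ (θ + 2 * Real.pi) = f t y₁ y₂ θ

/-- The space `S̲^± = H^∞([0,T] × 𝕋² × I^± × 𝕋)` of residual profiles, that is (Sobolev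
embedding) the smooth functions up to the boundary. -/
structure MemRes (σ : Side) (T : ℝ) (f : ResFun) : Prop where
  smooth : ContDiffOn ℝ ∞
    (fun p : ℝ × ℝ × ℝ × ℝ × ℝ => f p.1 p.2.1 p.2.2.1 p.2.2.2.1 p.2.2.2.2) (resDomain σ T)
  periodic_y₁ : ∀ t ∈ Set.Icc 0 T, ∀ y₁ y₂, ∀ y₃ ∈ Set.Icc σ.lo σ.hi, ∀ θ,
    f t (y₁ + 2 * Real.pi) y₂ y₃ θ = f t y₁ y₂ y₃ θ
  periodic_y₂ : ∀ t ∈ Set.Icc 0 T, ∀ y₁ y₂, ∀ y₃ ∈ Set.Icc σ.lo σ.hi, ∀ θ,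
    f t y₁ (y₂ + 2 * Real.pi) y₃ θ = f t y₁ y₂ y₃ θ
  periodic_θ : ∀ t ∈ Set.Icc 0 T, ∀ y₁ y₂, ∀ y₃ ∈ Set.Icc σ.lo σ.hi, ∀ θ,
    f t y₁ y₂ y₃ (θ + 2 * Real.pi) = f t y₁ y₂ y₃ θ

/-- The space `S_⋆^±` of surface wave profiles: smooth functions up to the boundary which decay
exponentially in `Y₃`, together with all their derivatives, at one common rate `δ`. -/
structure MemStar (σ : Side) (T : ℝ) (f : StarFun) : Prop where
  smooth : ContDiffOn ℝ ∞ f.uncurried (starDomain σ T)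
  decay : ∃ δ : ℝ, 0 < δ ∧ ∀ n : ℕ, ∃ C : ℝ, ∀ p ∈ starDomain σ T,
    ‖iteratedFDerivWithin ℝ n f.uncurried (starDomain σ T) p‖
      ≤ C * Real.exp (-(δ * (σ.sgn * p.2.2.2.2.1)))
  periodic_y₁ : ∀ t ∈ Set.Icc 0 T, ∀ y₁ y₂, ∀ y₃ ∈ Set.Icc σ.lo σ.hi, ∀ Y, 0 ≤ σ.sgn * Y → ∀ θ,
    f t (y₁ + 2 * Real.pi) y₂ y₃ Y θ = f t y₁ y₂ y₃ Y θ
  periodic_y₂ : ∀ t ∈ Set.Icc 0 T, ∀ y₁ y₂, ∀ y₃ ∈ Set.Icc σ.lo σ.hi, ∀ Y, 0 ≤ σ.sgn * Y → ∀ θ,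
    f t y₁ (y₂ + 2 * Real.pi) y₃ Y θ = f t y₁ y₂ y₃ Y θ
  periodic_θ : ∀ t ∈ Set.Icc 0 T, ∀ y₁ y₂, ∀ y₃ ∈ Set.Icc σ.lo σ.hi, ∀ Y, 0 ≤ σ.sgn * Y → ∀ θ,
    f t y₁ y₂ y₃ Y (θ + 2 * Real.pi) = f t y₁ y₂ y₃ Y θ

/-! ### Partial derivatives and integrals

The derivatives in `y₃` and `Y₃` are only used at interior points; the time derivative is one-sided
at `t = 0` and `t = T`. -/

/-- `∂_θ` of a function of `(t, y', θ)`. -/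
def FrontFun.dθ (f : FrontFun) : FrontFun :=
  fun t y₁ y₂ θ => deriv (fun s => f t y₁ y₂ s) θ

/-- `∂_{y_j}`, `j = 1, 2`, of a function of `(t, y', θ)`. -/
def FrontFun.dTan (f : FrontFun) : Fin 2 → FrontFun :=
  ![fun t y₁ y₂ θ => deriv (fun s => f t s y₂ θ) y₁,
    fun t y₁ y₂ θ => deriv (fun s => f t y₁ s θ) y₂]

/-- `∂_t` of a function of `(t, y', θ)` on `[0,T]`. -/
def FrontFun.dt (T : ℝ) (f : FrontFun) : FrontFun :=
  fun t y₁ y₂ θ => derivWithin (fun s => f s y₁ y₂ θ) (Set.Icc 0 T) t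

/-- `∂_{y₃}` of a function of `(t, y, θ)`. -/
def ResFun.dy₃ (f : ResFun) : ResFun :=
  fun t y₁ y₂ y₃ θ => deriv (fun s => f t y₁ y₂ s θ) y₃

/-- `∂_{y_α}`, `α = 1, 2, 3`, of a function of `(t, y, Y₃, θ)`. -/
def StarFun.dy (f : StarFun) : Fin 3 → StarFun :=
  ![fun t y₁ y₂ y₃ Y θ => deriv (fun s => f t s y₂ y₃ Y θ) y₁,
    fun t y₁ y₂ y₃ Y θ => deriv (fun s => f t y₁ s y₃ Y θ) y₂,
    fun t y₁ y₂ y₃ Y θ => deriv (fun s => f t y₁ y₂ s Y θ) y₃]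

/-- `∂_{Y₃}` of a function of `(t, y, Y₃, θ)`. -/
def StarFun.dY₃ (f : StarFun) : StarFun :=
  fun t y₁ y₂ y₃ Y θ => deriv (fun s => f t y₁ y₂ y₃ s θ) Y

/-- `∂_θ` of a function of `(t, y, Y₃, θ)`. -/
def StarFun.dθ (f : StarFun) : StarFun :=
  fun t y₁ y₂ y₃ Y θ => deriv (fun s => f t y₁ y₂ y₃ Y s) θ

/-- The mean `c₀` over the fast variable `θ ∈ 𝕋`. -/
def mean (f : ℝ → ℝ) : ℝ :=
  (2 * Real.pi)⁻¹ * ∫ θ in (0 : ℝ)..(2 * Real.pi), f θ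

/-- The integral over `Γ₀ = 𝕋² × {0}`. -/
def integralΓ₀ (f : ℝ → ℝ → ℝ) : ℝ :=
  ∫ y₁ in (0 : ℝ)..(2 * Real.pi), ∫ y₂ in (0 : ℝ)..(2 * Real.pi), f y₁ y₂

/-- The integral over `Ω₀^± = 𝕋² × I^±`. -/
def integralΩ₀ (σ : Side) (f : ℝ → ℝ → ℝ → ℝ) : ℝ :=
  ∫ y₁ in (0 : ℝ)..(2 * Real.pi), ∫ y₂ in (0 : ℝ)..(2 * Real.pi), ∫ y₃ in σ.lo..σ.hi, f y₁ y₂ y₃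

/-! ### The cut-off function and the coefficients `χ^{[ℓ]}`, `χ̇^{[ℓ]}` -/

/-- Smooth cut-off functions, equal to `1` on `[-1/3,1/3]` and to `0` outside `[-2/3,2/3]`. -/
structure IsCutoff (χ : ℝ → ℝ) : Prop where
  smooth : ContDiff ℝ ∞ χ
  eq_one : ∀ x ∈ Set.Icc (-1 / 3 : ℝ) (1 / 3), χ x = 1
  eq_zero : ∀ x ∉ Set.Icc (-2 / 3 : ℝ) (2 / 3), χ x = 0

/-- The formal series in `ε` of `g (y + Z)`, obtained by Taylor expansion of the function `g` at `y`,
for a formal series `Z` without constant term (so that `Zⁿ` does not contribute to the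
coefficients of order `< n`). -/
def formalComp (g : ℝ → ℝ) (y : ℝ) (Z : PowerSeries ℝ) : PowerSeries ℝ :=
  PowerSeries.mk fun k => ∑ n ∈ Finset.range (k + 1),
    iteratedDeriv n g y / (n.factorial : ℝ) * PowerSeries.coeff k (Z ^ n)

/-- Successive approximations of the formal solution `Z` of `Z = χ (y₃ + Z) Ψ`. -/
def shiftApprox (χ : ℝ → ℝ) (y₃ : ℝ) (Ψ : PowerSeries ℝ) : ℕ → PowerSeries ℝ
  | 0 => 0
  | k + 1 => formalComp χ y₃ (shiftApprox χ y₃ Ψ k) * Ψ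

/-- The formal series `Z` such that `x₃ = y₃ + Z` is the formal solution of
`y₃ = x₃ - χ (x₃) Ψ`, where `Ψ` has no constant term. -/
def shift (χ : ℝ → ℝ) (y₃ : ℝ) (Ψ : PowerSeries ℝ) : PowerSeries ℝ :=
  PowerSeries.mk fun k => PowerSeries.coeff k (shiftApprox χ y₃ Ψ k)

theorem X_pow_dvd_formalComp_sub (g : ℝ → ℝ) (y : ℝ) {Z W : PowerSeries ℝ} {N : ℕ}
    (h : PowerSeries.X ^ N ∣ Z - W) :
    PowerSeries.X ^ N ∣ formalComp g y Z - formalComp g y W := by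
  rw [PowerSeries.X_pow_dvd_iff]
  intro k hk
  simp only [formalComp, map_sub, PowerSeries.coeff_mk, ← Finset.sum_sub_distrib, ← mul_sub]
  refine Finset.sum_eq_zero fun n _ => ?_
  have h1 : PowerSeries.X ^ N ∣ Z ^ n - W ^ n := h.trans (sub_dvd_pow_sub_pow Z W n)
  have h2 := (PowerSeries.X_pow_dvd_iff.1 h1) k hk
  rw [map_sub] at h2
  rw [h2, mul_zero]

theorem X_pow_dvd_shiftApprox_sub (χ : ℝ → ℝ) (y₃ : ℝ) {Ψ : PowerSeries ℝ}
    (hΨ : PowerSeries.constantCoeff Ψ = 0) (k : ℕ) :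
    PowerSeries.X ^ (k + 1) ∣ shiftApprox χ y₃ Ψ (k + 1) - shiftApprox χ y₃ Ψ k := by
  have hX : PowerSeries.X ∣ Ψ := PowerSeries.X_dvd_iff.2 hΨ
  induction k with
  | zero =>
    simp only [shiftApprox, sub_zero, zero_add, pow_one]
    exact Dvd.dvd.mul_left hX _
  | succ k ih =>
    have := mul_dvd_mul (X_pow_dvd_formalComp_sub χ y₃ ih) hX
    rw [← pow_succ, sub_mul] at this
    exact this

theorem X_pow_dvd_shift_sub (χ : ℝ → ℝ) (y₃ : ℝ) {Ψ : PowerSeries ℝ}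
    (hΨ : PowerSeries.constantCoeff Ψ = 0) (k : ℕ) :
    PowerSeries.X ^ (k + 1) ∣ shift χ y₃ Ψ - shiftApprox χ y₃ Ψ k := by
  have key : ∀ i j : ℕ, PowerSeries.X ^ (i + 1) ∣
      shiftApprox χ y₃ Ψ (i + j) - shiftApprox χ y₃ Ψ i := by
    intro i j
    induction j with
    | zero => simp
    | succ j ih =>
      have h1 := X_pow_dvd_shiftApprox_sub χ y₃ hΨ (i + j)
      have h2 : (PowerSeries.X : PowerSeries ℝ) ^ (i + 1) ∣
          shiftApprox χ y₃ Ψ (i + j + 1) - shiftApprox χ y₃ Ψ (i + j) :=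
        (pow_dvd_pow _ (by omega)).trans h1
      have := dvd_add h2 ih
      rwa [sub_add_sub_cancel] at this
  rw [PowerSeries.X_pow_dvd_iff]
  intro i hi
  obtain ⟨j, rfl⟩ : ∃ j, k = i + j := ⟨k - i, by omega⟩
  have := (PowerSeries.X_pow_dvd_iff.1 (key i j)) i (by omega)
  simp only [map_sub, shift, PowerSeries.coeff_mk] at this ⊢
  linarith

/-- The series `shift` has no constant term and solves `Z = χ (y₃ + Z) Ψ`. -/
theorem shift_spec (χ : ℝ → ℝ) (y₃ : ℝ) {Ψ : PowerSeries ℝ}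
    (hΨ : PowerSeries.constantCoeff Ψ = 0) :
    PowerSeries.constantCoeff (shift χ y₃ Ψ) = 0 ∧
      shift χ y₃ Ψ = formalComp χ y₃ (shift χ y₃ Ψ) * Ψ := by
  refine ⟨?_, ?_⟩
  · rw [← PowerSeries.coeff_zero_eq_constantCoeff_apply]
    simp [shift, shiftApprox]
  · ext k
    have h1 := X_pow_dvd_shift_sub χ y₃ hΨ (k + 1)
    have h2 := Dvd.dvd.mul_right
      (X_pow_dvd_formalComp_sub χ y₃ (X_pow_dvd_shift_sub χ y₃ hΨ k)) Ψ
    have h3 := (PowerSeries.X_pow_dvd_iff.1 h1) k (by omega)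
    have h4 := (PowerSeries.X_pow_dvd_iff.1 h2) k (by omega)
    rw [sub_mul] at h4
    simp only [map_sub, shiftApprox] at h3 h4
    linarith

/-- The series `∑ ε^ℓ ψ^ℓ(t, y', θ)`. -/
def frontSeries (ψ : ℕ → FrontFun) (t y₁ y₂ θ : ℝ) : PowerSeries ℝ :=
  PowerSeries.mk fun ℓ => ψ ℓ t y₁ y₂ θ

/-- `χ^{[ℓ]}(t, y, θ)`: the coefficient of `ε^ℓ` in `χ(x₃)`, where `y₃ = x₃ - χ(x₃) ∑ ε^ℓ ψ^ℓ`. -/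
def chiCoeff (χ : ℝ → ℝ) (ψ : ℕ → FrontFun) (ℓ : ℕ) : ResFun :=
  fun t y₁ y₂ y₃ θ => PowerSeries.coeff ℓ
    (formalComp χ y₃ (shift χ y₃ (frontSeries ψ t y₁ y₂ θ)))

/-- `χ̇^{[ℓ]}(t, y, θ)`: the coefficient of `ε^ℓ` in `χ'(x₃)`, where `y₃ = x₃ - χ(x₃) ∑ ε^ℓ ψ^ℓ`. -/
def chiDotCoeff (χ : ℝ → ℝ) (ψ : ℕ → FrontFun) (ℓ : ℕ) : ResFun :=
  fun t y₁ y₂ y₃ θ => PowerSeries.coeff ℓ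
    (formalComp (deriv χ) y₃ (shift χ y₃ (frontSeries ψ t y₁ y₂ θ)))

/-! ### Profiles -/

/-- The front profiles: `ψ⁰ = ψ¹ = 0` and `ψ², …, ψ^{m+1}` belong to `H^∞`. -/
structure IsFrontFamily (T : ℝ) (m : ℕ) (ψ : ℕ → FrontFun) : Prop where
  zero : ψ 0 = 0
  one : ψ 1 = 0
  mem : ∀ ℓ, 2 ≤ ℓ → ℓ ≤ m + 1 → MemFront T (ψ ℓ)

/-- A constant state in `ℝ³` and a sequence of profiles with values in `ℝ³` (velocity or magnetic
field on one side), given by their components in `S̲^±` and `S_⋆^±`. -/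
structure VectorProfiles where
  base : Fin 3 → ℝ
  res : ℕ → Fin 3 → ResFun
  star : ℕ → Fin 3 → StarFun

/-- The full profile, an element of `S̲^± ⊕ S_⋆^±`. -/
def VectorProfiles.full (V : VectorProfiles) (ℓ : ℕ) (α : Fin 3) : StarFun :=
  fun t y₁ y₂ y₃ Y θ => V.res ℓ α t y₁ y₂ y₃ θ + V.star ℓ α t y₁ y₂ y₃ Y θ

/-- The profile of order `0` is the constant state, whose normal component vanishes, and the
profiles of orders `1, …, m` belong to `S^± = S̲^± ⊕ S_⋆^±`. -/
structure VectorProfiles.IsAdmissible (V : VectorProfiles) (σ : Side) (T : ℝ) (m : ℕ) : Prop where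
  base_normal : V.base 2 = 0
  res_zero : ∀ α, V.res 0 α = fun _ _ _ _ _ => V.base α
  star_zero : ∀ α, V.star 0 α = 0
  mem_res : ∀ ℓ, 1 ≤ ℓ → ℓ ≤ m → ∀ α, MemRes σ T (V.res ℓ α)
  mem_star : ∀ ℓ, 1 ≤ ℓ → ℓ ≤ m → ∀ α, MemStar σ T (V.star ℓ α)

/-- `∑_{ℓ₁+ℓ₂=n} f ℓ₁ ℓ₂`. -/
def sum₂ (n : ℕ) (f : ℕ → ℕ → ℝ) : ℝ :=
  ∑ p ∈ Finset.HasAntidiagonal.antidiagonal n, f p.1 p.2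

/-- `∑_{ℓ₁+ℓ₂=n, ℓ₂≥1} f ℓ₁ ℓ₂`. -/
def sum₂Pos (n : ℕ) (f : ℕ → ℕ → ℝ) : ℝ :=
  ∑ p ∈ (Finset.HasAntidiagonal.antidiagonal n).filter (fun p => 1 ≤ p.2), f p.1 p.2

/-- `∑_{ℓ₁+ℓ₂+ℓ₃=n} f ℓ₁ ℓ₂ ℓ₃`. -/
def sum₃ (n : ℕ) (f : ℕ → ℕ → ℕ → ℝ) : ℝ :=
  ∑ p ∈ Finset.HasAntidiagonal.antidiagonal n, ∑ q ∈ Finset.HasAntidiagonal.antidiagonal p.2, f p.1 q.1 q.2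

/-- The right hand side of order `k` in the fast divergence constraint: `F₇^{k,±}` when `V` is the
velocity, `F₈^{k,±}` when `V` is the magnetic field. -/
def fastDivSource (χ : ℝ → ℝ) (ξ : Fin 2 → ℝ) (ψ : ℕ → FrontFun) (V : VectorProfiles) (k : ℕ) :
    StarFun :=
  fun t y₁ y₂ y₃ Y θ =>
    -(∑ α : Fin 3, (V.full k α).dy α t y₁ y₂ y₃ Y θ)
    + sum₂ (k + 2) (fun ℓ₁ ℓ₂ => (ψ ℓ₁).dθ t y₁ y₂ θ
        * ∑ j : Fin 2, ξ j * (V.full ℓ₂ j.castSucc).dY₃ t y₁ y₂ y₃ Y θ)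
    + sum₂ (k + 1) (fun ℓ₁ ℓ₂ => ∑ j : Fin 2, (ψ ℓ₁).dTan j t y₁ y₂ θ
        * (V.full ℓ₂ j.castSucc).dY₃ t y₁ y₂ y₃ Y θ)
    + sum₃ (k + 1) (fun ℓ₁ ℓ₂ ℓ₃ => chiCoeff χ ψ ℓ₁ t y₁ y₂ y₃ θ * (ψ ℓ₂).dθ t y₁ y₂ θ
        * ∑ j : Fin 2, ξ j * (V.full ℓ₃ j.castSucc).dy 2 t y₁ y₂ y₃ Y θ)
    + sum₃ k (fun ℓ₁ ℓ₂ ℓ₃ => chiCoeff χ ψ ℓ₁ t y₁ y₂ y₃ θ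
        * ∑ j : Fin 2, (ψ ℓ₂).dTan j t y₁ y₂ θ * (V.full ℓ₃ j.castSucc).dy 2 t y₁ y₂ y₃ Y θ)
    + sum₃ k (fun ℓ₁ ℓ₂ ℓ₃ => chiDotCoeff χ ψ ℓ₁ t y₁ y₂ y₃ θ * ψ ℓ₂ t y₁ y₂ θ
        * (V.full ℓ₃ 2).dy 2 t y₁ y₂ y₃ Y θ)

/-- The fast divergence constraints
`∂_{Y₃} V₃^μ + ξ_j ∂_θ V_j^μ = (source of order μ - 1)` for `μ = 1, …, m`, written with
`μ = k + 1`. -/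
def FastDivergence (χ : ℝ → ℝ) (ξ : Fin 2 → ℝ) (ψ : ℕ → FrontFun) (V : VectorProfiles)
    (σ : Side) (T : ℝ) (m : ℕ) : Prop :=
  ∀ k < m, ∀ t ∈ Set.Icc 0 T, ∀ y₁ y₂ : ℝ, ∀ y₃ ∈ Set.Ioo σ.lo σ.hi,
    ∀ Y : ℝ, 0 < σ.sgn * Y → ∀ θ : ℝ,
      (V.full (k + 1) 2).dY₃ t y₁ y₂ y₃ Y θ
          + ∑ j : Fin 2, ξ j * (V.full (k + 1) j.castSucc).dθ t y₁ y₂ y₃ Y θ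
        = fastDivSource χ ξ ψ V k t y₁ y₂ y₃ Y θ

/-- `w(t, y, Y₃)` is the fast mean (in `θ`) of the normal component of the corrector of order
`m + 1`: the (unique) solution in `S_⋆^±` of `∂_{Y₃} w = c₀ (source of order m)`. -/
structure IsNormalFastMean (χ : ℝ → ℝ) (ξ : Fin 2 → ℝ) (ψ : ℕ → FrontFun) (V : VectorProfiles)
    (σ : Side) (T : ℝ) (m : ℕ) (w : ℝ → ℝ → ℝ → ℝ → ℝ → ℝ) : Prop where
  mem : MemStar σ T (fun t y₁ y₂ y₃ Y _ => w t y₁ y₂ y₃ Y)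
  eqn : ∀ t ∈ Set.Icc 0 T, ∀ y₁ y₂ : ℝ, ∀ y₃ ∈ Set.Ioo σ.lo σ.hi, ∀ Y : ℝ, 0 < σ.sgn * Y →
    deriv (fun s => w t y₁ y₂ y₃ s) Y
      = mean (fun θ => fastDivSource χ ξ ψ V m t y₁ y₂ y₃ Y θ)

/-! ### The source terms of the slow mean problem -/

/-- The interior divergence source term for the slow mean of order `m + 1`: `𝔽₇^{m,±}` when `V` is
the velocity, `𝔽₈^{m,±}` when `V` is the magnetic field. -/
def slowDivSource (χ : ℝ → ℝ) (ξ : Fin 2 → ℝ) (ψ : ℕ → FrontFun) (V : VectorProfiles) (m : ℕ)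
    (t y₁ y₂ y₃ : ℝ) : ℝ :=
  mean fun θ =>
    sum₃ (m + 2) (fun ℓ₁ ℓ₂ ℓ₃ => chiCoeff χ ψ ℓ₁ t y₁ y₂ y₃ θ * (ψ ℓ₂).dθ t y₁ y₂ θ
        * ∑ j : Fin 2, ξ j * (V.res ℓ₃ j.castSucc).dy₃ t y₁ y₂ y₃ θ)
    + sum₃ (m + 1) (fun ℓ₁ ℓ₂ ℓ₃ => chiCoeff χ ψ ℓ₁ t y₁ y₂ y₃ θ
        * ∑ j : Fin 2, (ψ ℓ₂).dTan j t y₁ y₂ θ * (V.res ℓ₃ j.castSucc).dy₃ t y₁ y₂ y₃ θ)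
    + sum₃ (m + 1) (fun ℓ₁ ℓ₂ ℓ₃ => chiDotCoeff χ ψ ℓ₁ t y₁ y₂ y₃ θ * ψ ℓ₂ t y₁ y₂ θ
        * (V.res ℓ₃ 2).dy₃ t y₁ y₂ y₃ θ)

/-- The jump source term `G₂^{m,±}` (for `V` the magnetic field), which is also the part of
`G₁^{m,±}` (for `V` the velocity) without time derivative. -/
def jumpSource (ξ : Fin 2 → ℝ) (ψ : ℕ → FrontFun) (V : VectorProfiles) (m : ℕ) : FrontFun :=
  fun t y₁ y₂ θ =>
    ∑ j : Fin 2, V.base j.castSucc * (ψ (m + 1)).dTan j t y₁ y₂ θ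
    + sum₂Pos (m + 2) (fun ℓ₁ ℓ₂ => (ψ ℓ₁).dθ t y₁ y₂ θ
        * ∑ j : Fin 2, ξ j * V.full ℓ₂ j.castSucc t y₁ y₂ 0 0 θ)
    + sum₂Pos (m + 1) (fun ℓ₁ ℓ₂ => ∑ j : Fin 2, (ψ ℓ₁).dTan j t y₁ y₂ θ
        * V.full ℓ₂ j.castSucc t y₁ y₂ 0 0 θ)

/-- The jump source term `G₁^{m,±}`, for `u` the velocity. -/
def jumpSourceVelocity (T : ℝ) (ξ : Fin 2 → ℝ) (ψ : ℕ → FrontFun) (u : VectorProfiles) (m : ℕ) :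
    FrontFun :=
  fun t y₁ y₂ θ => (ψ (m + 1)).dt T t y₁ y₂ θ + jumpSource ξ ψ u m t y₁ y₂ θ

/-- `𝔾₁^{m,±} = Ĝ₁^{m,±}(0) - û_{3,⋆}^{m+1,±}(0)|_{y₃=Y₃=0}`. -/
def slowJump₁ (T : ℝ) (ξ : Fin 2 → ℝ) (ψ : ℕ → FrontFun) (u : VectorProfiles) (m : ℕ)
    (w : ℝ → ℝ → ℝ → ℝ → ℝ → ℝ) (t y₁ y₂ : ℝ) : ℝ :=
  mean (fun θ => jumpSourceVelocity T ξ ψ u m t y₁ y₂ θ) - w t y₁ y₂ 0 0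

/-- `𝔾₂^{m,±} = Ĝ₂^{m,±}(0) - Ĥ_{3,⋆}^{m+1,±}(0)|_{y₃=Y₃=0}`. -/
def slowJump₂ (ξ : Fin 2 → ℝ) (ψ : ℕ → FrontFun) (H : VectorProfiles) (m : ℕ)
    (w : ℝ → ℝ → ℝ → ℝ → ℝ → ℝ) (t y₁ y₂ : ℝ) : ℝ :=
  mean (fun θ => jumpSource ξ ψ H m t y₁ y₂ θ) - w t y₁ y₂ 0 0

/-- The quantity `∫_{Ω₀^±} 𝔽₇^{m,±} dy ± ∫_{Γ₀} 𝔾₁^{m,±} dy'` at time `t`. -/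
def velocityFlux (σ : Side) (T : ℝ) (χ : ℝ → ℝ) (ξ : Fin 2 → ℝ) (ψ : ℕ → FrontFun)
    (u : VectorProfiles) (m : ℕ) (w : ℝ → ℝ → ℝ → ℝ → ℝ → ℝ) (t : ℝ) : ℝ :=
  integralΩ₀ σ (fun y₁ y₂ y₃ => slowDivSource χ ξ ψ u m t y₁ y₂ y₃)
    + σ.sgn * integralΓ₀ (fun y₁ y₂ => slowJump₁ T ξ ψ u m w t y₁ y₂)

/-- The quantity `∫_{Ω₀^±} 𝔽₈^{m,±} dy ± ∫_{Γ₀} 𝔾₂^{m,±} dy'` at time `t`. -/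
def magneticFlux (σ : Side) (χ : ℝ → ℝ) (ξ : Fin 2 → ℝ) (ψ : ℕ → FrontFun)
    (H : VectorProfiles) (m : ℕ) (w : ℝ → ℝ → ℝ → ℝ → ℝ → ℝ) (t : ℝ) : ℝ :=
  integralΩ₀ σ (fun y₁ y₂ y₃ => slowDivSource χ ξ ψ H m t y₁ y₂ y₃)
    + σ.sgn * integralΓ₀ (fun y₁ y₂ => slowJump₂ ξ ψ H m w t y₁ y₂)

/-- The Fredholm condition on one side: the quantity
`∫_{Ω₀^±} 𝔽₇^{m,±} dy ± ∫_{Γ₀} 𝔾₁^{m,±} dy'` has zero time derivative on `[0,T]`. -/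
def Fredholm (σ : Side) (T : ℝ) (χ : ℝ → ℝ) (ξ : Fin 2 → ℝ) (ψ : ℕ → FrontFun)
    (u : VectorProfiles) (m : ℕ) (w : ℝ → ℝ → ℝ → ℝ → ℝ → ℝ) : Prop :=
  ∀ t ∈ Set.Icc 0 T, HasDerivWithinAt (velocityFlux σ T χ ξ ψ u m w) 0 (Set.Icc 0 T) t

/-- `∫_{Γ₀} ∂_t f̂(0) dy'` at time `t`, with `f̂(0)` the mean of `f` in `θ`. -/
def slowMeanRate (T : ℝ) (f : FrontFun) (t : ℝ) : ℝ :=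
  integralΓ₀ fun y₁ y₂ => derivWithin (fun s => mean (fun θ => f s y₁ y₂ θ)) (Set.Icc 0 T) t

/-- `∫_{Γ₀ × 𝕋} f(t, y', θ) dy' dθ`. -/
def totalMean (f : FrontFun) (t : ℝ) : ℝ :=
  integralΓ₀ fun y₁ y₂ => ∫ θ in (0 : ℝ)..(2 * Real.pi), f t y₁ y₂ θ

/-- The second time derivative of `∫_{Γ₀ × 𝕋} f dy' dθ` vanishes on `[0,T]`. -/
def TotalMeanAffine (T : ℝ) (f : FrontFun) : Prop :=
  ∀ t ∈ Set.Icc 0 T,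
    HasDerivWithinAt (fun s => derivWithin (totalMean f) (Set.Icc 0 T) s) 0 (Set.Icc 0 T) t

end VortexSheet

end

/-! All sources are coefficients of formal series in ε. Let Ψ = ∑ ε^ℓ ψ^ℓ, let x₃ = y₃ + Z solve Z =
χ(x₃)Ψ, let J = ∂x₃/∂y₃ = (1 - χ'(x₃)Ψ)⁻¹, and let s_j = (ξ_j ∂_θ + ε ∂_j)Ψ be the slopes. The proof
shows that the interior integral and the integral over Γ₀ are two evaluations of the same mean
fluxes ∑ s_j V_j through the front, so that they cancel except for ∂_t ψ^{m+1}.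

Interior term. Letting |Y₃| → ∞ in the fast divergence constraints removes the surface waves and
leaves B = O(ε^{m+1}), where B is ε times the divergence of the residual series in straightened
variables (`residual_constraint`, `coeff_formalDiv`). With residual profiles cut off beyond order m,
the coefficient of B at order m+2 is minus the integrand of 𝔽. Since Ψ = O(ε²), also J = 1 + O(ε²),
so JB and B have the same coefficient at order m+2. Moreover JB is a divergence: this is the Piola
identity, that is, the symmetry of the second derivatives of x₃ (`psHasDerivAt_jacobian`,
`psHasDerivAt_jacobian_mul`). Hence 𝔽 is the θ-mean of a divergence (`slowDivIntegrand_eq`).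
Periodicity kills the tangential and fast fluxes, χ kills the normal flux at y₃ = ±1, and at y₃ = 0,
where χ = J = 1, there remains ∓ the mean of the order m+2 coefficient of ∑ s_j V_j, with V_j
residual (`integral_slowDivSource`).

Surface waves. For |y₃| < 1/3 one has χ = 1 and χ' = 0 to all orders. There the torus mean of
V_{3,⋆}^k minus the order k+1 coefficient of ∑ s_j V_{j,⋆} vanishes, by induction on k: by the
constraint its Y₃-derivative is the mean of a residual source, hence independent of Y₃, and a
function of Y₃ with constant derivative that decays is zero (`torusInt_starDefect_succ`). The same
step applied to the corrector of order m+1 gives its mean at y₃ = Y₃ = 0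
(`torusInt_normalFastMean`).

Conclusion. Up to a multiple of ∂_θ ψ^{m+2}, which has zero mean, the jump source is the order m+2
coefficient of ∑ s_j V_j with V_j the full profile (`jumpSource_eq`). Its residual half cancels the
interior integral, its surface half cancels the corrector, and the time derivative of the front
remains in the velocity case. The value is σ(2π)⁻¹ times d/dt of the total mean of ψ^{m+1}, which
gives the equivalence on either side alone (`fredholm_iff`). Fronts beyond m+1 and profiles beyond m
are arbitrary in the data, so they are first replaced by zero, which changes none of the sources
(`isSmoothFamily_trunc`). -/

open scoped ContDiff

noncomputable section

namespace VortexSheet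

open Set Function

/-! ### Differentiation and integration on slabs `I × 𝕋³` -/

/-- The integral over `𝕋² × 𝕋` of a function of `(y₁, y₂, θ)`. -/
def torusInt (f : ℝ → ℝ → ℝ → ℝ) : ℝ :=
  ∫ y₁ in (0 : ℝ)..(2 * Real.pi), ∫ y₂ in (0 : ℝ)..(2 * Real.pi),
    ∫ θ in (0 : ℝ)..(2 * Real.pi), f y₁ y₂ θ

/-- The points of `ℝ⁴` whose first coordinate lies in `I`. -/
def slab (I : Set ℝ) : Set (ℝ × ℝ × ℝ × ℝ) :=
  {p | p.1 ∈ I}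

/-- The uncurried form of a function of four variables. -/
def FrontFun.uncurried (f : FrontFun) : ℝ × ℝ × ℝ × ℝ → ℝ :=
  fun p => f p.1 p.2.1 p.2.2.1 p.2.2.2

/-- The derivative along `I` in the first variable. -/
def FrontFun.dFirst (I : Set ℝ) (f : FrontFun) : FrontFun :=
  fun s y₁ y₂ θ => derivWithin (fun r => f r y₁ y₂ θ) I s

theorem uniqueDiffOn_slab {a b : ℝ} (hab : a < b) : UniqueDiffOn ℝ (slab (Icc a b)) := by
  have : slab (Icc a b) = Icc a b ×ˢ (univ : Set (ℝ × ℝ × ℝ)) := by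
    ext p; simp [slab]
  rw [this]
  exact (uniqueDiffOn_Icc hab).prod uniqueDiffOn_univ

/-- Restriction to a coordinate line expresses each partial derivative, one-sided or not, through
the Fréchet derivative within the domain, whose regularity is known up to the boundary. -/
theorem hasDerivWithinAt_comp_curve {E : Type*} [NormedAddCommGroup E] [NormedSpace ℝ E]
    {f : E → ℝ} {S : Set E} (hf : DifferentiableOn ℝ f S) {c : ℝ → E} {v : E} {r : ℝ} {I : Set ℝ}
    (hc : HasDerivWithinAt c v I r) (hm : MapsTo c I S) (hr : r ∈ I) :
    HasDerivWithinAt (fun x => f (c x)) (fderivWithin ℝ f S (c r) v) I r :=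
  (hf _ (hm hr)).hasFDerivWithinAt.comp_hasDerivWithinAt r hc hm

theorem contDiffOn_fderivWithin_apply {E : Type*} [NormedAddCommGroup E] [NormedSpace ℝ E]
    {f : E → ℝ} {S : Set E} (hS : UniqueDiffOn ℝ S) {k n : WithTop ℕ∞} (hf : ContDiffOn ℝ n f S)
    (hk : k + 1 ≤ n) (v : E) : ContDiffOn ℝ k (fun p => fderivWithin ℝ f S p v) S :=
  (hf.fderivWithin hS hk).clm_apply contDiffOn_const

section Slab

variable {a b : ℝ} {f : FrontFun} {k n : WithTop ℕ∞}

theorem hasDerivWithinAt_first (hf : ContDiffOn ℝ n f.uncurried (slab (Icc a b))) (hn : n ≠ 0)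
    {s : ℝ} (hs : s ∈ Icc a b) (y₁ y₂ θ : ℝ) :
    HasDerivWithinAt (fun r => f r y₁ y₂ θ)
      (fderivWithin ℝ f.uncurried (slab (Icc a b)) (s, y₁, y₂, θ) (1, 0, 0, 0)) (Icc a b) s :=
  hasDerivWithinAt_comp_curve (hf.differentiableOn hn) (c := fun r => (r, y₁, y₂, θ))
    (((hasDerivAt_id s).prodMk (hasDerivAt_const s (y₁, y₂, θ))).hasDerivWithinAt)
    (fun _ h => h) hs

theorem hasDerivAt_snd (hf : ContDiffOn ℝ n f.uncurried (slab (Icc a b))) (hn : n ≠ 0)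
    {s : ℝ} (hs : s ∈ Icc a b) (y₁ y₂ θ : ℝ) :
    HasDerivAt (fun r => f s r y₂ θ)
      (fderivWithin ℝ f.uncurried (slab (Icc a b)) (s, y₁, y₂, θ) (0, 1, 0, 0)) y₁ := by
  rw [← hasDerivWithinAt_univ]
  exact hasDerivWithinAt_comp_curve (hf.differentiableOn hn) (c := fun r => (s, r, y₂, θ))
    (((hasDerivAt_const y₁ s).prodMk
      ((hasDerivAt_id y₁).prodMk (hasDerivAt_const y₁ (y₂, θ)))).hasDerivWithinAt)
    (fun _ _ => hs) (mem_univ _)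

theorem hasDerivAt_third (hf : ContDiffOn ℝ n f.uncurried (slab (Icc a b))) (hn : n ≠ 0)
    {s : ℝ} (hs : s ∈ Icc a b) (y₁ y₂ θ : ℝ) :
    HasDerivAt (fun r => f s y₁ r θ)
      (fderivWithin ℝ f.uncurried (slab (Icc a b)) (s, y₁, y₂, θ) (0, 0, 1, 0)) y₂ := by
  rw [← hasDerivWithinAt_univ]
  exact hasDerivWithinAt_comp_curve (hf.differentiableOn hn) (c := fun r => (s, y₁, r, θ))
    (((hasDerivAt_const y₂ s).prodMk ((hasDerivAt_const y₂ y₁).prodMk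
      ((hasDerivAt_id y₂).prodMk (hasDerivAt_const y₂ θ)))).hasDerivWithinAt)
    (fun _ _ => hs) (mem_univ _)

theorem hasDerivAt_fourth (hf : ContDiffOn ℝ n f.uncurried (slab (Icc a b))) (hn : n ≠ 0)
    {s : ℝ} (hs : s ∈ Icc a b) (y₁ y₂ θ : ℝ) :
    HasDerivAt (fun r => f s y₁ y₂ r)
      (fderivWithin ℝ f.uncurried (slab (Icc a b)) (s, y₁, y₂, θ) (0, 0, 0, 1)) θ := by
  rw [← hasDerivWithinAt_univ]
  exact hasDerivWithinAt_comp_curve (hf.differentiableOn hn) (c := fun r => (s, y₁, y₂, r))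
    (((hasDerivAt_const θ s).prodMk ((hasDerivAt_const θ y₁).prodMk
      ((hasDerivAt_const θ y₂).prodMk (hasDerivAt_id θ)))).hasDerivWithinAt)
    (fun _ _ => hs) (mem_univ _)

theorem contDiffOn_dFirst (hab : a < b) (hf : ContDiffOn ℝ n f.uncurried (slab (Icc a b)))
    (hk : k + 1 ≤ n) : ContDiffOn ℝ k (f.dFirst (Icc a b)).uncurried (slab (Icc a b)) :=
  (contDiffOn_fderivWithin_apply (uniqueDiffOn_slab hab) hf hk (1, 0, 0, 0)).congr fun p hp =>
    (hasDerivWithinAt_first hf (by rintro rfl; simp at hk) hp _ _ _).derivWithin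
      (uniqueDiffOn_Icc hab _ hp)

theorem contDiffOn_dTan (hab : a < b) (hf : ContDiffOn ℝ n f.uncurried (slab (Icc a b)))
    (hk : k + 1 ≤ n) (j : Fin 2) :
    ContDiffOn ℝ k (f.dTan j).uncurried (slab (Icc a b)) := by
  have hn : n ≠ 0 := by rintro rfl; simp at hk
  fin_cases j
  · exact (contDiffOn_fderivWithin_apply (uniqueDiffOn_slab hab) hf hk (0, 1, 0, 0)).congr
      fun p hp => (hasDerivAt_snd hf hn hp _ _ _).deriv
  · exact (contDiffOn_fderivWithin_apply (uniqueDiffOn_slab hab) hf hk (0, 0, 1, 0)).congr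
      fun p hp => (hasDerivAt_third hf hn hp _ _ _).deriv

theorem contDiffOn_dθ (hab : a < b) (hf : ContDiffOn ℝ n f.uncurried (slab (Icc a b)))
    (hk : k + 1 ≤ n) : ContDiffOn ℝ k f.dθ.uncurried (slab (Icc a b)) :=
  (contDiffOn_fderivWithin_apply (uniqueDiffOn_slab hab) hf hk (0, 0, 0, 1)).congr fun p hp =>
    (hasDerivAt_fourth hf (by rintro rfl; simp at hk) hp _ _ _).deriv

end Slab

/-! ### Differentiation under the integral sign, integrals over the torus, divergence theorem. -/

/-- The retraction of `ℝ` onto `[a, b]`. -/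
def clamp (a b s : ℝ) : ℝ := max a (min b s)

theorem continuous_clamp (a b : ℝ) : Continuous (clamp a b) := by
  unfold clamp; fun_prop

theorem clamp_mem {a b : ℝ} (hab : a ≤ b) (s : ℝ) : clamp a b s ∈ Icc a b :=
  ⟨le_max_left _ _, max_le hab (min_le_left _ _)⟩

theorem clamp_of_mem {a b s : ℝ} (hs : s ∈ Icc a b) : clamp a b s = s := by
  simp [clamp, hs.1, hs.2]

theorem integral_swap_of_continuous {g : ℝ → ℝ → ℝ}
    (hg : Continuous fun p : ℝ × ℝ => g p.1 p.2) (a b c d : ℝ) :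
    ∫ x in a..b, ∫ y in c..d, g x y = ∫ y in c..d, ∫ x in a..b, g x y := by
  rw [MeasureTheory.intervalIntegral_intervalIntegral_swap]
  exact (hg.continuousOn.integrableOn_compact (isCompact_uIcc.prod isCompact_uIcc)).mono_set
    (prod_mono uIoc_subset_uIcc uIoc_subset_uIcc)

/-- Fubini replaces dominated convergence: the increment of the integral from `a` to `r` is the
integral of `φ` over [a, r]. Clamping extends `f'` continuously to all of ℝ, so the fundamental
theorem of calculus also gives the one-sided derivatives at the end points. -/
theorem hasDerivWithinAt_intervalIntegral {a b c d : ℝ} (hab : a < b) {f f' : ℝ → ℝ → ℝ}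
    (hf : ∀ s ∈ Icc a b, Continuous (f s))
    (hf' : Continuous fun p : ℝ × ℝ => f' (clamp a b p.1) p.2)
    (h : ∀ s ∈ Icc a b, ∀ x, HasDerivWithinAt (fun r => f r x) (f' s x) (Icc a b) s)
    {s : ℝ} (hs : s ∈ Icc a b) :
    HasDerivWithinAt (fun r => ∫ x in c..d, f r x) (∫ x in c..d, f' s x) (Icc a b) s := by
  set φ : ℝ → ℝ := fun r => ∫ x in c..d, f' (clamp a b r) x with hφ
  have hφc : Continuous φ :=
    intervalIntegral.continuous_parametric_intervalIntegral_of_continuous' hf' c d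
  have key : ∀ r ∈ Icc a b, ∫ x in c..d, f r x = (∫ x in c..d, f a x) + ∫ q in a..r, φ q := by
    intro r hr
    have h1 : ∫ q in a..r, φ q = ∫ x in c..d, ∫ q in a..r, f' (clamp a b q) x := by
      rw [hφ, integral_swap_of_continuous hf']
    have h2 : ∀ x, ∫ q in a..r, f' (clamp a b q) x = f r x - f a x := by
      intro x
      refine intervalIntegral.integral_eq_sub_of_hasDerivAt_of_le (f := fun q => f q x) hr.1
        (fun q hq => ((h q ⟨hq.1, hq.2.trans hr.2⟩ x).continuousWithinAt).mono
          (Icc_subset_Icc_right hr.2)) (fun q hq => ?_) ?_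
      · have hq' : q ∈ Icc a b := ⟨hq.1.le, hq.2.le.trans hr.2⟩
        rw [clamp_of_mem hq']
        exact (h q hq' x).hasDerivAt (Icc_mem_nhds hq.1 (hq.2.trans_le hr.2))
      · exact (hf'.comp (by fun_prop : Continuous fun q => (q, x))).intervalIntegrable _ _
    rw [h1]
    simp only [h2]
    rw [intervalIntegral.integral_sub ((hf r hr).intervalIntegrable _ _)
      ((hf a (left_mem_Icc.2 hab.le)).intervalIntegrable _ _)]
    ring
  have h3 : HasDerivAt (fun r => (∫ x in c..d, f a x) + ∫ q in a..r, φ q) (φ s) s :=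
    (hφc.integral_hasStrictDerivAt a s).hasDerivAt.const_add _
  have h4 : φ s = ∫ x in c..d, f' s x := by simp only [hφ, clamp_of_mem hs]
  rw [← h4]
  exact h3.hasDerivWithinAt.congr key (key s hs)

theorem continuous_clamp_of_continuousOn {a b : ℝ} (hab : a ≤ b) {f : FrontFun}
    (hf : ContinuousOn f.uncurried (slab (Icc a b))) :
    Continuous fun p : ℝ × ℝ × ℝ × ℝ => f (clamp a b p.1) p.2.1 p.2.2.1 p.2.2.2 := by
  have h : Continuous fun p : ℝ × ℝ × ℝ × ℝ => (clamp a b p.1, p.2.1, p.2.2.1, p.2.2.2) := by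
    have := continuous_clamp a b
    fun_prop
  exact hf.comp_continuous h fun p => clamp_mem hab _

theorem continuous_of_slab {a b : ℝ} {f : FrontFun}
    (hf : ContinuousOn f.uncurried (slab (Icc a b))) {s : ℝ} (hs : s ∈ Icc a b) :
    Continuous fun p : ℝ × ℝ × ℝ => f s p.1 p.2.1 p.2.2 :=
  hf.comp_continuous (by fun_prop : Continuous fun p : ℝ × ℝ × ℝ => (s, p)) fun _ => hs

theorem continuous_integral_last {X : Type*} [TopologicalSpace X] [FirstCountableTopology X]
    {g : X → ℝ → ℝ} (hg : Continuous fun p : X × ℝ => g p.1 p.2) (c d : ℝ) :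
    Continuous fun x => ∫ θ in c..d, g x θ :=
  intervalIntegral.continuous_parametric_intervalIntegral_of_continuous' hg c d

theorem continuous_torusInt {X : Type*} [TopologicalSpace X] [FirstCountableTopology X]
    {g : X → ℝ → ℝ → ℝ → ℝ}
    (hg : Continuous fun p : X × ℝ × ℝ × ℝ => g p.1 p.2.1 p.2.2.1 p.2.2.2) :
    Continuous fun x => torusInt (g x) := by
  unfold torusInt
  refine continuous_integral_last (continuous_integral_last (X := X × ℝ)
    (g := fun p y₂ => ∫ θ in (0:ℝ)..(2 * Real.pi), g p.1 p.2 y₂ θ)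
    (continuous_integral_last (X := (X × ℝ) × ℝ) (g := fun p θ => g p.1.1 p.1.2 p.2 θ) ?_ _ _) _ _)
    _ _
  exact hg.comp (by fun_prop : Continuous fun p : ((X × ℝ) × ℝ) × ℝ =>
    (p.1.1.1, p.1.1.2, p.1.2, p.2))

section TorusInt

variable {f g : ℝ → ℝ → ℝ → ℝ}

/-- Joint continuity of a function of three variables. -/
def Cont3 (f : ℝ → ℝ → ℝ → ℝ) : Prop :=
  Continuous fun p : ℝ × ℝ × ℝ => f p.1 p.2.1 p.2.2

theorem Cont3.inner (hf : Cont3 f) (y₁ y₂ : ℝ) : Continuous (f y₁ y₂) :=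
  Continuous.comp (g := fun p : ℝ × ℝ × ℝ => f p.1 p.2.1 p.2.2) hf
    (by fun_prop : Continuous fun θ : ℝ => (y₁, y₂, θ))

theorem Cont3.integral_θ (hf : Cont3 f) (c d : ℝ) :
    Continuous fun p : ℝ × ℝ => ∫ θ in c..d, f p.1 p.2 θ :=
  continuous_integral_last (g := fun (p : ℝ × ℝ) θ => f p.1 p.2 θ)
    (Continuous.comp hf (by fun_prop : Continuous fun q : (ℝ × ℝ) × ℝ => (q.1.1, q.1.2, q.2))) c d

theorem Cont3.integral_y₂ (hf : Cont3 f) (c d c' d' : ℝ) :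
    Continuous fun y₁ : ℝ => ∫ y₂ in c'..d', ∫ θ in c..d, f y₁ y₂ θ :=
  continuous_integral_last (g := fun y₁ y₂ => ∫ θ in c..d, f y₁ y₂ θ) (hf.integral_θ c d) c' d'

theorem Cont3.add (hf : Cont3 f) (hg : Cont3 g) :
    Cont3 fun y₁ y₂ θ => f y₁ y₂ θ + g y₁ y₂ θ :=
  Continuous.add hf hg

theorem Cont3.sub (hf : Cont3 f) (hg : Cont3 g) :
    Cont3 fun y₁ y₂ θ => f y₁ y₂ θ - g y₁ y₂ θ :=
  Continuous.sub hf hg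

theorem Cont3.mul (hf : Cont3 f) (hg : Cont3 g) :
    Cont3 fun y₁ y₂ θ => f y₁ y₂ θ * g y₁ y₂ θ :=
  Continuous.mul hf hg

theorem cont3_const (c : ℝ) : Cont3 fun _ _ _ => c :=
  continuous_const

theorem cont3_sum {ι : Type*} (s : Finset ι) {F : ι → ℝ → ℝ → ℝ → ℝ} (h : ∀ i ∈ s, Cont3 (F i)) :
    Cont3 fun y₁ y₂ θ => ∑ i ∈ s, F i y₁ y₂ θ :=
  continuous_finsetSum s h

theorem torusInt_add (hf : Cont3 f) (hg : Cont3 g) :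
    torusInt (fun y₁ y₂ θ => f y₁ y₂ θ + g y₁ y₂ θ) = torusInt f + torusInt g := by
  unfold torusInt
  simp only [intervalIntegral.integral_add ((hf.inner _ _).intervalIntegrable _ _)
    ((hg.inner _ _).intervalIntegrable _ _)]
  have h : ∀ {F : ℝ → ℝ → ℝ → ℝ}, Cont3 F → ∀ y₁ : ℝ, Continuous fun y₂ : ℝ =>
      ∫ θ in (0 : ℝ)..(2 * Real.pi), F y₁ y₂ θ := fun hF y₁ =>
    (hF.integral_θ _ _).comp (by fun_prop : Continuous fun y₂ : ℝ => (y₁, y₂))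
  simp only [intervalIntegral.integral_add ((h hf _).intervalIntegrable _ _)
    ((h hg _).intervalIntegrable _ _)]
  exact intervalIntegral.integral_add ((hf.integral_y₂ _ _ _ _).intervalIntegrable _ _)
    ((hg.integral_y₂ _ _ _ _).intervalIntegrable _ _)

theorem torusInt_const_mul (c : ℝ) (f : ℝ → ℝ → ℝ → ℝ) :
    torusInt (fun y₁ y₂ θ => c * f y₁ y₂ θ) = c * torusInt f := by
  unfold torusInt
  simp only [intervalIntegral.integral_const_mul]

theorem torusInt_neg (f : ℝ → ℝ → ℝ → ℝ) :
    torusInt (fun y₁ y₂ θ => -f y₁ y₂ θ) = -torusInt f := by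
  simpa using torusInt_const_mul (-1) f

theorem torusInt_sub (hf : Cont3 f) (hg : Cont3 g) :
    torusInt (fun y₁ y₂ θ => f y₁ y₂ θ - g y₁ y₂ θ) = torusInt f - torusInt g := by
  have := torusInt_add (f := f) (g := fun y₁ y₂ θ => -g y₁ y₂ θ) hf (Continuous.neg hg)
  rw [torusInt_neg] at this
  simpa [sub_eq_add_neg] using this

theorem torusInt_zero : torusInt (fun _ _ _ => 0) = 0 := by
  simp [torusInt]

theorem torusInt_congr (h : ∀ y₁ y₂ θ, f y₁ y₂ θ = g y₁ y₂ θ) : torusInt f = torusInt g := by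
  congr 1; funext y₁ y₂ θ; exact h y₁ y₂ θ

theorem torusInt_sum {ι : Type*} (s : Finset ι) {F : ι → ℝ → ℝ → ℝ → ℝ}
    (h : ∀ i ∈ s, Cont3 (F i)) :
    torusInt (fun y₁ y₂ θ => ∑ i ∈ s, F i y₁ y₂ θ) = ∑ i ∈ s, torusInt (F i) := by
  classical
  induction s using Finset.induction_on with
  | empty => simp [torusInt_zero]
  | insert i s hi ih =>
    simp only [Finset.sum_insert hi]
    rw [torusInt_add (h i (Finset.mem_insert_self _ _))
      (cont3_sum s fun k hk => h k (Finset.mem_insert_of_mem hk)),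
      ih fun k hk => h k (Finset.mem_insert_of_mem hk)]

theorem abs_torusInt_le {C : ℝ} (h : ∀ y₁ ∈ Icc (0 : ℝ) (2 * Real.pi),
    ∀ y₂ ∈ Icc (0 : ℝ) (2 * Real.pi), ∀ θ ∈ Icc (0 : ℝ) (2 * Real.pi), |f y₁ y₂ θ| ≤ C) :
    |torusInt f| ≤ C * (2 * Real.pi) * (2 * Real.pi) * (2 * Real.pi) := by
  have key : ∀ {F : ℝ → ℝ} {K : ℝ}, (∀ x ∈ Icc (0 : ℝ) (2 * Real.pi), |F x| ≤ K) →
      |∫ x in (0 : ℝ)..(2 * Real.pi), F x| ≤ K * (2 * Real.pi) := by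
    intro F K hF
    have := intervalIntegral.norm_integral_le_of_norm_le_const (a := 0) (b := 2 * Real.pi)
      (f := F) (C := K) fun x hx => hF x (by
        rw [uIoc_of_le Real.two_pi_pos.le] at hx
        exact Ioc_subset_Icc_self hx)
    rwa [sub_zero, abs_of_pos Real.two_pi_pos] at this
  exact key fun y₁ h₁ => key fun y₂ h₂ => key fun θ h₃ => h y₁ h₁ y₂ h₂ θ h₃

theorem integralΓ₀_mean (f : ℝ → ℝ → ℝ → ℝ) :
    integralΓ₀ (fun y₁ y₂ => mean (fun θ => f y₁ y₂ θ)) = (2 * Real.pi)⁻¹ * torusInt f := by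
  unfold integralΓ₀ mean torusInt
  simp only [intervalIntegral.integral_const_mul]

/-- Functions of `(y₁, y₂, θ)` which are `2π`-periodic in every variable. -/
structure Periodic3 (f : ℝ → ℝ → ℝ → ℝ) : Prop where
  y₁ : ∀ y₁ y₂ θ, f (y₁ + 2 * Real.pi) y₂ θ = f y₁ y₂ θ
  y₂ : ∀ y₁ y₂ θ, f y₁ (y₂ + 2 * Real.pi) θ = f y₁ y₂ θ
  θ : ∀ y₁ y₂ θ, f y₁ y₂ (θ + 2 * Real.pi) = f y₁ y₂ θ

/-- The innermost integral is a difference of values at two points a period apart. In the two lemmas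
that follow, Fubini first brings the differentiated variable inside. -/
theorem torusInt_deriv_θ (hp : Periodic3 f) (hg : Cont3 g)
    (h : ∀ y₁ y₂ θ, HasDerivAt (fun r => f y₁ y₂ r) (g y₁ y₂ θ) θ) : torusInt g = 0 := by
  have h1 : ∀ y₁ y₂, ∫ θ in (0 : ℝ)..(2 * Real.pi), g y₁ y₂ θ = 0 := by
    intro y₁ y₂
    rw [intervalIntegral.integral_eq_sub_of_hasDerivAt (fun θ _ => h y₁ y₂ θ)
      ((hg.inner _ _).intervalIntegrable _ _)]
    have := hp.θ y₁ y₂ 0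
    rw [zero_add] at this
    rw [this, sub_self]
  simp [torusInt, h1]

theorem torusInt_deriv_y₂ (hp : Periodic3 f) (hg : Cont3 g)
    (h : ∀ y₁ y₂ θ, HasDerivAt (fun r => f y₁ r θ) (g y₁ y₂ θ) y₂) : torusInt g = 0 := by
  have h1 : ∀ y₁ θ, ∫ y₂ in (0 : ℝ)..(2 * Real.pi), g y₁ y₂ θ = 0 := by
    intro y₁ θ
    rw [intervalIntegral.integral_eq_sub_of_hasDerivAt (fun y₂ _ => h y₁ y₂ θ)
      ((Continuous.comp hg (by fun_prop : Continuous fun y₂ : ℝ =>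
        (y₁, y₂, θ))).intervalIntegrable _ _)]
    have := hp.y₂ y₁ 0 θ
    rw [zero_add] at this
    rw [this, sub_self]
  have h2 : ∀ y₁, ∫ y₂ in (0 : ℝ)..(2 * Real.pi), ∫ θ in (0 : ℝ)..(2 * Real.pi), g y₁ y₂ θ = 0 := by
    intro y₁
    rw [integral_swap_of_continuous (Continuous.comp hg (by fun_prop : Continuous fun p : ℝ × ℝ =>
        (y₁, p.1, p.2)))]
    simp [h1]
  simp [torusInt, h2]

theorem torusInt_deriv_y₁ (hp : Periodic3 f) (hg : Cont3 g)
    (h : ∀ y₁ y₂ θ, HasDerivAt (fun r => f r y₂ θ) (g y₁ y₂ θ) y₁) : torusInt g = 0 := by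
  have h1 : ∀ y₂ θ, ∫ y₁ in (0 : ℝ)..(2 * Real.pi), g y₁ y₂ θ = 0 := by
    intro y₂ θ
    rw [intervalIntegral.integral_eq_sub_of_hasDerivAt (fun y₁ _ => h y₁ y₂ θ)
      ((Continuous.comp hg (by fun_prop : Continuous fun y₁ : ℝ =>
        (y₁, y₂, θ))).intervalIntegrable _ _)]
    have := hp.y₁ 0 y₂ θ
    rw [zero_add] at this
    rw [this, sub_self]
  have h2 : ∀ y₂, ∫ y₁ in (0 : ℝ)..(2 * Real.pi), ∫ θ in (0 : ℝ)..(2 * Real.pi), g y₁ y₂ θ = 0 := by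
    intro y₂
    rw [integral_swap_of_continuous (Continuous.comp hg (by fun_prop : Continuous fun p : ℝ × ℝ =>
        (p.1, y₂, p.2)))]
    simp [h1]
  unfold torusInt
  rw [integral_swap_of_continuous (hg.integral_θ _ _)]
  simp [h2]

end TorusInt

section SlabIntegral

variable {a b : ℝ} {f : FrontFun}

theorem ContDiffOn.cont3 {n : WithTop ℕ∞} (hf : ContDiffOn ℝ n f.uncurried (slab (Icc a b)))
    {s : ℝ} (hs : s ∈ Icc a b) : Cont3 (f s) :=
  continuous_of_slab hf.continuousOn hs

theorem torusInt_dTan_eq_zero (hab : a < b) (hf : ContDiffOn ℝ 1 f.uncurried (slab (Icc a b)))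
    {s : ℝ} (hs : s ∈ Icc a b) (hp : Periodic3 (f s)) (j : Fin 2) : torusInt (f.dTan j s) = 0 := by
  have hc : Cont3 (f.dTan j s) :=
    continuous_of_slab (contDiffOn_dTan (k := 0) hab hf (by simp) j).continuousOn hs
  fin_cases j
  · exact torusInt_deriv_y₁ hp hc fun y₁ y₂ θ =>
      (hasDerivAt_snd hf one_ne_zero hs y₁ y₂ θ).differentiableAt.hasDerivAt
  · exact torusInt_deriv_y₂ hp hc fun y₁ y₂ θ =>
      (hasDerivAt_third hf one_ne_zero hs y₁ y₂ θ).differentiableAt.hasDerivAt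

theorem torusInt_dθ_eq_zero (hab : a < b) (hf : ContDiffOn ℝ 1 f.uncurried (slab (Icc a b)))
    {s : ℝ} (hs : s ∈ Icc a b) (hp : Periodic3 (f s)) : torusInt (f.dθ s) = 0 :=
  torusInt_deriv_θ hp
    (continuous_of_slab (contDiffOn_dθ (k := 0) hab hf (by simp)).continuousOn hs)
    fun y₁ y₂ θ => (hasDerivAt_fourth hf one_ne_zero hs y₁ y₂ θ).differentiableAt.hasDerivAt

theorem hasDerivWithinAt_dFirst (hf : ContDiffOn ℝ 1 f.uncurried (slab (Icc a b)))
    {s : ℝ} (hs : s ∈ Icc a b) (y₁ y₂ θ : ℝ) :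
    HasDerivWithinAt (fun r => f r y₁ y₂ θ) (f.dFirst (Icc a b) s y₁ y₂ θ) (Icc a b) s :=
  (hasDerivWithinAt_first hf one_ne_zero hs y₁ y₂ θ).differentiableWithinAt.hasDerivWithinAt

theorem continuous_dFirst_clamp (hab : a < b) (hf : ContDiffOn ℝ 1 f.uncurried (slab (Icc a b))) :
    Continuous fun p : ℝ × ℝ × ℝ × ℝ =>
      f.dFirst (Icc a b) (clamp a b p.1) p.2.1 p.2.2.1 p.2.2.2 :=
  continuous_clamp_of_continuousOn hab.le
    (contDiffOn_dFirst (k := 0) hab hf (by simp)).continuousOn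

theorem hasDerivWithinAt_integral_θ (hab : a < b)
    (hf : ContDiffOn ℝ 1 f.uncurried (slab (Icc a b))) {s : ℝ} (hs : s ∈ Icc a b) (y₁ y₂ : ℝ) :
    HasDerivWithinAt (fun r => ∫ θ in (0 : ℝ)..(2 * Real.pi), f r y₁ y₂ θ)
      (∫ θ in (0 : ℝ)..(2 * Real.pi), f.dFirst (Icc a b) s y₁ y₂ θ) (Icc a b) s :=
  hasDerivWithinAt_intervalIntegral hab (f := fun s θ => f s y₁ y₂ θ)
    (f' := fun s θ => f.dFirst (Icc a b) s y₁ y₂ θ)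
    (fun r hr => Cont3.inner (ContDiffOn.cont3 hf hr) y₁ y₂)
    ((continuous_dFirst_clamp hab hf).comp (by fun_prop : Continuous fun p : ℝ × ℝ =>
      (p.1, y₁, y₂, p.2)))
    (fun r hr θ => hasDerivWithinAt_dFirst hf hr y₁ y₂ θ) hs

theorem hasDerivWithinAt_torusInt (hab : a < b)
    (hf : ContDiffOn ℝ 1 f.uncurried (slab (Icc a b))) {s : ℝ} (hs : s ∈ Icc a b) :
    HasDerivWithinAt (fun r => torusInt (f r)) (torusInt (f.dFirst (Icc a b) s)) (Icc a b) s := by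
  have hd := continuous_dFirst_clamp hab hf
  have h1 : ∀ y₁, ∀ r ∈ Icc a b, HasDerivWithinAt
      (fun r => ∫ y₂ in (0 : ℝ)..(2 * Real.pi), ∫ θ in (0 : ℝ)..(2 * Real.pi), f r y₁ y₂ θ)
      (∫ y₂ in (0 : ℝ)..(2 * Real.pi), ∫ θ in (0 : ℝ)..(2 * Real.pi),
        f.dFirst (Icc a b) r y₁ y₂ θ) (Icc a b) r := by
    intro y₁ r hr
    refine hasDerivWithinAt_intervalIntegral hab
      (f := fun r y₂ => ∫ θ in (0 : ℝ)..(2 * Real.pi), f r y₁ y₂ θ)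
      (f' := fun r y₂ => ∫ θ in (0 : ℝ)..(2 * Real.pi), f.dFirst (Icc a b) r y₁ y₂ θ)
      (fun q hq => ?_) ?_ (fun q hq y₂ => hasDerivWithinAt_integral_θ hab hf hq y₁ y₂) hr
    · exact (Cont3.integral_θ (ContDiffOn.cont3 hf hq) _ _).comp
        (by fun_prop : Continuous fun y₂ : ℝ => (y₁, y₂))
    · exact continuous_integral_last (g := fun (p : ℝ × ℝ) θ =>
        f.dFirst (Icc a b) (clamp a b p.1) y₁ p.2 θ) (hd.comp
        (by fun_prop : Continuous fun q : (ℝ × ℝ) × ℝ => (q.1.1, y₁, q.1.2, q.2))) _ _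
  refine hasDerivWithinAt_intervalIntegral hab
    (f := fun r y₁ => ∫ y₂ in (0 : ℝ)..(2 * Real.pi), ∫ θ in (0 : ℝ)..(2 * Real.pi), f r y₁ y₂ θ)
    (f' := fun r y₁ => ∫ y₂ in (0 : ℝ)..(2 * Real.pi), ∫ θ in (0 : ℝ)..(2 * Real.pi),
      f.dFirst (Icc a b) r y₁ y₂ θ)
    (fun q hq => ?_) ?_ (fun q hq y₁ => h1 y₁ q hq) hs
  · exact Cont3.integral_y₂ (ContDiffOn.cont3 hf hq) _ _ _ _
  · exact continuous_integral_last (g := fun (p : ℝ × ℝ) y₂ => ∫ θ in (0 : ℝ)..(2 * Real.pi),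
      f.dFirst (Icc a b) (clamp a b p.1) p.2 y₂ θ)
      (continuous_integral_last (g := fun (p : (ℝ × ℝ) × ℝ) θ =>
        f.dFirst (Icc a b) (clamp a b p.1.1) p.1.2 p.2 θ) (hd.comp
        (by fun_prop : Continuous fun q : ((ℝ × ℝ) × ℝ) × ℝ =>
          (q.1.1.1, q.1.1.2, q.1.2, q.2))) _ _) _ _

theorem integral_torusInt_dFirst (hab : a < b)
    (hf : ContDiffOn ℝ 1 f.uncurried (slab (Icc a b))) :
    ∫ s in a..b, torusInt (f.dFirst (Icc a b) s) = torusInt (f b) - torusInt (f a) := by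
  have hc : Continuous fun s => torusInt (f.dFirst (Icc a b) (clamp a b s)) :=
    continuous_torusInt (g := fun s => f.dFirst (Icc a b) (clamp a b s))
      (continuous_dFirst_clamp hab hf)
  have h1 : ∫ s in a..b, torusInt (f.dFirst (Icc a b) s)
      = ∫ s in a..b, torusInt (f.dFirst (Icc a b) (clamp a b s)) := by
    refine intervalIntegral.integral_congr fun s hs => ?_
    rw [uIcc_of_le hab.le] at hs
    simp only [clamp_of_mem hs]
  rw [h1]
  refine intervalIntegral.integral_eq_sub_of_hasDerivAt_of_le hab.le
    (f := fun s => torusInt (f s))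
    (fun s hs => (hasDerivWithinAt_torusInt hab hf hs).continuousWithinAt) (fun s hs => ?_)
    (hc.intervalIntegrable _ _)
  rw [clamp_of_mem (Ioo_subset_Icc_self hs)]
  exact (hasDerivWithinAt_torusInt hab hf (Ioo_subset_Icc_self hs)).hasDerivAt
    (Icc_mem_nhds hs.1 hs.2)

/-- `integralΩ₀` integrates the normal variable inside the tangential ones; moved outermost by
Fubini, it becomes the parameter of a family of torus integrals. -/
theorem integral_slab_swap (hab : a ≤ b) (hf : ContinuousOn f.uncurried (slab (Icc a b))) :
    ∫ y₁ in (0 : ℝ)..(2 * Real.pi), ∫ y₂ in (0 : ℝ)..(2 * Real.pi), ∫ s in a..b,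
      ∫ θ in (0 : ℝ)..(2 * Real.pi), f s y₁ y₂ θ = ∫ s in a..b, torusInt (f s) := by
  have hc := continuous_clamp_of_continuousOn hab hf
  have h0 : ∀ G : ℝ → ℝ, ∫ s in a..b, G s = ∫ s in a..b, G (clamp a b s) := by
    intro G
    refine intervalIntegral.integral_congr fun s hs => ?_
    rw [uIcc_of_le hab] at hs
    simp only [clamp_of_mem hs]
  have h1 : ∀ y₁ y₂, ∫ s in a..b, ∫ θ in (0 : ℝ)..(2 * Real.pi), f s y₁ y₂ θ
      = ∫ s in a..b, ∫ θ in (0 : ℝ)..(2 * Real.pi), f (clamp a b s) y₁ y₂ θ := fun y₁ y₂ => h0 _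
  simp only [h1]
  have hθ : Continuous fun q : (ℝ × ℝ) × ℝ =>
      ∫ θ in (0 : ℝ)..(2 * Real.pi), f (clamp a b q.1.1) q.1.2 q.2 θ :=
    continuous_integral_last (g := fun (q : (ℝ × ℝ) × ℝ) θ => f (clamp a b q.1.1) q.1.2 q.2 θ)
      (hc.comp (by fun_prop : Continuous fun q : ((ℝ × ℝ) × ℝ) × ℝ =>
          (q.1.1.1, q.1.1.2, q.1.2, q.2))) _ _
  have h2 : ∀ y₁, ∫ y₂ in (0 : ℝ)..(2 * Real.pi), ∫ s in a..b,
      ∫ θ in (0 : ℝ)..(2 * Real.pi), f (clamp a b s) y₁ y₂ θ = ∫ s in a..b,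
      ∫ y₂ in (0 : ℝ)..(2 * Real.pi), ∫ θ in (0 : ℝ)..(2 * Real.pi), f (clamp a b s) y₁ y₂ θ :=
    fun y₁ => integral_swap_of_continuous (g := fun y₂ s =>
      ∫ θ in (0 : ℝ)..(2 * Real.pi), f (clamp a b s) y₁ y₂ θ)
      (hθ.comp (by fun_prop : Continuous fun p : ℝ × ℝ => ((p.2, y₁), p.1))) _ _ _ _
  simp only [h2]
  rw [integral_swap_of_continuous (g := fun y₁ s => ∫ y₂ in (0 : ℝ)..(2 * Real.pi),
    ∫ θ in (0 : ℝ)..(2 * Real.pi), f (clamp a b s) y₁ y₂ θ)]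
  · exact (h0 fun s => torusInt (f s)).symm
  · exact continuous_integral_last (g := fun (p : ℝ × ℝ) y₂ => ∫ θ in (0 : ℝ)..(2 * Real.pi),
      f (clamp a b p.2) p.1 y₂ θ)
      (hθ.comp (by fun_prop : Continuous fun q : (ℝ × ℝ) × ℝ => ((q.1.2, q.1.1), q.2))) _ _

/-- The divergence theorem on `[a, b] × 𝕋³`. -/
theorem integral_slab_divergence (hab : a < b) {p c : FrontFun} {q : Fin 2 → FrontFun}
    {g : FrontFun}
    (hp : ContDiffOn ℝ 1 p.uncurried (slab (Icc a b)))
    (hq : ∀ j, ContDiffOn ℝ 1 (q j).uncurried (slab (Icc a b)))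
    (hc : ContDiffOn ℝ 1 c.uncurried (slab (Icc a b)))
    (hqp : ∀ j, ∀ s ∈ Icc a b, Periodic3 (q j s)) (hcp : ∀ s ∈ Icc a b, Periodic3 (c s))
    (hg : ∀ s ∈ Ioo a b, ∀ y₁ y₂ θ, g s y₁ y₂ θ = deriv (fun r => p r y₁ y₂ θ) s
      + ∑ j, (q j).dTan j s y₁ y₂ θ + c.dθ s y₁ y₂ θ) :
    ∫ y₁ in (0 : ℝ)..(2 * Real.pi), ∫ y₂ in (0 : ℝ)..(2 * Real.pi), ∫ s in a..b,
      ∫ θ in (0 : ℝ)..(2 * Real.pi), g s y₁ y₂ θ = torusInt (p b) - torusInt (p a) := by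
  -- `g` is only controlled in the open interval, where the two-sided normal derivative makes sense.
  -- `G` agrees with it there and, using the derivative within [a, b], is continuous up to the ends.
  set G : FrontFun := fun s y₁ y₂ θ => p.dFirst (Icc a b) s y₁ y₂ θ
      + ∑ j, (q j).dTan j s y₁ y₂ θ + c.dθ s y₁ y₂ θ with hG
  have hp' := (contDiffOn_dFirst (k := 0) hab hp (by simp)).continuousOn
  have hq' := fun j => (contDiffOn_dTan (k := 0) hab (hq j) (by simp) j).continuousOn
  have hc' := (contDiffOn_dθ (k := 0) hab hc (by simp)).continuousOn
  have hGc : ContinuousOn G.uncurried (slab (Icc a b)) :=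
    (hp'.add (continuousOn_finsetSum _ fun j _ => hq' j)).add hc'
  have h1 : ∀ y₁ y₂, ∫ s in a..b, ∫ θ in (0 : ℝ)..(2 * Real.pi), g s y₁ y₂ θ
      = ∫ s in a..b, ∫ θ in (0 : ℝ)..(2 * Real.pi), G s y₁ y₂ θ := by
    intro y₁ y₂
    refine intervalIntegral.integral_congr_Ioo_of_le hab.le fun s hs => ?_
    refine intervalIntegral.integral_congr fun θ _ => ?_
    simp only [hG, hg s hs, FrontFun.dFirst]
    rw [derivWithin_of_mem_nhds (Icc_mem_nhds hs.1 hs.2)]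
  simp only [h1]
  rw [integral_slab_swap hab.le hGc, ← integral_torusInt_dFirst hab hp]
  refine intervalIntegral.integral_congr fun s hs => ?_
  rw [uIcc_of_le hab.le] at hs
  have hp3 : Cont3 (p.dFirst (Icc a b) s) := continuous_of_slab hp' hs
  have hq3 : ∀ j, Cont3 ((q j).dTan j s) := fun j => continuous_of_slab (hq' j) hs
  have hc3 : Cont3 (c.dθ s) := continuous_of_slab hc' hs
  simp only [hG]
  rw [torusInt_add (hp3.add (cont3_sum _ fun j _ => hq3 j)) hc3,
    torusInt_add hp3 (cont3_sum _ fun j _ => hq3 j), torusInt_sum _ fun j _ => hq3 j,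
    torusInt_dθ_eq_zero hab hc hs (hcp s hs),
    Finset.sum_eq_zero fun j _ => torusInt_dTan_eq_zero hab (hq j) hs (hqp j s hs) j]
  simp

end SlabIntegral

open PowerSeries

/-! ### Coefficientwise differentiation of formal power series -/

/-- The formal series `F` depending on a real parameter has at `s` the derivative `F'`, coefficient
by coefficient. -/
def PSHasDerivAt (F : ℝ → PowerSeries ℝ) (F' : PowerSeries ℝ) (s : ℝ) : Prop :=
  ∀ k, HasDerivAt (fun r => coeff k (F r)) (coeff k F') s

section PSHasDerivAt

variable {F G : ℝ → PowerSeries ℝ} {F' G' : PowerSeries ℝ} {s : ℝ}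

theorem psHasDerivAt_const (c : PowerSeries ℝ) (s : ℝ) : PSHasDerivAt (fun _ => c) 0 s := fun k => by
  simpa using hasDerivAt_const s (coeff k c)

theorem PSHasDerivAt.unique (hF : PSHasDerivAt F F' s) (hG : PSHasDerivAt F G' s) : F' = G' := by
  ext k; exact (hF k).unique (hG k)

theorem PSHasDerivAt.neg (hF : PSHasDerivAt F F' s) : PSHasDerivAt (fun r => -F r) (-F') s :=
  fun k => by simpa using (hF k).fun_neg

theorem PSHasDerivAt.sub (hF : PSHasDerivAt F F' s) (hG : PSHasDerivAt G G' s) :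
    PSHasDerivAt (fun r => F r - G r) (F' - G') s := fun k => by
  simpa using (hF k).fun_sub (hG k)

theorem psHasDerivAt_sum {ι : Type*} (u : Finset ι) {A : ι → ℝ → PowerSeries ℝ}
    {A' : ι → PowerSeries ℝ} (h : ∀ i ∈ u, PSHasDerivAt (A i) (A' i) s) :
    PSHasDerivAt (fun r => ∑ i ∈ u, A i r) (∑ i ∈ u, A' i) s := fun k => by
  simpa using HasDerivAt.fun_sum fun i hi => h i hi k

theorem PSHasDerivAt.mul (hF : PSHasDerivAt F F' s) (hG : PSHasDerivAt G G' s) :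
    PSHasDerivAt (fun r => F r * G r) (F' * G s + F s * G') s := fun k => by
  simp only [coeff_mul, map_add, ← Finset.sum_add_distrib]
  exact HasDerivAt.fun_sum fun p _ => (hF p.1).fun_mul (hG p.2)

theorem PSHasDerivAt.const_mul (c : PowerSeries ℝ) (hF : PSHasDerivAt F F' s) :
    PSHasDerivAt (fun r => c * F r) (c * F') s := by
  simpa using (psHasDerivAt_const c s).mul hF

theorem PSHasDerivAt.mul_const (hF : PSHasDerivAt F F' s) (c : PowerSeries ℝ) :
    PSHasDerivAt (fun r => F r * c) (F' * c) s := by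
  simpa using hF.mul (psHasDerivAt_const c s)

theorem PSHasDerivAt.pow_succ (hF : PSHasDerivAt F F' s) (n : ℕ) :
    PSHasDerivAt (fun r => F r ^ (n + 1)) ((n + 1 : ℕ) • (F s ^ n * F')) s := by
  induction n with
  | zero => simpa using hF
  | succ n ih =>
    have := ih.mul hF
    simp only [← _root_.pow_succ] at this
    convert this using 1
    simp only [nsmul_eq_mul]
    push_cast
    ring

theorem coeff_pow_eq_zero_of_lt {Z : PowerSeries ℝ} (hZ : constantCoeff Z = 0) {k n : ℕ}
    (h : k < n) : coeff k (Z ^ n) = 0 :=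
  X_pow_dvd_iff.1 (pow_dvd_pow_of_dvd (X_dvd_iff.2 hZ) n) k h

/-- A series without constant term has Zⁿ = O(εⁿ), so the Taylor sum may be taken over any longer
range; this gives the freedom needed when derivatives shift the index. -/
theorem coeff_formalComp_of_le (g : ℝ → ℝ) (y : ℝ) {Z : PowerSeries ℝ} (hZ : constantCoeff Z = 0)
    {k N : ℕ} (h : k < N) : coeff k (formalComp g y Z)
      = ∑ n ∈ Finset.range N, iteratedDeriv n g y / (n.factorial : ℝ) * coeff k (Z ^ n) := by
  rw [formalComp, coeff_mk]
  refine Finset.sum_subset (Finset.range_subset_range.2 h) fun n _ hn => ?_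
  rw [coeff_pow_eq_zero_of_lt hZ (by simpa using hn), mul_zero]

theorem coeff_formalComp_mul (g : ℝ → ℝ) (y : ℝ) {Z : PowerSeries ℝ} (hZ : constantCoeff Z = 0)
    (W : PowerSeries ℝ) (k : ℕ) : coeff k (formalComp g y Z * W)
      = ∑ n ∈ Finset.range (k + 1), iteratedDeriv n g y / (n.factorial : ℝ)
        * coeff k (Z ^ n * W) := by
  simp only [coeff_mul, Finset.mul_sum]
  rw [Finset.sum_comm]
  refine Finset.sum_congr rfl fun p hp => ?_
  rw [coeff_formalComp_of_le g y hZ (N := k + 1)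
      (by have := Finset.HasAntidiagonal.mem_antidiagonal.1 hp; omega),
    Finset.sum_mul]
  exact Finset.sum_congr rfl fun n _ => by ring

/-- Each coefficient is a finite Taylor sum and is differentiated termwise. Both resulting families,
from g⁽ⁿ⁾(y) and from Fⁿ, are Taylor sums of g' and recombine into the chain rule. -/
theorem PSHasDerivAt.formalComp {g : ℝ → ℝ} (hg : ContDiff ℝ ∞ g) {y : ℝ → ℝ} {y' : ℝ}
    (hy : HasDerivAt y y' s) (hF : PSHasDerivAt F F' s) (h0 : ∀ r, constantCoeff (F r) = 0) :
    PSHasDerivAt (fun r => formalComp g (y r) (F r))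
      (VortexSheet.formalComp (deriv g) (y s) (F s) * (C y' + F')) s := by
  intro k
  have h1 : ∀ n : ℕ, HasDerivAt (fun r => iteratedDeriv n g (y r) / (n.factorial : ℝ))
      (iteratedDeriv (n + 1) g (y s) * y' / (n.factorial : ℝ)) s := by
    intro n
    have h2 : HasDerivAt (iteratedDeriv n g) (iteratedDeriv (n + 1) g (y s)) (y s) := by
      rw [iteratedDeriv_succ]
      exact ((hg.differentiable_iteratedDeriv n
        (by exact_mod_cast WithTop.coe_lt_coe.2 (ENat.natCast_lt_top n))) _).hasDerivAt
    exact (h2.comp s hy).div_const _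
  have h2 : ∀ n : ℕ, HasDerivAt (fun r => coeff k (F r ^ n))
      (coeff k (n • (F s ^ (n - 1) * F'))) s := by
    intro n
    cases n with
    | zero => simpa using hasDerivAt_const s (coeff k (1 : PowerSeries ℝ))
    | succ n => exact hF.pow_succ n k
  -- The range `k + 2` has one term more than the definition. In the first family the last term
  -- drops since F^{k+1} has no coefficient of order k; in the second the term n = 0 drops and the
  -- index shifts.
  have h3 := HasDerivAt.fun_sum (u := Finset.range (k + 2)) fun n _ => (h1 n).fun_mul (h2 n)
  have h4 : (fun r => coeff k (VortexSheet.formalComp g (y r) (F r))) = fun r =>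
      ∑ n ∈ Finset.range (k + 2), iteratedDeriv n g (y r) / (n.factorial : ℝ)
        * coeff k (F r ^ n) :=
    funext fun r => coeff_formalComp_of_le g (y r) (h0 r) (by omega)
  rw [h4]
  refine h3.congr_deriv ?_
  rw [coeff_formalComp_mul _ _ (h0 s)]
  simp only [mul_add, map_add, Finset.sum_add_distrib, ← iteratedDeriv_succ']
  congr 1
  · rw [Finset.sum_range_succ, coeff_pow_eq_zero_of_lt (h0 s) (Nat.lt_succ_self k), mul_zero,
      add_zero]
    refine Finset.sum_congr rfl fun n _ => ?_
    rw [coeff_mul_C]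
    ring
  · rw [Finset.sum_range_succ']
    simp only [zero_smul, map_zero, mul_zero, add_zero]
    refine Finset.sum_congr rfl fun n _ => ?_
    rw [Nat.add_sub_cancel, Nat.factorial_succ, map_nsmul, nsmul_eq_mul]
    push_cast
    field_simp

theorem coeff_inv_one_sub {N : PowerSeries ℝ} (hN : constantCoeff N = 0) (k : ℕ) :
    coeff k (1 - N)⁻¹ = coeff k (∑ n ∈ Finset.range (k + 1), N ^ n) := by
  have hU : (1 - N) * (1 - N)⁻¹ = 1 := PowerSeries.mul_inv_cancel _ (by simp [hN])
  have h1 : (∑ n ∈ Finset.range (k + 1), N ^ n) = (1 - N)⁻¹ - N ^ (k + 1) * (1 - N)⁻¹ := by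
    have h2 := geom_sum_mul_neg N (k + 1)
    calc _ = (∑ n ∈ Finset.range (k + 1), N ^ n) * ((1 - N) * (1 - N)⁻¹) := by rw [hU, mul_one]
      _ = _ := by rw [← mul_assoc, h2]; ring
  have h3 : coeff k (N ^ (k + 1) * (1 - N)⁻¹) = 0 :=
    X_pow_dvd_iff.1 (Dvd.dvd.mul_right (pow_dvd_pow_of_dvd (X_dvd_iff.2 hN) (k + 1)) _) k
      (Nat.lt_succ_self k)
  rw [h1, map_sub, h3, sub_zero]

/-- Existence and value are separated: each coefficient is that of a finite geometric sum, hence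
differentiable, and the value is then forced by differentiating (1 - F)(1 - F)⁻¹ = 1. -/
theorem PSHasDerivAt.inv_one_sub (hF : PSHasDerivAt F F' s) (h0 : ∀ r, constantCoeff (F r) = 0) :
    PSHasDerivAt (fun r => (1 - F r)⁻¹) ((1 - F s)⁻¹ ^ 2 * F') s := by
  have hU : ∀ r, (1 - F r) * (1 - F r)⁻¹ = 1 := fun r =>
    PowerSeries.mul_inv_cancel _ (by simp [h0 r])
  have hpow : ∀ n : ℕ, PSHasDerivAt (fun r => F r ^ n) (n • (F s ^ (n - 1) * F')) s := by
    intro n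
    cases n with
    | zero => simpa using psHasDerivAt_const 1 s
    | succ n => exact hF.pow_succ n
  obtain ⟨J', hJ'⟩ : ∃ J', PSHasDerivAt (fun r => (1 - F r)⁻¹) J' s := by
    refine ⟨PowerSeries.mk fun k => coeff k (∑ n ∈ Finset.range (k + 1), n • (F s ^ (n - 1) * F')),
      fun k => ?_⟩
    simp only [coeff_inv_one_sub (h0 _), coeff_mk]
    exact psHasDerivAt_sum _ (fun n _ => hpow n) k
  have h1 := ((psHasDerivAt_const 1 s).sub hF).mul hJ'
  simp only [hU] at h1
  have h2 := (psHasDerivAt_const 1 s).unique h1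
  have h3 : J' = (1 - F s)⁻¹ ^ 2 * F' := by
    linear_combination (-(1 - F s)⁻¹) * h2 - J' * hU s
  rwa [← h3]

end PSHasDerivAt

/-! ### The formal straightening of the fronts -/

theorem coeff_shift (χ : ℝ → ℝ) (y₃ : ℝ) (Ψ : PowerSeries ℝ) (k : ℕ) :
    coeff k (shift χ y₃ Ψ) = coeff k (shiftApprox χ y₃ Ψ k) := by
  rw [shift, coeff_mk]

theorem constantCoeff_shiftApprox (χ : ℝ → ℝ) (y₃ : ℝ) {Ψ : PowerSeries ℝ}
    (hΨ : constantCoeff Ψ = 0) (k : ℕ) : constantCoeff (shiftApprox χ y₃ Ψ k) = 0 := by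
  cases k <;> simp [shiftApprox, hΨ]

/-- The formal Jacobian `∂x₃/∂y₃ = (1 - χ'(x₃) Ψ)⁻¹`. -/
def jacobian (χ : ℝ → ℝ) (y₃ : ℝ) (Ψ : PowerSeries ℝ) : PowerSeries ℝ :=
  (1 - formalComp (deriv χ) y₃ (shift χ y₃ Ψ) * Ψ)⁻¹

section Shift

variable {χ : ℝ → ℝ}

theorem jacobian_spec (χ : ℝ → ℝ) (y₃ : ℝ) {Ψ : PowerSeries ℝ} (hΨ : constantCoeff Ψ = 0) :
    jacobian χ y₃ Ψ * (1 - formalComp (deriv χ) y₃ (shift χ y₃ Ψ) * Ψ) = 1 :=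
  PowerSeries.inv_mul_cancel _ (by simp [hΨ])

/-- Implicit differentiation. The coefficient of order k stabilises at the k-th approximation, so a
derivative Z' exists; differentiating Z = χ(y + Z)Ψ gives (1 - χ'Ψ) Z' = χ'Ψ y' + χΨ', and J inverts
the factor on the left. -/
theorem psHasDerivAt_shift (hχ : ContDiff ℝ ∞ χ) {y : ℝ → ℝ} {y' s : ℝ} (hy : HasDerivAt y y' s)
    {Ψ : ℝ → PowerSeries ℝ} {Ψ' : PowerSeries ℝ} (hΨ : PSHasDerivAt Ψ Ψ' s)
    (h0 : ∀ r, constantCoeff (Ψ r) = 0) :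
    PSHasDerivAt (fun r => shift χ (y r) (Ψ r)) (jacobian χ (y s) (Ψ s)
      * (formalComp (deriv χ) (y s) (shift χ (y s) (Ψ s)) * Ψ s * C y'
        + formalComp χ (y s) (shift χ (y s) (Ψ s)) * Ψ')) s := by
  have happ : ∀ k, ∃ Z', PSHasDerivAt (fun r => shiftApprox χ (y r) (Ψ r) k) Z' s := by
    intro k
    induction k with
    | zero => exact ⟨0, psHasDerivAt_const 0 s⟩
    | succ k ih =>
      obtain ⟨Z', hZ'⟩ := ih
      exact ⟨_, (hZ'.formalComp hχ hy fun r => constantCoeff_shiftApprox χ _ (h0 r) k).mul hΨ⟩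
  choose A hA using happ
  obtain ⟨Z', hZ'⟩ : ∃ Z', PSHasDerivAt (fun r => shift χ (y r) (Ψ r)) Z' s := by
    refine ⟨PowerSeries.mk fun k => coeff k (A k), fun k => ?_⟩
    simp only [coeff_shift, coeff_mk]
    exact hA k k
  have h1 := (hZ'.formalComp hχ hy fun r => (shift_spec χ (y r) (h0 r)).1).mul hΨ
  have h2 : (fun r => formalComp χ (y r) (shift χ (y r) (Ψ r)) * Ψ r)
      = fun r => shift χ (y r) (Ψ r) := funext fun r => (shift_spec χ (y r) (h0 r)).2.symm
  rw [h2] at h1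
  have h3 := hZ'.unique h1
  have h4 := jacobian_spec χ (y s) (h0 s)
  have h5 : Z' = jacobian χ (y s) (Ψ s)
      * (formalComp (deriv χ) (y s) (shift χ (y s) (Ψ s)) * Ψ s * C y'
        + formalComp χ (y s) (shift χ (y s) (Ψ s)) * Ψ') := by
    linear_combination (jacobian χ (y s) (Ψ s)) * h3 - Z' * h4
  rwa [← h5]

theorem contDiff_deriv_of_smooth (hχ : ContDiff ℝ ∞ χ) : ContDiff ℝ ∞ (deriv χ) :=
  (contDiff_infty_iff_deriv.1 hχ).2

/-- The common value of the tangential derivative of the Jacobian and of the normal derivative of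
the tangential derivative of the shift. -/
def jacobianDeriv (χ : ℝ → ℝ) (y₃ : ℝ) (Ψ Ψ' : PowerSeries ℝ) : PowerSeries ℝ :=
  jacobian χ y₃ Ψ ^ 2 * (formalComp (deriv (deriv χ)) y₃ (shift χ y₃ Ψ)
    * (jacobian χ y₃ Ψ * (formalComp χ y₃ (shift χ y₃ Ψ) * Ψ')) * Ψ
    + formalComp (deriv χ) y₃ (shift χ y₃ Ψ) * Ψ')

theorem psHasDerivAt_jacobian (hχ : ContDiff ℝ ∞ χ) (y₃ : ℝ) {s : ℝ}
    {Ψ : ℝ → PowerSeries ℝ} {Ψ' : PowerSeries ℝ} (hΨ : PSHasDerivAt Ψ Ψ' s)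
    (h0 : ∀ r, constantCoeff (Ψ r) = 0) :
    PSHasDerivAt (fun r => jacobian χ y₃ (Ψ r)) (jacobianDeriv χ y₃ (Ψ s) Ψ') s := by
  have hZ := psHasDerivAt_shift hχ (hasDerivAt_const s y₃) hΨ h0
  have hL := hZ.formalComp (contDiff_deriv_of_smooth hχ) (hasDerivAt_const s y₃)
    fun r => (shift_spec χ y₃ (h0 r)).1
  have := (hL.mul hΨ).inv_one_sub fun r => by simp [h0 r]
  simp only [map_zero, mul_zero, zero_add] at this
  exact this

/-- JχΨ' is the variation of x₃ when Ψ moves in the direction Ψ', and J is ∂x₃/∂y₃. Together with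
`psHasDerivAt_jacobian`, this is the symmetry of the mixed second derivatives of x₃, the source of
the Piola identity. -/
theorem psHasDerivAt_jacobian_mul (hχ : ContDiff ℝ ∞ χ) (y₃ : ℝ) {Ψ : PowerSeries ℝ}
    (Ψ' : PowerSeries ℝ) (h0 : constantCoeff Ψ = 0) :
    PSHasDerivAt (fun s => jacobian χ s Ψ * (formalComp χ s (shift χ s Ψ) * Ψ'))
      (jacobianDeriv χ y₃ Ψ Ψ') y₃ := by
  have hid := hasDerivAt_id y₃
  have hΨ := psHasDerivAt_const Ψ y₃
  have hZ := psHasDerivAt_shift hχ hid hΨ fun _ => h0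
  have hK := hZ.formalComp hχ hid fun r => (shift_spec χ _ h0).1
  have hL := hZ.formalComp (contDiff_deriv_of_smooth hχ) hid fun r => (shift_spec χ _ h0).1
  have hJ := (hL.mul hΨ).inv_one_sub fun r => by simp [h0]
  have h := hJ.mul (hK.mul_const Ψ')
  simp only [id, map_one, mul_one, mul_zero, add_zero] at h
  have h4 := jacobian_spec χ y₃ h0
  change PSHasDerivAt (fun s => jacobian χ s Ψ * (formalComp χ s (shift χ s Ψ) * Ψ')) (
    jacobian χ y₃ Ψ ^ 2 * (formalComp (deriv (deriv χ)) y₃ (shift χ y₃ Ψ)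
      * (1 + jacobian χ y₃ Ψ * (formalComp (deriv χ) y₃ (shift χ y₃ Ψ) * Ψ)) * Ψ)
      * (formalComp χ y₃ (shift χ y₃ Ψ) * Ψ')
    + jacobian χ y₃ Ψ * (formalComp (deriv χ) y₃ (shift χ y₃ Ψ)
      * (1 + jacobian χ y₃ Ψ * (formalComp (deriv χ) y₃ (shift χ y₃ Ψ) * Ψ)) * Ψ')) y₃ at h
  -- 1 + ∂Z/∂y₃ is ∂x₃/∂y₃, that is, J.
  have h5 : 1 + jacobian χ y₃ Ψ * (formalComp (deriv χ) y₃ (shift χ y₃ Ψ) * Ψ)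
      = jacobian χ y₃ Ψ := by linear_combination (-1 : PowerSeries ℝ) * h4
  rw [h5] at h
  convert h using 1
  unfold jacobianDeriv
  ring

end Shift

/-! ### Smooth dependence of the coefficients -/

/-- All coefficients of the formal series `F` are of class `C^n` on `S`. -/
def PSContDiffOn {E : Type*} [NormedAddCommGroup E] [NormedSpace ℝ E] (n : WithTop ℕ∞)
    (F : E → PowerSeries ℝ) (S : Set E) : Prop :=
  ∀ k, ContDiffOn ℝ n (fun p => coeff k (F p)) S

section PSContDiffOn

variable {E : Type*} [NormedAddCommGroup E] [NormedSpace ℝ E] {n : WithTop ℕ∞} {S : Set E}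
  {F G : E → PowerSeries ℝ}

theorem psContDiffOn_const (c : PowerSeries ℝ) : PSContDiffOn n (fun _ : E => c) S :=
  fun _ => contDiffOn_const

theorem PSContDiffOn.add (hF : PSContDiffOn n F S) (hG : PSContDiffOn n G S) :
    PSContDiffOn n (fun p => F p + G p) S := fun k => by
  simpa using (hF k).add (hG k)

theorem PSContDiffOn.mul (hF : PSContDiffOn n F S) (hG : PSContDiffOn n G S) :
    PSContDiffOn n (fun p => F p * G p) S := fun k => by
  simp only [coeff_mul]
  exact ContDiffOn.sum fun p _ => (hF p.1).mul (hG p.2)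

theorem psContDiffOn_sum {ι : Type*} (u : Finset ι) {A : ι → E → PowerSeries ℝ}
    (h : ∀ i ∈ u, PSContDiffOn n (A i) S) : PSContDiffOn n (fun p => ∑ i ∈ u, A i p) S :=
  fun k => by simpa using ContDiffOn.sum fun i hi => h i hi k

theorem PSContDiffOn.pow (hF : PSContDiffOn n F S) (i : ℕ) :
    PSContDiffOn n (fun p => F p ^ i) S := by
  induction i with
  | zero => simpa using psContDiffOn_const 1
  | succ i ih => simpa only [_root_.pow_succ] using ih.mul hF

theorem contDiff_iteratedDeriv {g : ℝ → ℝ} (hg : ContDiff ℝ ∞ g) (i : ℕ) :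
    ContDiff ℝ ∞ (iteratedDeriv i g) := by
  induction i with
  | zero => simpa using hg
  | succ i ih => rw [iteratedDeriv_succ]; exact contDiff_deriv_of_smooth ih

theorem PSContDiffOn.formalComp {g : ℝ → ℝ} (hg : ContDiff ℝ ∞ g) {y : E → ℝ}
    (hy : ContDiffOn ℝ ∞ y S) (hF : PSContDiffOn ∞ F S) :
    PSContDiffOn ∞ (fun p => formalComp g (y p) (F p)) S := fun k => by
  simp only [VortexSheet.formalComp, coeff_mk]
  exact ContDiffOn.sum fun i _ =>
    (((contDiff_iteratedDeriv hg i).comp_contDiffOn hy).div_const _).mul (hF.pow i k)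

theorem PSContDiffOn.shift {χ : ℝ → ℝ} (hχ : ContDiff ℝ ∞ χ) {y : E → ℝ}
    (hy : ContDiffOn ℝ ∞ y S) (hF : PSContDiffOn ∞ F S) :
    PSContDiffOn ∞ (fun p => shift χ (y p) (F p)) S := by
  have happ : ∀ k, PSContDiffOn ∞ (fun p => shiftApprox χ (y p) (F p) k) S := by
    intro k
    induction k with
    | zero => exact psContDiffOn_const 0
    | succ k ih => exact (ih.formalComp hχ hy).mul hF
  intro k
  simp only [coeff_shift]
  exact happ k k

theorem PSContDiffOn.jacobian {χ : ℝ → ℝ} (hχ : ContDiff ℝ ∞ χ) {y : E → ℝ}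
    (hy : ContDiffOn ℝ ∞ y S) (hF : PSContDiffOn ∞ F S) (h0 : ∀ p, constantCoeff (F p) = 0) :
    PSContDiffOn ∞ (fun p => jacobian χ (y p) (F p)) S := by
  have hN := ((hF.shift hχ hy).formalComp (contDiff_deriv_of_smooth hχ) hy).mul hF
  intro k
  simp only [VortexSheet.jacobian]
  simp only [fun p => coeff_inv_one_sub (N := VortexSheet.formalComp (deriv χ) (y p)
    (VortexSheet.shift χ (y p) (F p)) * F p) (by simp [h0 p]) k]
  exact psContDiffOn_sum _ (fun i _ => hN.pow i) k

end PSContDiffOn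

open Filter Topology

/-! ### Slices of profiles at fixed time -/

theorem Side.lo_lt_hi (σ : Side) : σ.lo < σ.hi := by
  cases σ <;> simp [Side.lo, Side.hi]

theorem Side.sgn_mul_self (σ : Side) : σ.sgn * σ.sgn = 1 := by
  cases σ <;> simp [Side.sgn]

theorem Side.sgn_ne_zero (σ : Side) : σ.sgn ≠ 0 := by
  cases σ <;> simp [Side.sgn]

section Front

variable {T : ℝ} {f : FrontFun} {t : ℝ}

theorem contDiffOn_frontSlice {n : WithTop ℕ∞} (hf : ContDiffOn ℝ n f.uncurried (slab (Icc 0 T)))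
    (ht : t ∈ Icc 0 T) (S : Set (ℝ × ℝ × ℝ × ℝ)) :
    ContDiffOn ℝ n (FrontFun.uncurried fun _ y₁ y₂ θ => f t y₁ y₂ θ) S :=
  hf.comp (f := fun p : ℝ × ℝ × ℝ × ℝ => (t, p.2)) (by fun_prop) fun _ _ => ht

theorem MemFront.contDiffOn (hf : MemFront T f) : ContDiffOn ℝ ∞ f.uncurried (slab (Icc 0 T)) :=
  hf.smooth

theorem MemFront.contDiffOn_dTan (hf : MemFront T f) (hT : 0 < T) (j : Fin 2) :
    ContDiffOn ℝ ∞ (f.dTan j).uncurried (slab (Icc 0 T)) :=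
  VortexSheet.contDiffOn_dTan hT hf.contDiffOn (by simp) j

theorem MemFront.contDiffOn_dθ (hf : MemFront T f) (hT : 0 < T) :
    ContDiffOn ℝ ∞ f.dθ.uncurried (slab (Icc 0 T)) :=
  VortexSheet.contDiffOn_dθ hT hf.contDiffOn (by simp)

theorem MemFront.periodic (hf : MemFront T f) (ht : t ∈ Icc 0 T) : Periodic3 (f t) :=
  ⟨hf.periodic_y₁ t ht, hf.periodic_y₂ t ht, hf.periodic_θ t ht⟩

theorem hasDerivAt_dTan_zero {a b : ℝ} (hf : ContDiffOn ℝ 1 f.uncurried (slab (Icc a b)))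
    (ht : t ∈ Icc a b) (y₁ y₂ θ : ℝ) :
    HasDerivAt (fun r => f t r y₂ θ) (f.dTan 0 t y₁ y₂ θ) y₁ :=
  (hasDerivAt_snd hf one_ne_zero ht y₁ y₂ θ).differentiableAt.hasDerivAt

theorem hasDerivAt_dTan_one {a b : ℝ} (hf : ContDiffOn ℝ 1 f.uncurried (slab (Icc a b)))
    (ht : t ∈ Icc a b) (y₁ y₂ θ : ℝ) :
    HasDerivAt (fun r => f t y₁ r θ) (f.dTan 1 t y₁ y₂ θ) y₂ :=
  (hasDerivAt_third hf one_ne_zero ht y₁ y₂ θ).differentiableAt.hasDerivAt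

theorem hasDerivAt_dθ {a b : ℝ} (hf : ContDiffOn ℝ 1 f.uncurried (slab (Icc a b)))
    (ht : t ∈ Icc a b) (y₁ y₂ θ : ℝ) :
    HasDerivAt (fun r => f t y₁ y₂ r) (f.dθ t y₁ y₂ θ) θ :=
  (hasDerivAt_fourth hf one_ne_zero ht y₁ y₂ θ).differentiableAt.hasDerivAt

end Front

/-- A function of `(t, y, θ)` at fixed `t`, with `y₃` as first variable. -/
def ResFun.slice (f : ResFun) (t : ℝ) : FrontFun :=
  fun s y₁ y₂ θ => f t y₁ y₂ s θ

/-- A function of `(t, y, Y₃, θ)` at fixed `(t, Y₃)`, with `y₃` as first variable. -/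
def StarFun.slice (f : StarFun) (t Y : ℝ) : FrontFun :=
  fun s y₁ y₂ θ => f t y₁ y₂ s Y θ

/-- A function of `(t, y, Y₃, θ)` at fixed `(t, y₃)`, with `Y₃` as first variable. -/
def StarFun.fastSlice (f : StarFun) (t y₃ : ℝ) : FrontFun :=
  fun s y₁ y₂ θ => f t y₁ y₂ y₃ s θ

/-- A function of `(t, y, θ)` as a function of `(t, y, Y₃, θ)`. -/
def ResFun.toStar (f : ResFun) : StarFun :=
  fun t y₁ y₂ y₃ _ θ => f t y₁ y₂ y₃ θ

section Slices

variable {σ : Side} {T : ℝ} {t : ℝ}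

theorem MemRes.contDiffOn_slice {f : ResFun} (hf : MemRes σ T f) (ht : t ∈ Icc 0 T) :
    ContDiffOn ℝ ∞ (f.slice t).uncurried (slab (Icc σ.lo σ.hi)) :=
  hf.smooth.comp (f := fun p : ℝ × ℝ × ℝ × ℝ => (t, p.2.1, p.2.2.1, p.1, p.2.2.2)) (by fun_prop)
    fun _ hp => ⟨ht, hp⟩

theorem MemRes.periodic {f : ResFun} (hf : MemRes σ T f) (ht : t ∈ Icc 0 T) {s : ℝ}
    (hs : s ∈ Icc σ.lo σ.hi) : Periodic3 (f.slice t s) :=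
  ⟨fun y₁ y₂ θ => hf.periodic_y₁ t ht y₁ y₂ s hs θ, fun y₁ y₂ θ => hf.periodic_y₂ t ht y₁ y₂ s hs θ,
    fun y₁ y₂ θ => hf.periodic_θ t ht y₁ y₂ s hs θ⟩

variable {f : StarFun}

theorem MemStar.contDiffOn_slice (hf : MemStar σ T f) (ht : t ∈ Icc 0 T) {Y : ℝ}
    (hY : 0 ≤ σ.sgn * Y) : ContDiffOn ℝ ∞ (f.slice t Y).uncurried (slab (Icc σ.lo σ.hi)) :=
  hf.smooth.comp (f := fun p : ℝ × ℝ × ℝ × ℝ => (t, p.2.1, p.2.2.1, p.1, Y, p.2.2.2)) (by fun_prop)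
    fun _ hp => ⟨ht, hp, hY⟩

theorem MemStar.contDiffOn_fastSlice (hf : MemStar σ T f) (ht : t ∈ Icc 0 T) {y₃ : ℝ}
    (hy : y₃ ∈ Icc σ.lo σ.hi) {I : Set ℝ} (hI : ∀ Y ∈ I, 0 ≤ σ.sgn * Y) :
    ContDiffOn ℝ ∞ (f.fastSlice t y₃).uncurried (slab I) :=
  hf.smooth.comp (f := fun p : ℝ × ℝ × ℝ × ℝ => (t, p.2.1, p.2.2.1, y₃, p.1, p.2.2.2))
    (by fun_prop) fun _ hp => ⟨ht, hy, hI _ hp⟩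

theorem MemStar.periodic (hf : MemStar σ T f) (ht : t ∈ Icc 0 T) {s : ℝ}
    (hs : s ∈ Icc σ.lo σ.hi) {Y : ℝ} (hY : 0 ≤ σ.sgn * Y) : Periodic3 (f.slice t Y s) :=
  ⟨fun y₁ y₂ θ => hf.periodic_y₁ t ht y₁ y₂ s hs Y hY θ,
    fun y₁ y₂ θ => hf.periodic_y₂ t ht y₁ y₂ s hs Y hY θ,
    fun y₁ y₂ θ => hf.periodic_θ t ht y₁ y₂ s hs Y hY θ⟩

theorem uniqueDiffOn_starDomain (σ : Side) {T : ℝ} (hT : 0 < T) :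
    UniqueDiffOn ℝ (starDomain σ T) := by
  have h : UniqueDiffOn ℝ {Y : ℝ | 0 ≤ σ.sgn * Y} := by
    cases σ
    · have : {Y : ℝ | 0 ≤ Side.plus.sgn * Y} = Ici 0 := by ext; simp [Side.sgn]
      rw [this]; exact uniqueDiffOn_Ici 0
    · have : {Y : ℝ | 0 ≤ Side.minus.sgn * Y} = Iic 0 := by ext; simp [Side.sgn]
      rw [this]; exact uniqueDiffOn_Iic 0
  have h2 : starDomain σ T = Icc 0 T ×ˢ (univ ×ˢ (univ ×ˢ (Icc σ.lo σ.hi ×ˢ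
      ({Y : ℝ | 0 ≤ σ.sgn * Y} ×ˢ (univ : Set ℝ))))) := by
    ext p; simp [starDomain]
  rw [h2]
  exact (uniqueDiffOn_Icc hT).prod (uniqueDiffOn_univ.prod (uniqueDiffOn_univ.prod
    ((uniqueDiffOn_Icc σ.lo_lt_hi).prod (h.prod uniqueDiffOn_univ))))

theorem tendsto_exp_decay (C δ : ℝ) (hδ : 0 < δ) (σ : Side) :
    Tendsto (fun r : ℝ => C * Real.exp (-(δ * (σ.sgn * (σ.sgn * r))))) atTop (𝓝 0) := by
  have h : ∀ r, σ.sgn * (σ.sgn * r) = r := fun r => by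
    rw [← mul_assoc, σ.sgn_mul_self, one_mul]
  simp only [h]
  rw [← mul_zero C]
  exact (Real.tendsto_exp_neg_atTop_nhds_zero.comp
    (tendsto_id.const_mul_atTop hδ)).const_mul C

theorem Side.sgn_mul_sgn_mul (σ : Side) (r : ℝ) : σ.sgn * (σ.sgn * r) = r := by
  rw [← mul_assoc, σ.sgn_mul_self, one_mul]

/-- Directional derivatives of a profile of `S_⋆` tend to zero at infinity. -/
theorem MemStar.tendsto_fderivWithin (hf : MemStar σ T f) (hT : 0 < T) (ht : t ∈ Icc 0 T)
    (y₁ y₂ : ℝ) {y₃ : ℝ} (hy : y₃ ∈ Icc σ.lo σ.hi) (θ : ℝ) (v : ℝ × ℝ × ℝ × ℝ × ℝ × ℝ) :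
    Tendsto (fun r : ℝ => fderivWithin ℝ f.uncurried (starDomain σ T)
      (t, y₁, y₂, y₃, σ.sgn * r, θ) v) atTop (𝓝 0) := by
  obtain ⟨δ, hδ, h⟩ := hf.decay
  -- Only the decay of the first derivative is needed; the iterated derivative of order 1 has the
  -- norm of the Fréchet derivative.
  obtain ⟨C, hC⟩ := h 1
  have h1 : Tendsto (fun r : ℝ => C * Real.exp (-(δ * (σ.sgn * (σ.sgn * r)))) * ‖v‖)
      atTop (𝓝 0) := by
    simpa using (tendsto_exp_decay C δ hδ σ).mul_const ‖v‖
  refine squeeze_zero_norm' ?_ h1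
  filter_upwards [eventually_ge_atTop 0] with r hr
  have hp : (t, y₁, y₂, y₃, σ.sgn * r, θ) ∈ starDomain σ T :=
    ⟨ht, hy, by simpa [σ.sgn_mul_sgn_mul] using hr⟩
  have h2 := hC _ hp
  rw [norm_iteratedFDerivWithin_one _ (uniqueDiffOn_starDomain σ hT _ hp)] at h2
  exact (ContinuousLinearMap.le_opNorm _ _).trans
    (mul_le_mul_of_nonneg_right h2 (norm_nonneg _))

theorem MemStar.hasDerivAt_dy (hf : MemStar σ T f) (ht : t ∈ Icc 0 T)
    (y₁ y₂ : ℝ) {y₃ : ℝ} (hy : y₃ ∈ Ioo σ.lo σ.hi) {Y : ℝ} (hY : 0 ≤ σ.sgn * Y) (θ : ℝ) :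
    HasDerivAt (fun s => f t y₁ y₂ s Y θ) (fderivWithin ℝ f.uncurried (starDomain σ T)
      (t, y₁, y₂, y₃, Y, θ) (0, 0, 0, 1, 0, 0)) y₃ := by
  have hc : HasDerivWithinAt (fun s : ℝ => (t, y₁, y₂, s, Y, θ)) (0, 0, 0, 1, 0, 0)
      (Icc σ.lo σ.hi) y₃ :=
    ((hasDerivAt_const y₃ t).prodMk ((hasDerivAt_const y₃ y₁).prodMk
      ((hasDerivAt_const y₃ y₂).prodMk ((hasDerivAt_id y₃).prodMk
        (hasDerivAt_const y₃ (Y, θ)))))).hasDerivWithinAt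
  exact (hasDerivWithinAt_comp_curve (hf.smooth.differentiableOn (by simp)) hc
    (fun s hs => ⟨ht, hs, hY⟩) (Ioo_subset_Icc_self hy)).hasDerivAt (Icc_mem_nhds hy.1 hy.2)

theorem MemStar.hasDerivAt_dy_zero (hf : MemStar σ T f) (ht : t ∈ Icc 0 T)
    (y₁ y₂ : ℝ) {y₃ : ℝ} (hy : y₃ ∈ Icc σ.lo σ.hi) {Y : ℝ} (hY : 0 ≤ σ.sgn * Y) (θ : ℝ) :
    HasDerivAt (fun s => f t s y₂ y₃ Y θ) (fderivWithin ℝ f.uncurried (starDomain σ T)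
      (t, y₁, y₂, y₃, Y, θ) (0, 1, 0, 0, 0, 0)) y₁ := by
  have hc : HasDerivWithinAt (fun s : ℝ => (t, s, y₂, y₃, Y, θ)) (0, 1, 0, 0, 0, 0)
      univ y₁ :=
    ((hasDerivAt_const y₁ t).prodMk ((hasDerivAt_id y₁).prodMk
        (hasDerivAt_const y₁ (y₂, y₃, Y, θ)))).hasDerivWithinAt
  exact (hasDerivWithinAt_comp_curve (hf.smooth.differentiableOn (by simp)) hc
    (fun s hs => ⟨ht, hy, hY⟩) (mem_univ _)).hasDerivAt univ_mem

theorem MemStar.hasDerivAt_dy_one (hf : MemStar σ T f) (ht : t ∈ Icc 0 T)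
    (y₁ y₂ : ℝ) {y₃ : ℝ} (hy : y₃ ∈ Icc σ.lo σ.hi) {Y : ℝ} (hY : 0 ≤ σ.sgn * Y) (θ : ℝ) :
    HasDerivAt (fun s => f t y₁ s y₃ Y θ) (fderivWithin ℝ f.uncurried (starDomain σ T)
      (t, y₁, y₂, y₃, Y, θ) (0, 0, 1, 0, 0, 0)) y₂ := by
  have hc : HasDerivWithinAt (fun s : ℝ => (t, y₁, s, y₃, Y, θ)) (0, 0, 1, 0, 0, 0)
      univ y₂ :=
    ((hasDerivAt_const y₂ t).prodMk ((hasDerivAt_const y₂ y₁).prodMk ((hasDerivAt_id y₂).prodMk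
        (hasDerivAt_const y₂ (y₃, Y, θ))))).hasDerivWithinAt
  exact (hasDerivWithinAt_comp_curve (hf.smooth.differentiableOn (by simp)) hc
    (fun s hs => ⟨ht, hy, hY⟩) (mem_univ _)).hasDerivAt univ_mem

theorem MemStar.hasDerivAt_dθ (hf : MemStar σ T f) (ht : t ∈ Icc 0 T)
    (y₁ y₂ : ℝ) {y₃ : ℝ} (hy : y₃ ∈ Icc σ.lo σ.hi) {Y : ℝ} (hY : 0 ≤ σ.sgn * Y) (θ : ℝ) :
    HasDerivAt (fun s => f t y₁ y₂ y₃ Y s) (fderivWithin ℝ f.uncurried (starDomain σ T)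
      (t, y₁, y₂, y₃, Y, θ) (0, 0, 0, 0, 0, 1)) θ := by
  have hc : HasDerivWithinAt (fun s : ℝ => (t, y₁, y₂, y₃, Y, s)) (0, 0, 0, 0, 0, 1)
      univ θ :=
    ((hasDerivAt_const θ t).prodMk ((hasDerivAt_const θ y₁).prodMk ((hasDerivAt_const θ y₂).prodMk
        ((hasDerivAt_const θ y₃).prodMk ((hasDerivAt_const θ Y).prodMk
          (hasDerivAt_id θ)))))).hasDerivWithinAt
  exact (hasDerivWithinAt_comp_curve (hf.smooth.differentiableOn (by simp)) hc
    (fun s hs => ⟨ht, hy, hY⟩) (mem_univ _)).hasDerivAt univ_mem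

theorem Side.isOpen_pos (σ : Side) : IsOpen {Y : ℝ | 0 < σ.sgn * Y} :=
  isOpen_lt continuous_const (continuous_const.mul continuous_id)

theorem MemStar.hasDerivAt_dY₃ (hf : MemStar σ T f) (ht : t ∈ Icc 0 T)
    (y₁ y₂ : ℝ) {y₃ : ℝ} (hy : y₃ ∈ Icc σ.lo σ.hi) {Y : ℝ} (hY : 0 < σ.sgn * Y) (θ : ℝ) :
    HasDerivAt (fun s => f t y₁ y₂ y₃ s θ) (fderivWithin ℝ f.uncurried (starDomain σ T)
      (t, y₁, y₂, y₃, Y, θ) (0, 0, 0, 0, 1, 0)) Y := by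
  have hc : HasDerivWithinAt (fun s : ℝ => (t, y₁, y₂, y₃, s, θ)) (0, 0, 0, 0, 1, 0)
      {Y : ℝ | 0 ≤ σ.sgn * Y} Y :=
    ((hasDerivAt_const Y t).prodMk ((hasDerivAt_const Y y₁).prodMk ((hasDerivAt_const Y y₂).prodMk
        ((hasDerivAt_const Y y₃).prodMk ((hasDerivAt_id Y).prodMk
          (hasDerivAt_const Y θ)))))).hasDerivWithinAt
  exact (hasDerivWithinAt_comp_curve (hf.smooth.differentiableOn (by simp)) hc
    (fun s hs => ⟨ht, hy, hs⟩) (le_of_lt hY : (0:ℝ) ≤ _)).hasDerivAt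
      (mem_of_superset (σ.isOpen_pos.mem_nhds hY) fun x (h : 0 < σ.sgn * x) => h.le)

theorem MemStar.tendsto_dy (hf : MemStar σ T f) (hT : 0 < T) (ht : t ∈ Icc 0 T)
    (y₁ y₂ : ℝ) {y₃ : ℝ} (hy : y₃ ∈ Ioo σ.lo σ.hi) (θ : ℝ) (α : Fin 3) :
    Tendsto (fun r : ℝ => f.dy α t y₁ y₂ y₃ (σ.sgn * r) θ) atTop (𝓝 0) := by
  have hy' := Ioo_subset_Icc_self hy
  have hev : ∀ {A B : ℝ → ℝ}, (∀ r, 0 ≤ r → A r = B r) → Tendsto A atTop (𝓝 0) →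
      Tendsto B atTop (𝓝 0) := fun h hA => hA.congr' (by
    filter_upwards [eventually_ge_atTop 0] with r hr using h r hr)
  have hr' : ∀ r : ℝ, 0 ≤ r → 0 ≤ σ.sgn * (σ.sgn * r) := fun r hr => by
    rwa [σ.sgn_mul_sgn_mul]
  fin_cases α
  · exact hev (fun r hr => (hf.hasDerivAt_dy_zero ht y₁ y₂ hy' (hr' r hr) θ).deriv.symm)
      (hf.tendsto_fderivWithin hT ht y₁ y₂ hy' θ _)
  · exact hev (fun r hr => (hf.hasDerivAt_dy_one ht y₁ y₂ hy' (hr' r hr) θ).deriv.symm)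
      (hf.tendsto_fderivWithin hT ht y₁ y₂ hy' θ _)
  · exact hev (fun r hr => (hf.hasDerivAt_dy ht y₁ y₂ hy (hr' r hr) θ).deriv.symm)
      (hf.tendsto_fderivWithin hT ht y₁ y₂ hy' θ _)

theorem MemStar.tendsto_dθ (hf : MemStar σ T f) (hT : 0 < T) (ht : t ∈ Icc 0 T)
    (y₁ y₂ : ℝ) {y₃ : ℝ} (hy : y₃ ∈ Icc σ.lo σ.hi) (θ : ℝ) :
    Tendsto (fun r : ℝ => f.dθ t y₁ y₂ y₃ (σ.sgn * r) θ) atTop (𝓝 0) := by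
  refine (hf.tendsto_fderivWithin hT ht y₁ y₂ hy θ (0, 0, 0, 0, 0, 1)).congr' ?_
  filter_upwards [eventually_ge_atTop 0] with r hr
  exact (hf.hasDerivAt_dθ ht y₁ y₂ hy (by rwa [σ.sgn_mul_sgn_mul]) θ).deriv.symm

theorem MemStar.tendsto_dY₃ (hf : MemStar σ T f) (hT : 0 < T) (ht : t ∈ Icc 0 T)
    (y₁ y₂ : ℝ) {y₃ : ℝ} (hy : y₃ ∈ Icc σ.lo σ.hi) (θ : ℝ) :
    Tendsto (fun r : ℝ => f.dY₃ t y₁ y₂ y₃ (σ.sgn * r) θ) atTop (𝓝 0) := by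
  refine (hf.tendsto_fderivWithin hT ht y₁ y₂ hy θ (0, 0, 0, 0, 1, 0)).congr' ?_
  filter_upwards [eventually_gt_atTop 0] with r hr
  exact (hf.hasDerivAt_dY₃ ht y₁ y₂ hy (by rwa [σ.sgn_mul_sgn_mul]) θ).deriv.symm

end Slices

/-! ### The source terms as coefficients of formal series -/

/-- The series `∑ ε^ℓ ∂_{y_j} ψ^ℓ`. -/
def frontSeriesTan (ψ : ℕ → FrontFun) (j : Fin 2) (t y₁ y₂ θ : ℝ) : PowerSeries ℝ :=
  PowerSeries.mk fun ℓ => (ψ ℓ).dTan j t y₁ y₂ θ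

/-- The series `∑ ε^ℓ ∂_θ ψ^ℓ`. -/
def frontSeriesθ (ψ : ℕ → FrontFun) (t y₁ y₂ θ : ℝ) : PowerSeries ℝ :=
  PowerSeries.mk fun ℓ => (ψ ℓ).dθ t y₁ y₂ θ

/-- The series `∑ ε^ℓ (ξ_j ∂_θ + ε ∂_{y_j}) ψ^ℓ`. -/
def frontSlope (ξ : Fin 2 → ℝ) (ψ : ℕ → FrontFun) (j : Fin 2) (t y₁ y₂ θ : ℝ) : PowerSeries ℝ :=
  C (ξ j) * frontSeriesθ ψ t y₁ y₂ θ + X * frontSeriesTan ψ j t y₁ y₂ θ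

/-- The series `∑ ε^ℓ χ^{[ℓ]}`. -/
def chiSeries (χ : ℝ → ℝ) (ψ : ℕ → FrontFun) (t y₁ y₂ y₃ θ : ℝ) : PowerSeries ℝ :=
  formalComp χ y₃ (shift χ y₃ (frontSeries ψ t y₁ y₂ θ))

/-- The series `∑ ε^ℓ χ̇^{[ℓ]}`. -/
def chiDotSeries (χ : ℝ → ℝ) (ψ : ℕ → FrontFun) (t y₁ y₂ y₃ θ : ℝ) : PowerSeries ℝ :=
  formalComp (deriv χ) y₃ (shift χ y₃ (frontSeries ψ t y₁ y₂ θ))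

theorem sum₂_mul (n : ℕ) (A B : ℕ → ℝ) :
    sum₂ n (fun i j => A i * B j) = coeff n (PowerSeries.mk A * PowerSeries.mk B) := by
  simp [sum₂, coeff_mul]

theorem sum₃_mul (n : ℕ) (A B D : ℕ → ℝ) : sum₃ n (fun i j k => A i * (B j * D k))
    = coeff n (PowerSeries.mk A * (PowerSeries.mk B * PowerSeries.mk D)) := by
  simp [sum₃, coeff_mul, Finset.mul_sum]

theorem sum₂_finset_sum {ι : Type*} (u : Finset ι) (n : ℕ) (f : ι → ℕ → ℕ → ℝ) :
    sum₂ n (fun i j => ∑ a ∈ u, f a i j) = ∑ a ∈ u, sum₂ n (f a) := by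
  simp only [sum₂]
  rw [Finset.sum_comm]

theorem sum₃_finset_sum {ι : Type*} (u : Finset ι) (n : ℕ) (f : ι → ℕ → ℕ → ℕ → ℝ) :
    sum₃ n (fun i j k => ∑ a ∈ u, f a i j k) = ∑ a ∈ u, sum₃ n (f a) := by
  simp only [sum₃]
  rw [Finset.sum_comm (s := u)]
  refine Finset.sum_congr rfl fun p _ => ?_
  rw [Finset.sum_comm]

section Source

variable (χ : ℝ → ℝ) (ξ : Fin 2 → ℝ) (ψ : ℕ → FrontFun) (k : ℕ) (t y₁ y₂ y₃ θ : ℝ)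

/-- The source term of the fast divergence constraint, for given values `D ℓ α β` of
`∂_{y_β} V_α^ℓ` and `E ℓ α` of `∂_{Y₃} V_α^ℓ`. -/
def divSource (D : ℕ → Fin 3 → Fin 3 → ℝ) (E : ℕ → Fin 3 → ℝ) : ℝ :=
  -(∑ α : Fin 3, D k α α)
    + sum₂ (k + 2) (fun ℓ₁ ℓ₂ => (ψ ℓ₁).dθ t y₁ y₂ θ
        * ∑ j : Fin 2, ξ j * E ℓ₂ j.castSucc)
    + sum₂ (k + 1) (fun ℓ₁ ℓ₂ => ∑ j : Fin 2, (ψ ℓ₁).dTan j t y₁ y₂ θ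
        * E ℓ₂ j.castSucc)
    + sum₃ (k + 1) (fun ℓ₁ ℓ₂ ℓ₃ => chiCoeff χ ψ ℓ₁ t y₁ y₂ y₃ θ * (ψ ℓ₂).dθ t y₁ y₂ θ
        * ∑ j : Fin 2, ξ j * D ℓ₃ j.castSucc 2)
    + sum₃ k (fun ℓ₁ ℓ₂ ℓ₃ => chiCoeff χ ψ ℓ₁ t y₁ y₂ y₃ θ
        * ∑ j : Fin 2, (ψ ℓ₂).dTan j t y₁ y₂ θ * D ℓ₃ j.castSucc 2)
    + sum₃ k (fun ℓ₁ ℓ₂ ℓ₃ => chiDotCoeff χ ψ ℓ₁ t y₁ y₂ y₃ θ * ψ ℓ₂ t y₁ y₂ θ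
        * D ℓ₃ 2 2)

theorem fastDivSource_eq (V : VectorProfiles) (Y : ℝ) :
    fastDivSource χ ξ ψ V k t y₁ y₂ y₃ Y θ = divSource χ ξ ψ k t y₁ y₂ y₃ θ
      (fun ℓ α β => (V.full ℓ α).dy β t y₁ y₂ y₃ Y θ)
      (fun ℓ α => (V.full ℓ α).dY₃ t y₁ y₂ y₃ Y θ) :=
  rfl

/-- The terms with three factors in the source terms. -/
theorem sum₃_source_eq (n : ℕ) (D : ℕ → Fin 3 → ℝ) :
    sum₃ (n + 1) (fun ℓ₁ ℓ₂ ℓ₃ => chiCoeff χ ψ ℓ₁ t y₁ y₂ y₃ θ * (ψ ℓ₂).dθ t y₁ y₂ θ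
        * ∑ j : Fin 2, ξ j * D ℓ₃ j.castSucc)
    + sum₃ n (fun ℓ₁ ℓ₂ ℓ₃ => chiCoeff χ ψ ℓ₁ t y₁ y₂ y₃ θ
        * ∑ j : Fin 2, (ψ ℓ₂).dTan j t y₁ y₂ θ * D ℓ₃ j.castSucc)
    + sum₃ n (fun ℓ₁ ℓ₂ ℓ₃ => chiDotCoeff χ ψ ℓ₁ t y₁ y₂ y₃ θ * ψ ℓ₂ t y₁ y₂ θ
        * D ℓ₃ 2)
    = coeff (n + 1) (chiSeries χ ψ t y₁ y₂ y₃ θ * ∑ j : Fin 2, frontSlope ξ ψ j t y₁ y₂ θ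
          * PowerSeries.mk (fun ℓ => D ℓ j.castSucc)
        + X * (chiDotSeries χ ψ t y₁ y₂ y₃ θ * (frontSeries ψ t y₁ y₂ θ
          * PowerSeries.mk (fun ℓ => D ℓ 2)))) := by
  have hK : PowerSeries.mk (fun ℓ => chiCoeff χ ψ ℓ t y₁ y₂ y₃ θ) = chiSeries χ ψ t y₁ y₂ y₃ θ := by
    ext; simp [chiCoeff, chiSeries]
  have hL : PowerSeries.mk (fun ℓ => chiDotCoeff χ ψ ℓ t y₁ y₂ y₃ θ)
      = chiDotSeries χ ψ t y₁ y₂ y₃ θ := by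
    ext; simp [chiDotCoeff, chiDotSeries]
  have hC : ∀ j : Fin 2, PowerSeries.mk (fun ℓ => ξ j * D ℓ j.castSucc)
      = C (ξ j) * PowerSeries.mk (fun ℓ => D ℓ j.castSucc) := fun j => by ext; simp
  simp only [Finset.mul_sum, sum₃_finset_sum, mul_assoc, sum₃_mul, hK, hL, hC]
  -- The two sums of order n carry one slow derivative more; the factor ε in front of them raises
  -- them to the order n + 1 of the first sum.
  simp only [frontSlope, add_mul, mul_add, Finset.sum_add_distrib, map_add, map_sum,
    coeff_succ_X_mul]
  congr 2
  · refine Finset.sum_congr rfl fun j _ => ?_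
    rw [frontSeriesθ]
    congr 1
    ring
  · refine Finset.sum_congr rfl fun j _ => ?_
    rw [← coeff_succ_X_mul, frontSeriesTan]
    congr 1
    ring

/-- The ε in `frontSlope` absorbs the shift between the two orders. The values `E` are left free
because the formula serves both for ∂_{Y₃}V in the fast source and for the traces of V in the jump
source. -/
theorem sum₂_source_eq (n : ℕ) (E : ℕ → Fin 3 → ℝ) :
    sum₂ (n + 1) (fun ℓ₁ ℓ₂ => (ψ ℓ₁).dθ t y₁ y₂ θ
        * ∑ j : Fin 2, ξ j * E ℓ₂ j.castSucc)
    + sum₂ n (fun ℓ₁ ℓ₂ => ∑ j : Fin 2, (ψ ℓ₁).dTan j t y₁ y₂ θ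
        * E ℓ₂ j.castSucc)
    = coeff (n + 1) (∑ j : Fin 2, frontSlope ξ ψ j t y₁ y₂ θ
          * PowerSeries.mk (fun ℓ => E ℓ j.castSucc)) := by
  have hC : ∀ j : Fin 2, PowerSeries.mk (fun ℓ => ξ j * E ℓ j.castSucc)
      = C (ξ j) * PowerSeries.mk (fun ℓ => E ℓ j.castSucc) := fun j => by ext; simp
  simp only [Finset.mul_sum, sum₂_finset_sum, sum₂_mul, hC]
  simp only [frontSlope, add_mul, Finset.sum_add_distrib, map_add, map_sum]
  congr 1
  · refine Finset.sum_congr rfl fun j _ => ?_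
    rw [frontSeriesθ]
    congr 1
    ring
  · refine Finset.sum_congr rfl fun j _ => ?_
    rw [mul_assoc, coeff_succ_X_mul, frontSeriesTan]

/-- The terms with ∂_{Y₃} sit one order higher than those with ∂_{y₃}, because a derivative in Y₃ =
y₃/ε costs a factor 1/ε. -/
theorem divSource_eq_coeff (D : ℕ → Fin 3 → Fin 3 → ℝ) (E : ℕ → Fin 3 → ℝ) :
    divSource χ ξ ψ k t y₁ y₂ y₃ θ D E
      = coeff (k + 2) (∑ j : Fin 2, frontSlope ξ ψ j t y₁ y₂ θ
          * PowerSeries.mk (fun ℓ => E ℓ j.castSucc))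
        + coeff (k + 1) (chiSeries χ ψ t y₁ y₂ y₃ θ * ∑ j : Fin 2, frontSlope ξ ψ j t y₁ y₂ θ
            * PowerSeries.mk (fun ℓ => D ℓ j.castSucc 2)
          + X * (chiDotSeries χ ψ t y₁ y₂ y₃ θ * (frontSeries ψ t y₁ y₂ θ
            * PowerSeries.mk (fun ℓ => D ℓ 2 2))))
        - ∑ α : Fin 3, D k α α := by
  rw [← sum₃_source_eq χ ξ ψ t y₁ y₂ y₃ θ k fun ℓ α => D ℓ α 2, ← sum₂_source_eq, divSource]
  ring

variable {χ ξ ψ k t y₁ y₂ y₃ θ}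

/-- Linearity in the values of the derivatives is what allows the source to be split into a residual
and a surface wave part. -/
theorem divSource_add (D D' : ℕ → Fin 3 → Fin 3 → ℝ) (E E' : ℕ → Fin 3 → ℝ) :
    divSource χ ξ ψ k t y₁ y₂ y₃ θ (fun ℓ α β => D ℓ α β + D' ℓ α β) (fun ℓ α => E ℓ α + E' ℓ α)
      = divSource χ ξ ψ k t y₁ y₂ y₃ θ D E + divSource χ ξ ψ k t y₁ y₂ y₃ θ D' E' := by
  simp only [divSource, sum₂, sum₃, mul_add, Finset.sum_add_distrib]
  ring

theorem tendsto_divSource {ι : Type*} {l : Filter ι} {D : ι → ℕ → Fin 3 → Fin 3 → ℝ}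
    {E : ι → ℕ → Fin 3 → ℝ} (hD : ∀ ℓ α β, Tendsto (fun i => D i ℓ α β) l (𝓝 0))
    (hE : ∀ ℓ α, Tendsto (fun i => E i ℓ α) l (𝓝 0)) :
    Tendsto (fun i => divSource χ ξ ψ k t y₁ y₂ y₃ θ (D i) (E i)) l (𝓝 0) := by
  have h0 : divSource χ ξ ψ k t y₁ y₂ y₃ θ (fun _ _ _ => 0) (fun _ _ => 0) = 0 := by
    simp [divSource, sum₂, sum₃]
  rw [← h0]
  simp only [divSource, sum₂, sum₃]
  refine (((((Tendsto.neg ?_).add ?_).add ?_).add ?_).add ?_).add ?_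
  · exact tendsto_finsetSum _ fun α _ => hD _ _ _
  · exact tendsto_finsetSum _ fun p _ => (tendsto_finsetSum _ fun j _ =>
      (hE _ _).const_mul _).const_mul _
  · exact tendsto_finsetSum _ fun p _ => tendsto_finsetSum _ fun j _ => (hE _ _).const_mul _
  · exact tendsto_finsetSum _ fun p _ => tendsto_finsetSum _ fun q _ =>
      (tendsto_finsetSum _ fun j _ => (hD _ _ _).const_mul _).const_mul _
  · exact tendsto_finsetSum _ fun p _ => tendsto_finsetSum _ fun q _ =>
      (tendsto_finsetSum _ fun j _ => (hD _ _ _).const_mul _).const_mul _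
  · exact tendsto_finsetSum _ fun p _ => tendsto_finsetSum _ fun q _ => (hD _ _ _).const_mul _

end Source

/-! ### Locally constant cut-offs -/

/-- All derivatives of positive order vanish at `y`, so only the zeroth Taylor term survives,
whatever the formal displacement: where the cut-off is locally constant, the fronts do not affect it
at any order. -/
theorem formalComp_of_eventuallyEq_const {g : ℝ → ℝ} {y c : ℝ} (h : g =ᶠ[𝓝 y] fun _ => c)
    (Z : PowerSeries ℝ) : formalComp g y Z = C c := by
  ext k
  rw [formalComp, coeff_mk, Finset.sum_range_succ']
  have h1 : ∀ n : ℕ, iteratedDeriv (n + 1) g y = 0 := fun n => by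
    rw [h.iteratedDeriv_eq, iteratedDeriv_const]; simp
  simp only [h1, zero_div, zero_mul, Finset.sum_const_zero, zero_add, iteratedDeriv_zero,
    pow_zero, h.eq_of_nhds, coeff_one, coeff_C]
  simp

theorem IsCutoff.eventuallyEq_one {χ : ℝ → ℝ} (hχ : IsCutoff χ) {y : ℝ} (hy : |y| < 1 / 3) :
    χ =ᶠ[𝓝 y] fun _ => 1 := by
  have : Icc (-1 / 3 : ℝ) (1 / 3) ∈ 𝓝 y := by
    rw [abs_lt] at hy
    exact Icc_mem_nhds (by linarith) hy.2
  filter_upwards [this] with x hx using hχ.eq_one x hx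

theorem IsCutoff.eventuallyEq_zero {χ : ℝ → ℝ} (hχ : IsCutoff χ) {y : ℝ} (hy : 2 / 3 < |y|) :
    χ =ᶠ[𝓝 y] fun _ => 0 := by
  have : {x : ℝ | 2 / 3 < |x|} ∈ 𝓝 y :=
    (isOpen_lt continuous_const continuous_abs).mem_nhds hy
  filter_upwards [this] with x hx
  refine hχ.eq_zero x fun h => ?_
  have : |x| ≤ 2 / 3 := abs_le.2 ⟨by linarith [h.1], h.2⟩
  exact absurd hx (not_lt.2 this)

section Cutoff

variable {χ : ℝ → ℝ} {y₃ : ℝ}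

theorem chiSeries_eq_one (hχ : IsCutoff χ) (ψ : ℕ → FrontFun) (t y₁ y₂ θ : ℝ)
    (hy : |y₃| < 1 / 3) : chiSeries χ ψ t y₁ y₂ y₃ θ = 1 := by
  rw [chiSeries, formalComp_of_eventuallyEq_const (hχ.eventuallyEq_one hy), map_one]

theorem chiSeries_eq_zero (hχ : IsCutoff χ) (ψ : ℕ → FrontFun) (t y₁ y₂ θ : ℝ)
    (hy : 2 / 3 < |y₃|) : chiSeries χ ψ t y₁ y₂ y₃ θ = 0 := by
  rw [chiSeries, formalComp_of_eventuallyEq_const (hχ.eventuallyEq_zero hy), map_zero]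

theorem chiDotSeries_eq_zero (hχ : IsCutoff χ) (ψ : ℕ → FrontFun) (t y₁ y₂ θ : ℝ)
    (hy : |y₃| < 1 / 3) : chiDotSeries χ ψ t y₁ y₂ y₃ θ = 0 := by
  have h : deriv χ =ᶠ[𝓝 y₃] fun _ => 0 :=
    (hχ.eventuallyEq_one hy).deriv.trans (by simp)
  rw [chiDotSeries, formalComp_of_eventuallyEq_const h, map_zero]

theorem jacobian_eq_one (hχ : IsCutoff χ) (ψ : ℕ → FrontFun) (t y₁ y₂ θ : ℝ)
    (hy : |y₃| < 1 / 3) :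
    jacobian χ y₃ (frontSeries ψ t y₁ y₂ θ) = 1 := by
  have h := chiDotSeries_eq_zero hχ ψ t y₁ y₂ θ hy
  rw [chiDotSeries] at h
  rw [jacobian, h, zero_mul, sub_zero]
  simp

end Cutoff

/-! ### Families smooth at all orders, and the constraint on the residual profiles. -/

/-- A family of fronts and profiles, smooth at all orders, the residual profiles being zero beyond
the order `m`, which satisfies the fast divergence constraints up to order `m`. -/
structure IsSmoothFamily (T : ℝ) (m : ℕ) (χ : ℝ → ℝ) (ξ : Fin 2 → ℝ) (ψ : ℕ → FrontFun)
    (V : VectorProfiles) (σ : Side) : Prop where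
  T_pos : 0 < T
  cutoff : IsCutoff χ
  front_zero : ψ 0 = 0
  front_one : ψ 1 = 0
  front : ∀ ℓ, MemFront T (ψ ℓ)
  res_zero : ∀ α, V.res 0 α = fun _ _ _ _ _ => V.base α
  star_zero : ∀ α, V.star 0 α = 0
  res : ∀ ℓ α, MemRes σ T (V.res ℓ α)
  star : ∀ ℓ α, MemStar σ T (V.star ℓ α)
  res_gt : ∀ ℓ, m < ℓ → ∀ α, V.res ℓ α = 0
  div : FastDivergence χ ξ ψ V σ T m

/-- The residual profiles as a formal series. -/
def resSeries (V : VectorProfiles) (α : Fin 3) (t s y₁ y₂ θ : ℝ) : PowerSeries ℝ :=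
  PowerSeries.mk fun ℓ => (V.res ℓ α).slice t s y₁ y₂ θ

/-- The tangential derivatives of the residual profiles as a formal series. -/
def resSeriesTan (V : VectorProfiles) (α : Fin 3) (j : Fin 2) (t s y₁ y₂ θ : ℝ) : PowerSeries ℝ :=
  PowerSeries.mk fun ℓ => ((V.res ℓ α).slice t).dTan j s y₁ y₂ θ

/-- The fast derivatives of the residual profiles as a formal series. -/
def resSeriesθ (V : VectorProfiles) (α : Fin 3) (t s y₁ y₂ θ : ℝ) : PowerSeries ℝ :=
  PowerSeries.mk fun ℓ => ((V.res ℓ α).slice t).dθ s y₁ y₂ θ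

/-- The normal derivatives of the residual profiles as a formal series. -/
def resSeriesNormal (V : VectorProfiles) (α : Fin 3) (t s y₁ y₂ θ : ℝ) : PowerSeries ℝ :=
  PowerSeries.mk fun ℓ => (V.res ℓ α).dy₃ t y₁ y₂ s θ

namespace IsSmoothFamily

variable {T : ℝ} {m : ℕ} {χ : ℝ → ℝ} {ξ : Fin 2 → ℝ} {ψ : ℕ → FrontFun} {V : VectorProfiles}
  {σ : Side} {t : ℝ}

theorem constantCoeff_front (h : IsSmoothFamily T m χ ξ ψ V σ) (t y₁ y₂ θ : ℝ) :
    constantCoeff (frontSeries ψ t y₁ y₂ θ) = 0 := by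
  simp [frontSeries, ← coeff_zero_eq_constantCoeff_apply, h.front_zero]

/-- This gain of two orders makes the Jacobian invisible at order m + 2 and bounds the indices of
the profiles that can occur. -/
theorem X_sq_dvd_front (h : IsSmoothFamily T m χ ξ ψ V σ) (t y₁ y₂ θ : ℝ) :
    X ^ 2 ∣ frontSeries ψ t y₁ y₂ θ := by
  rw [X_pow_dvd_iff]
  intro k hk
  interval_cases k <;> simp [frontSeries, h.front_zero, h.front_one]

theorem dTan_zero_fun (j : Fin 2) : (0 : FrontFun).dTan j = 0 := by
  funext t y₁ y₂ θ
  fin_cases j <;> simp [FrontFun.dTan]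

theorem dθ_zero_fun : (0 : FrontFun).dθ = 0 := by
  funext t y₁ y₂ θ
  simp [FrontFun.dθ]

theorem X_sq_dvd_slope (h : IsSmoothFamily T m χ ξ ψ V σ) (j : Fin 2) (t y₁ y₂ θ : ℝ) :
    X ^ 2 ∣ frontSlope ξ ψ j t y₁ y₂ θ := by
  refine dvd_add (Dvd.dvd.mul_left ?_ _) (Dvd.dvd.mul_left ?_ _)
  all_goals
    rw [X_pow_dvd_iff]
    intro k hk
    interval_cases k <;>
      simp [frontSeriesθ, frontSeriesTan, h.front_zero, h.front_one, dTan_zero_fun, dθ_zero_fun]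

/-- Derivatives of the full profiles split into residual and surface wave parts. -/
theorem dy_full (h : IsSmoothFamily T m χ ξ ψ V σ) (ht : t ∈ Icc 0 T) (y₁ y₂ : ℝ) {y₃ : ℝ}
    (hy : y₃ ∈ Ioo σ.lo σ.hi) {Y : ℝ} (hY : 0 ≤ σ.sgn * Y) (θ : ℝ) (ℓ : ℕ) (α β : Fin 3) :
    (V.full ℓ α).dy β t y₁ y₂ y₃ Y θ
      = (V.res ℓ α).toStar.dy β t y₁ y₂ y₃ 0 θ + (V.star ℓ α).dy β t y₁ y₂ y₃ Y θ := by
  have hy' := Ioo_subset_Icc_self hy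
  have hr := ((h.res ℓ α).contDiffOn_slice ht).of_le (m := 1) (by exact_mod_cast le_top)
  fin_cases β
  · exact ((hasDerivAt_dTan_zero hr hy' y₁ y₂ θ).fun_add
      ((h.star ℓ α).hasDerivAt_dy_zero ht y₁ y₂ hy' hY θ).differentiableAt.hasDerivAt).deriv
  · exact ((hasDerivAt_dTan_one hr hy' y₁ y₂ θ).fun_add
      ((h.star ℓ α).hasDerivAt_dy_one ht y₁ y₂ hy' hY θ).differentiableAt.hasDerivAt).deriv
  · have h1 : HasDerivAt (fun s => V.res ℓ α t y₁ y₂ s θ) ((V.res ℓ α).dy₃ t y₁ y₂ y₃ θ) y₃ :=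
      ((hasDerivWithinAt_first hr one_ne_zero hy' y₁ y₂ θ).hasDerivAt
        (Icc_mem_nhds hy.1 hy.2)).differentiableAt.hasDerivAt
    exact (h1.fun_add
      ((h.star ℓ α).hasDerivAt_dy ht y₁ y₂ hy hY θ).differentiableAt.hasDerivAt).deriv

theorem dθ_full (h : IsSmoothFamily T m χ ξ ψ V σ) (ht : t ∈ Icc 0 T) (y₁ y₂ : ℝ) {y₃ : ℝ}
    (hy : y₃ ∈ Icc σ.lo σ.hi) {Y : ℝ} (hY : 0 ≤ σ.sgn * Y) (θ : ℝ) (ℓ : ℕ) (α : Fin 3) :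
    (V.full ℓ α).dθ t y₁ y₂ y₃ Y θ
      = ((V.res ℓ α).slice t).dθ y₃ y₁ y₂ θ + (V.star ℓ α).dθ t y₁ y₂ y₃ Y θ :=
  ((hasDerivAt_dθ (((h.res ℓ α).contDiffOn_slice ht).of_le (m := 1) (by exact_mod_cast le_top))
    hy y₁ y₂ θ).fun_add
    ((h.star ℓ α).hasDerivAt_dθ ht y₁ y₂ hy hY θ).differentiableAt.hasDerivAt).deriv

theorem dY₃_full (V : VectorProfiles) (ℓ : ℕ) (α : Fin 3) (t y₁ y₂ y₃ Y θ : ℝ) :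
    (V.full ℓ α).dY₃ t y₁ y₂ y₃ Y θ = (V.star ℓ α).dY₃ t y₁ y₂ y₃ Y θ :=
  deriv_const_add _

/-- The fast source splits into residual and surface wave parts. -/
theorem fastDivSource_split (h : IsSmoothFamily T m χ ξ ψ V σ) (ht : t ∈ Icc 0 T) (y₁ y₂ : ℝ)
    {y₃ : ℝ} (hy : y₃ ∈ Ioo σ.lo σ.hi) {Y : ℝ} (hY : 0 ≤ σ.sgn * Y) (θ : ℝ) (k : ℕ) :
    fastDivSource χ ξ ψ V k t y₁ y₂ y₃ Y θ
      = divSource χ ξ ψ k t y₁ y₂ y₃ θ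
          (fun ℓ α β => (V.res ℓ α).toStar.dy β t y₁ y₂ y₃ 0 θ) (fun _ _ => 0)
        + divSource χ ξ ψ k t y₁ y₂ y₃ θ (fun ℓ α β => (V.star ℓ α).dy β t y₁ y₂ y₃ Y θ)
          (fun ℓ α => (V.star ℓ α).dY₃ t y₁ y₂ y₃ Y θ) := by
  rw [fastDivSource_eq, ← divSource_add]
  simp only [h.dy_full ht y₁ y₂ hy hY θ, dY₃_full, zero_add]

/-- The divergence constraint for the residual profiles. -/
theorem residual_constraint (h : IsSmoothFamily T m χ ξ ψ V σ) (ht : t ∈ Icc 0 T) (y₁ y₂ : ℝ)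
    {y₃ : ℝ} (hy : y₃ ∈ Ioo σ.lo σ.hi) (θ : ℝ) {k : ℕ} (hk : k < m) :
    ∑ j : Fin 2, ξ j * ((V.res (k + 1) j.castSucc).slice t).dθ y₃ y₁ y₂ θ
      = divSource χ ξ ψ k t y₁ y₂ y₃ θ
          (fun ℓ α β => (V.res ℓ α).toStar.dy β t y₁ y₂ y₃ 0 θ) (fun _ _ => 0) := by
  have hy' := Ioo_subset_Icc_self hy
  set A : ℝ := ∑ j : Fin 2, ξ j * ((V.res (k + 1) j.castSucc).slice t).dθ y₃ y₁ y₂ θ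
    - divSource χ ξ ψ k t y₁ y₂ y₃ θ
        (fun ℓ α β => (V.res ℓ α).toStar.dy β t y₁ y₂ y₃ 0 θ) (fun _ _ => 0) with hA
  have h1 : Tendsto (fun r : ℝ => divSource χ ξ ψ k t y₁ y₂ y₃ θ
      (fun ℓ α β => (V.star ℓ α).dy β t y₁ y₂ y₃ (σ.sgn * r) θ)
      (fun ℓ α => (V.star ℓ α).dY₃ t y₁ y₂ y₃ (σ.sgn * r) θ)
      - ((V.star (k + 1) 2).dY₃ t y₁ y₂ y₃ (σ.sgn * r) θ
        + ∑ j : Fin 2, ξ j * (V.star (k + 1) j.castSucc).dθ t y₁ y₂ y₃ (σ.sgn * r) θ))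
      atTop (𝓝 (0 - (0 + ∑ j : Fin 2, ξ j * 0))) := by
    refine Tendsto.sub (tendsto_divSource
      (fun ℓ α β => (h.star ℓ α).tendsto_dy h.T_pos ht y₁ y₂ hy θ β)
      (fun ℓ α => (h.star ℓ α).tendsto_dY₃ h.T_pos ht y₁ y₂ hy' θ)) (Tendsto.add ?_ ?_)
    · exact (h.star _ _).tendsto_dY₃ h.T_pos ht y₁ y₂ hy' θ
    · exact tendsto_finsetSum _ fun j _ =>
        ((h.star _ _).tendsto_dθ h.T_pos ht y₁ y₂ hy' θ).const_mul _
  -- By the fast divergence constraint, the residual imbalance `A`, which does not depend on Y₃,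
  -- equals a combination of derivatives of surface waves; these decay as |Y₃| → ∞.
  have h2 : Tendsto (fun _ : ℝ => A) atTop (𝓝 0) := by
    simp only [mul_zero, Finset.sum_const_zero, add_zero, sub_zero] at h1
    refine h1.congr' ?_
    filter_upwards [eventually_gt_atTop 0] with r hr
    have hr' : 0 < σ.sgn * (σ.sgn * r) := by rwa [σ.sgn_mul_sgn_mul]
    have h3 := h.div k hk t ht y₁ y₂ y₃ hy _ hr' θ
    rw [h.fastDivSource_split ht y₁ y₂ hy hr'.le, dY₃_full] at h3
    simp only [h.dθ_full ht y₁ y₂ hy' hr'.le θ, mul_add, Finset.sum_add_distrib] at h3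
    rw [hA]
    linarith
  exact sub_eq_zero.1 (tendsto_nhds_unique tendsto_const_nhds h2)

end IsSmoothFamily

/-! ### The formal divergence and its Jacobian multiple. -/

section Pointwise

variable (χ : ℝ → ℝ) (ξ : Fin 2 → ℝ) (ψ : ℕ → FrontFun) (V : VectorProfiles)

/-- The formal divergence (multiplied by `ε`) of the residual profiles in the original variables. -/
def formalDiv (t s y₁ y₂ θ : ℝ) : PowerSeries ℝ :=
  ∑ j : Fin 2, (C (ξ j) * resSeriesθ V j.castSucc t s y₁ y₂ θ
      + X * resSeriesTan V j.castSucc j t s y₁ y₂ θ)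
    + X * resSeriesNormal V 2 t s y₁ y₂ θ
    - (chiSeries χ ψ t y₁ y₂ s θ * ∑ j : Fin 2, frontSlope ξ ψ j t y₁ y₂ θ
        * resSeriesNormal V j.castSucc t s y₁ y₂ θ
      + X * (chiDotSeries χ ψ t y₁ y₂ s θ * (frontSeries ψ t y₁ y₂ θ
          * resSeriesNormal V 2 t s y₁ y₂ θ)))

/-- The integrand of `slowDivSource`. -/
def slowDivIntegrand (m : ℕ) (t s y₁ y₂ θ : ℝ) : ℝ :=
  coeff (m + 2) (chiSeries χ ψ t y₁ y₂ s θ * ∑ j : Fin 2, frontSlope ξ ψ j t y₁ y₂ θ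
        * resSeriesNormal V j.castSucc t s y₁ y₂ θ
      + X * (chiDotSeries χ ψ t y₁ y₂ s θ * (frontSeries ψ t y₁ y₂ θ
          * resSeriesNormal V 2 t s y₁ y₂ θ)))

theorem slowDivSource_eq (m : ℕ) (t y₁ y₂ s : ℝ) : slowDivSource χ ξ ψ V m t y₁ y₂ s
    = mean fun θ => slowDivIntegrand χ ξ ψ V m t s y₁ y₂ θ := by
  unfold slowDivSource slowDivIntegrand resSeriesNormal
  congr 1
  funext θ
  exact sum₃_source_eq χ ξ ψ t y₁ y₂ s θ (m + 1) fun ℓ α => (V.res ℓ α).dy₃ t y₁ y₂ s θ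

end Pointwise

namespace IsSmoothFamily

variable {T : ℝ} {m : ℕ} {χ : ℝ → ℝ} {ξ : Fin 2 → ℝ} {ψ : ℕ → FrontFun} {V : VectorProfiles}
  {σ : Side} {t : ℝ}

/-- Orders 1 to m are the residual constraints. At order 0 the base profile is constant and the
slopes start at order 2. -/
theorem coeff_formalDiv (h : IsSmoothFamily T m χ ξ ψ V σ) (ht : t ∈ Icc 0 T) (y₁ y₂ : ℝ)
    {s : ℝ} (hs : s ∈ Ioo σ.lo σ.hi) (θ : ℝ) {i : ℕ} (hi : i < m + 1) :
    coeff i (formalDiv χ ξ ψ V t s y₁ y₂ θ) = 0 := by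
  cases i with
  | zero =>
    have h1 : ∀ j, constantCoeff (frontSlope ξ ψ j t y₁ y₂ θ) = 0 := fun j =>
      X_dvd_iff.1 ((dvd_pow_self X two_ne_zero).trans (h.X_sq_dvd_slope j t y₁ y₂ θ))
    have h2 : ∀ α, constantCoeff (resSeriesθ V α t s y₁ y₂ θ) = 0 := fun α => by
      simp [resSeriesθ, ← coeff_zero_eq_constantCoeff_apply, h.res_zero, ResFun.slice, FrontFun.dθ]
    simp [formalDiv, h1, h2]
  | succ k =>
    have h1 := h.residual_constraint ht y₁ y₂ hs θ (k := k) (by omega)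
    rw [divSource_eq_coeff] at h1
    have h2 : PowerSeries.mk (fun _ : ℕ => (0 : ℝ)) = 0 := by ext; simp
    simp only [h2, mul_zero, Finset.sum_const_zero, map_zero, zero_add] at h1
    have h3 : ∑ α : Fin 3, (V.res k α).toStar.dy α t y₁ y₂ s 0 θ
        = coeff (k + 1) (∑ j : Fin 2, X * resSeriesTan V j.castSucc j t s y₁ y₂ θ
          + X * resSeriesNormal V 2 t s y₁ y₂ θ) := by
      rw [Fin.sum_univ_three, Fin.sum_univ_two]
      simp only [map_add, coeff_succ_X_mul, resSeriesTan, resSeriesNormal, coeff_mk]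
      rfl
    have h4 : ∑ j : Fin 2, ξ j * ((V.res (k + 1) j.castSucc).slice t).dθ s y₁ y₂ θ
        = coeff (k + 1) (∑ j : Fin 2, C (ξ j) * resSeriesθ V j.castSucc t s y₁ y₂ θ) := by
      simp [resSeriesθ]
    rw [h3, h4] at h1
    rw [formalDiv, map_sub, Finset.sum_add_distrib, add_assoc, map_add, h1]
    simp only [resSeriesNormal]
    change coeff (k + 1) _ - coeff (k + 1) _ + coeff (k + 1) _ - coeff (k + 1) _ = 0
    exact (by intros; ring : ∀ a b : ℝ, a - b + b - a = 0) _ _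

/-- J - 1 = Jχ'Ψ is divisible by ε² and the formal divergence by ε^{m+1}, so their product starts
beyond order m + 2. At that order the terms of the divergence without front involve only residual
profiles of orders m + 1 and m + 2, which are zero. -/
theorem coeff_jacobian_mul_formalDiv (h : IsSmoothFamily T m χ ξ ψ V σ) (ht : t ∈ Icc 0 T)
    (y₁ y₂ : ℝ) {s : ℝ} (hs : s ∈ Ioo σ.lo σ.hi) (θ : ℝ) :
    coeff (m + 2) (jacobian χ s (frontSeries ψ t y₁ y₂ θ) * formalDiv χ ξ ψ V t s y₁ y₂ θ)
      = -slowDivIntegrand χ ξ ψ V m t s y₁ y₂ θ := by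
  set J := jacobian χ s (frontSeries ψ t y₁ y₂ θ)
  set B := formalDiv χ ξ ψ V t s y₁ y₂ θ with hB
  have hJ : J * (1 - chiDotSeries χ ψ t y₁ y₂ s θ * frontSeries ψ t y₁ y₂ θ) = 1 :=
    jacobian_spec χ s (h.constantCoeff_front t y₁ y₂ θ)
  have h1 : J * B = B + frontSeries ψ t y₁ y₂ θ * B * (J * chiDotSeries χ ψ t y₁ y₂ s θ) := by
    linear_combination B * hJ
  have h2 : X ^ (2 + (m + 1)) ∣ frontSeries ψ t y₁ y₂ θ * B * (J * chiDotSeries χ ψ t y₁ y₂ s θ) := by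
    rw [pow_add]
    exact Dvd.dvd.mul_right (mul_dvd_mul (h.X_sq_dvd_front t y₁ y₂ θ)
      (X_pow_dvd_iff.2 fun i hi => h.coeff_formalDiv ht y₁ y₂ hs θ hi)) _
  rw [h1, map_add, X_pow_dvd_iff.1 h2 (m + 2) (by omega), add_zero, hB, formalDiv, map_sub,
    slowDivIntegrand]
  have h3 : coeff (m + 2) (∑ j : Fin 2, (C (ξ j) * resSeriesθ V j.castSucc t s y₁ y₂ θ
      + X * resSeriesTan V j.castSucc j t s y₁ y₂ θ)
      + X * resSeriesNormal V 2 t s y₁ y₂ θ) = 0 := by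
    have hz : (0 : ResFun).slice t = 0 := rfl
    simp only [map_add, map_sum, coeff_succ_X_mul, coeff_C_mul, resSeriesθ, resSeriesTan,
      resSeriesNormal, coeff_mk, h.res_gt (m + 2) (by omega), h.res_gt (m + 1) (by omega), hz,
      dTan_zero_fun, dθ_zero_fun]
    simp [ResFun.dy₃]
  rw [h3, zero_sub]

end IsSmoothFamily

/-! ### Fluxes of the residual profiles and the integral of the interior source. -/

section Flux

variable (χ : ℝ → ℝ) (ξ : Fin 2 → ℝ) (ψ : ℕ → FrontFun) (V : VectorProfiles) (m : ℕ) (t : ℝ)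

/-- The normal flux of the residual profiles at order `m + 1`. -/
def normalFlux : FrontFun := fun s y₁ y₂ θ =>
  coeff (m + 2) (∑ j : Fin 2, jacobian χ s (frontSeries ψ t y₁ y₂ θ)
    * (chiSeries χ ψ t y₁ y₂ s θ * frontSlope ξ ψ j t y₁ y₂ θ)
    * resSeries V j.castSucc t s y₁ y₂ θ)

/-- The tangential fluxes of the residual profiles at order `m + 1`. -/
def tanFlux (j : Fin 2) : FrontFun := fun s y₁ y₂ θ =>
  coeff (m + 1) (-(jacobian χ s (frontSeries ψ t y₁ y₂ θ) * resSeries V j.castSucc t s y₁ y₂ θ))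

/-- The flux of the residual profiles in the fast variable, at order `m + 1`. -/
def fastFlux : FrontFun := fun s y₁ y₂ θ =>
  coeff (m + 2) (-(∑ j : Fin 2, C (ξ j) * (jacobian χ s (frontSeries ψ t y₁ y₂ θ)
    * resSeries V j.castSucc t s y₁ y₂ θ)))

end Flux

theorem frontSeries_periodic {ψ : ℕ → FrontFun} {t : ℝ} (h : ∀ ℓ, Periodic3 (ψ ℓ t))
    (y₁ y₂ θ : ℝ) :
    frontSeries ψ t (y₁ + 2 * Real.pi) y₂ θ = frontSeries ψ t y₁ y₂ θ ∧
    frontSeries ψ t y₁ (y₂ + 2 * Real.pi) θ = frontSeries ψ t y₁ y₂ θ ∧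
    frontSeries ψ t y₁ y₂ (θ + 2 * Real.pi) = frontSeries ψ t y₁ y₂ θ := by
  simp only [frontSeries, (h _).y₁, (h _).y₂, (h _).θ, and_self]

theorem resSeries_periodic {V : VectorProfiles} {t s : ℝ} {α : Fin 3}
    (h : ∀ ℓ, Periodic3 ((V.res ℓ α).slice t s)) (y₁ y₂ θ : ℝ) :
    resSeries V α t s (y₁ + 2 * Real.pi) y₂ θ = resSeries V α t s y₁ y₂ θ ∧
    resSeries V α t s y₁ (y₂ + 2 * Real.pi) θ = resSeries V α t s y₁ y₂ θ ∧
    resSeries V α t s y₁ y₂ (θ + 2 * Real.pi) = resSeries V α t s y₁ y₂ θ := by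
  simp only [resSeries, (h _).y₁, (h _).y₂, (h _).θ, and_self]

theorem PSContDiffOn.neg {E : Type*} [NormedAddCommGroup E] [NormedSpace ℝ E] {n : WithTop ℕ∞}
    {S : Set E} {F : E → PowerSeries ℝ} (hF : PSContDiffOn n F S) :
    PSContDiffOn n (fun p => -F p) S := fun k => by
  simpa using (hF k).neg

namespace IsSmoothFamily

variable {T : ℝ} {m : ℕ} {χ : ℝ → ℝ} {ξ : Fin 2 → ℝ} {ψ : ℕ → FrontFun} {V : VectorProfiles}
  {σ : Side} {t : ℝ}

theorem psContDiffOn_front (h : IsSmoothFamily T m χ ξ ψ V σ) (ht : t ∈ Icc 0 T)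
    (S : Set (ℝ × ℝ × ℝ × ℝ)) :
    PSContDiffOn ∞ (fun p : ℝ × ℝ × ℝ × ℝ => frontSeries ψ t p.2.1 p.2.2.1 p.2.2.2) S :=
  fun k => by
    simp only [frontSeries, coeff_mk]
    exact contDiffOn_frontSlice (h.front k).contDiffOn ht S

theorem psContDiffOn_slope (h : IsSmoothFamily T m χ ξ ψ V σ) (ht : t ∈ Icc 0 T) (j : Fin 2)
    (S : Set (ℝ × ℝ × ℝ × ℝ)) :
    PSContDiffOn ∞ (fun p : ℝ × ℝ × ℝ × ℝ => frontSlope ξ ψ j t p.2.1 p.2.2.1 p.2.2.2) S := by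
  refine ((psContDiffOn_const _).mul fun k => ?_).add ((psContDiffOn_const _).mul fun k => ?_)
  · simp only [frontSeriesθ, coeff_mk]
    exact contDiffOn_frontSlice ((h.front k).contDiffOn_dθ h.T_pos) ht S
  · simp only [frontSeriesTan, coeff_mk]
    exact contDiffOn_frontSlice ((h.front k).contDiffOn_dTan h.T_pos j) ht S

theorem psContDiffOn_jacobian (h : IsSmoothFamily T m χ ξ ψ V σ) (ht : t ∈ Icc 0 T)
    (S : Set (ℝ × ℝ × ℝ × ℝ)) :
    PSContDiffOn ∞ (fun p : ℝ × ℝ × ℝ × ℝ =>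
      jacobian χ p.1 (frontSeries ψ t p.2.1 p.2.2.1 p.2.2.2)) S :=
  (h.psContDiffOn_front ht S).jacobian h.cutoff.smooth contDiffOn_fst
    fun _ => h.constantCoeff_front _ _ _ _

theorem psContDiffOn_chi (h : IsSmoothFamily T m χ ξ ψ V σ) (ht : t ∈ Icc 0 T)
    (S : Set (ℝ × ℝ × ℝ × ℝ)) :
    PSContDiffOn ∞ (fun p : ℝ × ℝ × ℝ × ℝ => chiSeries χ ψ t p.2.1 p.2.2.1 p.1 p.2.2.2) S :=
  ((h.psContDiffOn_front ht S).shift h.cutoff.smooth contDiffOn_fst).formalComp h.cutoff.smooth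
    contDiffOn_fst

theorem psContDiffOn_res (h : IsSmoothFamily T m χ ξ ψ V σ) (ht : t ∈ Icc 0 T) (α : Fin 3) :
    PSContDiffOn ∞ (fun p : ℝ × ℝ × ℝ × ℝ => resSeries V α t p.1 p.2.1 p.2.2.1 p.2.2.2)
      (slab (Icc σ.lo σ.hi)) := fun k => by
  simp only [resSeries, coeff_mk]
  exact (h.res k α).contDiffOn_slice ht

theorem contDiffOn_normalFlux (h : IsSmoothFamily T m χ ξ ψ V σ) (ht : t ∈ Icc 0 T) :
    ContDiffOn ℝ 1 (normalFlux χ ξ ψ V m t).uncurried (slab (Icc σ.lo σ.hi)) :=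
  ContDiffOn.of_le ((psContDiffOn_sum _ fun j _ => ((h.psContDiffOn_jacobian ht _).mul
    ((h.psContDiffOn_chi ht _).mul (h.psContDiffOn_slope ht j _))).mul
      (h.psContDiffOn_res ht j.castSucc)) (m + 2)) (by exact_mod_cast le_top)

theorem contDiffOn_tanFlux (h : IsSmoothFamily T m χ ξ ψ V σ) (ht : t ∈ Icc 0 T) (j : Fin 2) :
    ContDiffOn ℝ 1 (tanFlux χ ψ V m t j).uncurried (slab (Icc σ.lo σ.hi)) :=
  ContDiffOn.of_le (((h.psContDiffOn_jacobian ht _).mul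
    (h.psContDiffOn_res ht j.castSucc)).neg (m + 1)) (by exact_mod_cast le_top)

theorem contDiffOn_fastFlux (h : IsSmoothFamily T m χ ξ ψ V σ) (ht : t ∈ Icc 0 T) :
    ContDiffOn ℝ 1 (fastFlux χ ξ ψ V m t).uncurried (slab (Icc σ.lo σ.hi)) :=
  ContDiffOn.of_le ((psContDiffOn_sum _ fun j _ => (psContDiffOn_const (C (ξ j))).mul
    ((h.psContDiffOn_jacobian ht _).mul (h.psContDiffOn_res ht j.castSucc))).neg (m + 2))
    (by exact_mod_cast le_top)

theorem periodic_tanFlux (h : IsSmoothFamily T m χ ξ ψ V σ) (ht : t ∈ Icc 0 T) (j : Fin 2)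
    {s : ℝ} (hs : s ∈ Icc σ.lo σ.hi) : Periodic3 (tanFlux χ ψ V m t j s) := by
  have hf := frontSeries_periodic (ψ := ψ) fun ℓ => (h.front ℓ).periodic ht
  have hr := resSeries_periodic (V := V) fun ℓ => (h.res ℓ j.castSucc).periodic ht hs
  constructor <;> intro y₁ y₂ θ <;>
    simp only [tanFlux, (hf _ _ _).1, (hf _ _ _).2.1, (hf _ _ _).2.2, (hr _ _ _).1,
      (hr _ _ _).2.1, (hr _ _ _).2.2]

theorem periodic_fastFlux (h : IsSmoothFamily T m χ ξ ψ V σ) (ht : t ∈ Icc 0 T)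
    {s : ℝ} (hs : s ∈ Icc σ.lo σ.hi) : Periodic3 (fastFlux χ ξ ψ V m t s) := by
  have hf := frontSeries_periodic (ψ := ψ) fun ℓ => (h.front ℓ).periodic ht
  have hr := fun j : Fin 2 =>
    resSeries_periodic (V := V) fun ℓ => (h.res ℓ j.castSucc).periodic ht hs
  constructor <;> intro y₁ y₂ θ <;>
    simp only [fastFlux, (hf _ _ _).1, (hf _ _ _).2.1, (hf _ _ _).2.2, (hr _ _ _ _).1,
      (hr _ _ _ _).2.1, (hr _ _ _ _).2.2]

theorem contDiffOn_front_one (h : IsSmoothFamily T m χ ξ ψ V σ) (ℓ : ℕ) :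
    ContDiffOn ℝ 1 (ψ ℓ).uncurried (slab (Icc 0 T)) :=
  (h.front ℓ).contDiffOn.of_le (by exact_mod_cast le_top)

theorem contDiffOn_res_one (h : IsSmoothFamily T m χ ξ ψ V σ) (ht : t ∈ Icc 0 T) (ℓ : ℕ)
    (α : Fin 3) : ContDiffOn ℝ 1 ((V.res ℓ α).slice t).uncurried (slab (Icc σ.lo σ.hi)) :=
  ((h.res ℓ α).contDiffOn_slice ht).of_le (by exact_mod_cast le_top)

theorem dTan_tanFlux (h : IsSmoothFamily T m χ ξ ψ V σ) (ht : t ∈ Icc 0 T) (j : Fin 2)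
    {s : ℝ} (hs : s ∈ Icc σ.lo σ.hi) (y₁ y₂ θ : ℝ) :
    (tanFlux χ ψ V m t j).dTan j s y₁ y₂ θ
      = coeff (m + 1) (-(jacobianDeriv χ s (frontSeries ψ t y₁ y₂ θ) (frontSeriesTan ψ j t y₁ y₂ θ)
          * resSeries V j.castSucc t s y₁ y₂ θ
        + jacobian χ s (frontSeries ψ t y₁ y₂ θ) * resSeriesTan V j.castSucc j t s y₁ y₂ θ)) := by
  fin_cases j
  · have h1 : PSHasDerivAt (fun r => frontSeries ψ t r y₂ θ) (frontSeriesTan ψ 0 t y₁ y₂ θ) y₁ :=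
      fun k => by
        simp only [frontSeries, frontSeriesTan, coeff_mk]
        exact hasDerivAt_dTan_zero (h.contDiffOn_front_one k) ht y₁ y₂ θ
    have h2 : PSHasDerivAt (fun r => resSeries V 0 t s r y₂ θ)
        (resSeriesTan V 0 0 t s y₁ y₂ θ) y₁ := fun k => by
      simp only [resSeries, resSeriesTan, coeff_mk]
      exact hasDerivAt_dTan_zero (h.contDiffOn_res_one ht k _) hs y₁ y₂ θ
    exact (((psHasDerivAt_jacobian h.cutoff.smooth s h1
      fun _ => h.constantCoeff_front _ _ _ _).mul h2).neg (m + 1)).deriv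
  · have h1 : PSHasDerivAt (fun r => frontSeries ψ t y₁ r θ) (frontSeriesTan ψ 1 t y₁ y₂ θ) y₂ :=
      fun k => by
        simp only [frontSeries, frontSeriesTan, coeff_mk]
        exact hasDerivAt_dTan_one (h.contDiffOn_front_one k) ht y₁ y₂ θ
    have h2 : PSHasDerivAt (fun r => resSeries V 1 t s y₁ r θ)
        (resSeriesTan V 1 1 t s y₁ y₂ θ) y₂ := fun k => by
      simp only [resSeries, resSeriesTan, coeff_mk]
      exact hasDerivAt_dTan_one (h.contDiffOn_res_one ht k _) hs y₁ y₂ θ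
    exact (((psHasDerivAt_jacobian h.cutoff.smooth s h1
      fun _ => h.constantCoeff_front _ _ _ _).mul h2).neg (m + 1)).deriv

theorem dθ_fastFlux (h : IsSmoothFamily T m χ ξ ψ V σ) (ht : t ∈ Icc 0 T)
    {s : ℝ} (hs : s ∈ Icc σ.lo σ.hi) (y₁ y₂ θ : ℝ) :
    (fastFlux χ ξ ψ V m t).dθ s y₁ y₂ θ
      = coeff (m + 2) (-(∑ j : Fin 2, C (ξ j) *
        (jacobianDeriv χ s (frontSeries ψ t y₁ y₂ θ) (frontSeriesθ ψ t y₁ y₂ θ)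
          * resSeries V j.castSucc t s y₁ y₂ θ
        + jacobian χ s (frontSeries ψ t y₁ y₂ θ) * resSeriesθ V j.castSucc t s y₁ y₂ θ))) := by
  have h1 : PSHasDerivAt (fun r => frontSeries ψ t y₁ y₂ r) (frontSeriesθ ψ t y₁ y₂ θ) θ :=
    fun k => by
      simp only [frontSeries, frontSeriesθ, coeff_mk]
      exact hasDerivAt_dθ (h.contDiffOn_front_one k) ht y₁ y₂ θ
  have h2 : ∀ j : Fin 2, PSHasDerivAt (fun r => resSeries V j.castSucc t s y₁ y₂ r)
      (resSeriesθ V j.castSucc t s y₁ y₂ θ) θ := fun j k => by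
    simp only [resSeries, resSeriesθ, coeff_mk]
    exact hasDerivAt_dθ (h.contDiffOn_res_one ht k _) hs y₁ y₂ θ
  exact ((psHasDerivAt_sum Finset.univ fun j _ => ((psHasDerivAt_jacobian h.cutoff.smooth s h1
      fun _ => h.constantCoeff_front _ _ _ _).mul (h2 j)).const_mul (C (ξ j))).neg (m + 2)).deriv

/-- The slope does not depend on y₃, so `psHasDerivAt_jacobian_mul` applies in the direction of the
slope. As `jacobianDeriv` is linear in the direction, its θ and tangential parts will match those in
`dθ_fastFlux` and `dTan_tanFlux`. -/
theorem deriv_normalFlux (h : IsSmoothFamily T m χ ξ ψ V σ) (ht : t ∈ Icc 0 T)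
    {s : ℝ} (hs : s ∈ Ioo σ.lo σ.hi) (y₁ y₂ θ : ℝ) :
    deriv (fun r => normalFlux χ ξ ψ V m t r y₁ y₂ θ) s
      = coeff (m + 2) (∑ j : Fin 2,
        (jacobianDeriv χ s (frontSeries ψ t y₁ y₂ θ) (frontSlope ξ ψ j t y₁ y₂ θ)
          * resSeries V j.castSucc t s y₁ y₂ θ
        + jacobian χ s (frontSeries ψ t y₁ y₂ θ)
          * (chiSeries χ ψ t y₁ y₂ s θ * frontSlope ξ ψ j t y₁ y₂ θ)
          * resSeriesNormal V j.castSucc t s y₁ y₂ θ)) := by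
  have h2 : ∀ j : Fin 2, PSHasDerivAt (fun r => resSeries V j.castSucc t r y₁ y₂ θ)
      (resSeriesNormal V j.castSucc t s y₁ y₂ θ) s := fun j k => by
    simp only [resSeries, resSeriesNormal, coeff_mk]
    exact ((hasDerivWithinAt_first (h.contDiffOn_res_one ht k j.castSucc) one_ne_zero
      (Ioo_subset_Icc_self hs) y₁ y₂ θ).hasDerivAt
        (Icc_mem_nhds hs.1 hs.2)).differentiableAt.hasDerivAt
  exact (psHasDerivAt_sum Finset.univ (fun j _ => (psHasDerivAt_jacobian_mul h.cutoff.smooth s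
      (frontSlope ξ ψ j t y₁ y₂ θ) (h.constantCoeff_front t y₁ y₂ θ)).mul (h2 j)) (m + 2)).deriv

/-- The Piola identity: the terms in which the profiles are not differentiated cancel, and the three
flux derivatives add up to -JB plus the term ε ∂₃V₃, whose coefficient of order m + 2 is the
derivative of a vanishing profile of order m + 1. -/
theorem slowDivIntegrand_eq (h : IsSmoothFamily T m χ ξ ψ V σ) (ht : t ∈ Icc 0 T)
    {s : ℝ} (hs : s ∈ Ioo σ.lo σ.hi) (y₁ y₂ θ : ℝ) :
    slowDivIntegrand χ ξ ψ V m t s y₁ y₂ θ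
      = deriv (fun r => normalFlux χ ξ ψ V m t r y₁ y₂ θ) s
        + ∑ j, (tanFlux χ ψ V m t j).dTan j s y₁ y₂ θ + (fastFlux χ ξ ψ V m t).dθ s y₁ y₂ θ := by
  have hs' := Ioo_subset_Icc_self hs
  have h0 : coeff (m + 2) (X * resSeriesNormal V 2 t s y₁ y₂ θ) = 0 := by
    rw [coeff_succ_X_mul, resSeriesNormal, coeff_mk, h.res_gt (m + 1) (by omega)]
    simp [ResFun.dy₃]
  rw [← neg_eq_iff_eq_neg.2 (h.coeff_jacobian_mul_formalDiv ht y₁ y₂ hs θ),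
    h.deriv_normalFlux ht hs, h.dθ_fastFlux ht hs']
  simp only [h.dTan_tanFlux ht _ hs']
  -- The tangential fluxes are coefficients of order m + 1; a factor ε aligns them with the other
  -- two fluxes.
  simp only [← coeff_succ_X_mul (m + 1)]
  rw [← map_sum, ← map_add, ← map_add, ← map_neg, ← sub_eq_zero, ← map_sub, ← neg_eq_zero,
    ← map_neg, ← h0]
  congr 1
  have hJ := jacobian_spec χ s (h.constantCoeff_front t y₁ y₂ θ)
  simp only [formalDiv, Fin.sum_univ_two, frontSlope, jacobianDeriv, chiSeries, chiDotSeries] at hJ ⊢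
  -- The normal component enters only as J(1 - χ'Ψ) ε ∂₃V₃, which equals ε ∂₃V₃ by the definition of
  -- J.
  linear_combination (X * resSeriesNormal V 2 t s y₁ y₂ θ) * hJ

theorem normalFlux_outer (h : IsSmoothFamily T m χ ξ ψ V σ) {s : ℝ} (hs : 2 / 3 < |s|)
    (y₁ y₂ θ : ℝ) : normalFlux χ ξ ψ V m t s y₁ y₂ θ = 0 := by
  simp [normalFlux, chiSeries_eq_zero h.cutoff ψ t y₁ y₂ θ hs]

theorem normalFlux_zero (h : IsSmoothFamily T m χ ξ ψ V σ) (y₁ y₂ θ : ℝ) :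
    normalFlux χ ξ ψ V m t 0 y₁ y₂ θ = coeff (m + 2) (∑ j : Fin 2, frontSlope ξ ψ j t y₁ y₂ θ
      * resSeries V j.castSucc t 0 y₁ y₂ θ) := by
  have h0 : |(0 : ℝ)| < 1 / 3 := by norm_num
  simp only [normalFlux, chiSeries_eq_one h.cutoff ψ t y₁ y₂ θ h0,
    jacobian_eq_one h.cutoff ψ t y₁ y₂ θ h0, one_mul]

/-- The integral of the interior source term. -/
theorem integral_slowDivSource (h : IsSmoothFamily T m χ ξ ψ V σ) (ht : t ∈ Icc 0 T) :
    integralΩ₀ σ (fun y₁ y₂ y₃ => slowDivSource χ ξ ψ V m t y₁ y₂ y₃)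
      = -(σ.sgn * ((2 * Real.pi)⁻¹ * torusInt fun y₁ y₂ θ =>
        coeff (m + 2) (∑ j : Fin 2, frontSlope ξ ψ j t y₁ y₂ θ
          * resSeries V j.castSucc t 0 y₁ y₂ θ))) := by
  have h1 := integral_slab_divergence σ.lo_lt_hi (g := slowDivIntegrand χ ξ ψ V m t)
    (h.contDiffOn_normalFlux ht) (h.contDiffOn_tanFlux ht) (h.contDiffOn_fastFlux ht)
    (fun j s hs => h.periodic_tanFlux ht j hs) (fun s hs => h.periodic_fastFlux ht hs)
    fun s hs y₁ y₂ θ => h.slowDivIntegrand_eq ht hs y₁ y₂ θ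
  simp only [integralΩ₀, slowDivSource_eq, mean, intervalIntegral.integral_const_mul]
  rw [h1, ← torusInt_congr h.normalFlux_zero]
  -- The outer end is the upper one on the plus side and the lower one on the minus side. The
  -- cut-off removes the flux there, and the end y₃ = 0 contributes with the sign -σ.
  cases σ
  · have h2 : torusInt (normalFlux χ ξ ψ V m t 1) = 0 := by
      rw [torusInt_congr (h.normalFlux_outer (by norm_num : (2:ℝ) / 3 < |1|)), torusInt_zero]
    simp [Side.hi, Side.lo, Side.sgn, h2]
  · have h2 : torusInt (normalFlux χ ξ ψ V m t (-1)) = 0 := by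
      rw [torusInt_congr (h.normalFlux_outer (by norm_num : (2:ℝ) / 3 < |-1|)), torusInt_zero]
    simp [Side.hi, Side.lo, Side.sgn, h2]

end IsSmoothFamily

/-! ### Surface wave profiles -/

/-- A function of `(t, y, Y₃, θ)` at fixed `t` along a curve in the variables `(y₃, Y₃)`. -/
def StarFun.along (f : StarFun) (t : ℝ) (a b : ℝ → ℝ) : FrontFun :=
  fun s y₁ y₂ θ => f t y₁ y₂ (a s) (b s) θ

theorem MemStar.contDiffOn_along {σ : Side} {T t : ℝ} {f : StarFun} (hf : MemStar σ T f)
    (ht : t ∈ Icc 0 T) {a b : ℝ → ℝ} (ha : ContDiff ℝ ∞ a) (hb : ContDiff ℝ ∞ b) {I : Set ℝ}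
    (haI : ∀ s ∈ I, a s ∈ Icc σ.lo σ.hi) (hbI : ∀ s ∈ I, 0 ≤ σ.sgn * b s) :
    ContDiffOn ℝ ∞ (f.along t a b).uncurried (slab I) :=
  hf.smooth.comp (f := fun p : ℝ × ℝ × ℝ × ℝ => (t, p.2.1, p.2.2.1, a p.1, b p.1, p.2.2.2))
    (by fun_prop) fun p hp => ⟨ht, haI _ hp, hbI _ hp⟩

/-- The surface wave profiles as a formal series. -/
def starSeries (V : VectorProfiles) (α : Fin 3) (t y₁ y₂ y₃ Y θ : ℝ) : PowerSeries ℝ :=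
  PowerSeries.mk fun ℓ => V.star ℓ α t y₁ y₂ y₃ Y θ

/-- The tangential part, of order `n`, of the normal flux of the surface wave profiles. -/
def starFlux (ξ : Fin 2 → ℝ) (ψ : ℕ → FrontFun) (V : VectorProfiles) (n : ℕ) : StarFun :=
  fun t y₁ y₂ y₃ Y θ => coeff n (∑ j : Fin 2, frontSlope ξ ψ j t y₁ y₂ θ
    * starSeries V j.castSucc t y₁ y₂ y₃ Y θ)

/-- The difference of a profile and of the tangential part of the normal flux. -/
def starDefect (ξ : Fin 2 → ℝ) (ψ : ℕ → FrontFun) (V : VectorProfiles) (N : StarFun) (n : ℕ) :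
    StarFun :=
  fun t y₁ y₂ y₃ Y θ => N t y₁ y₂ y₃ Y θ - starFlux ξ ψ V n t y₁ y₂ y₃ Y θ

theorem Cont3.exists_bound {f : ℝ → ℝ → ℝ → ℝ} (hf : Cont3 f) :
    ∃ K, 0 ≤ K ∧ ∀ y₁ ∈ Icc (0 : ℝ) (2 * Real.pi), ∀ y₂ ∈ Icc (0 : ℝ) (2 * Real.pi),
      ∀ θ ∈ Icc (0 : ℝ) (2 * Real.pi), |f y₁ y₂ θ| ≤ K := by
  obtain ⟨K, hK⟩ := ((isCompact_Icc (a := (0 : ℝ)) (b := 2 * Real.pi)).prod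
    ((isCompact_Icc (a := (0 : ℝ)) (b := 2 * Real.pi)).prod
      (isCompact_Icc (a := (0 : ℝ)) (b := 2 * Real.pi)))).exists_bound_of_continuousOn
    (Continuous.continuousOn hf)
  have h0 : (0 : ℝ) ∈ Icc (0 : ℝ) (2 * Real.pi) := ⟨le_rfl, Real.two_pi_pos.le⟩
  exact ⟨K, (norm_nonneg _).trans (hK (0, 0, 0) ⟨h0, h0, h0⟩),
    fun y₁ h₁ y₂ h₂ θ h₃ => hK (y₁, y₂, θ) ⟨h₁, h₂, h₃⟩⟩

theorem tendsto_torusInt_mul {A : ℝ → ℝ → ℝ → ℝ} (hA : Cont3 A) {S : ℝ → ℝ → ℝ → ℝ → ℝ}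
    {b : ℝ → ℝ} (hb : Tendsto b atTop (𝓝 0))
    (hS : ∀ r, 0 ≤ r → ∀ y₁ y₂ θ, |S r y₁ y₂ θ| ≤ b r) :
    Tendsto (fun r => torusInt fun y₁ y₂ θ => A y₁ y₂ θ * S r y₁ y₂ θ) atTop (𝓝 0) := by
  obtain ⟨K, hK0, hK⟩ := hA.exists_bound
  have h1 : Tendsto (fun r => K * b r * (2 * Real.pi) * (2 * Real.pi) * (2 * Real.pi)) atTop
      (𝓝 0) := by
    simpa using (((hb.const_mul K).mul_const (2 * Real.pi)).mul_const (2 * Real.pi)).mul_const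
      (2 * Real.pi)
  refine squeeze_zero_norm' ?_ h1
  filter_upwards [eventually_ge_atTop 0] with r hr
  refine abs_torusInt_le fun y₁ h₁ y₂ h₂ θ h₃ => ?_
  rw [abs_mul]
  exact mul_le_mul (hK y₁ h₁ y₂ h₂ θ h₃) (hS r hr y₁ y₂ θ) (abs_nonneg _) hK0

theorem MemStar.exists_decay {σ : Side} {T t : ℝ} {f : StarFun} (hf : MemStar σ T f)
    (ht : t ∈ Icc 0 T) {y₃ : ℝ} (hy : y₃ ∈ Icc σ.lo σ.hi) :
    ∃ b : ℝ → ℝ, Tendsto b atTop (𝓝 0) ∧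
      ∀ r, 0 ≤ r → ∀ y₁ y₂ θ, |f t y₁ y₂ y₃ (σ.sgn * r) θ| ≤ b r := by
  obtain ⟨δ, hδ, h⟩ := hf.decay
  obtain ⟨K, hK⟩ := h 0
  refine ⟨_, tendsto_exp_decay K δ hδ σ, fun r hr y₁ y₂ θ => ?_⟩
  have := hK (t, y₁, y₂, y₃, σ.sgn * r, θ) ⟨ht, hy, by simpa [σ.sgn_mul_sgn_mul] using hr⟩
  rwa [norm_iteratedFDerivWithin_zero] at this

theorem MemStar.tendsto_torusInt_mul {σ : Side} {T t : ℝ} {f : StarFun} (hf : MemStar σ T f)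
    (ht : t ∈ Icc 0 T) {y₃ : ℝ} (hy : y₃ ∈ Icc σ.lo σ.hi) {A : ℝ → ℝ → ℝ → ℝ} (hA : Cont3 A) :
    Tendsto (fun r => torusInt fun y₁ y₂ θ => A y₁ y₂ θ * f t y₁ y₂ y₃ (σ.sgn * r) θ)
      atTop (𝓝 0) := by
  obtain ⟨b, hb, h⟩ := hf.exists_decay ht hy
  exact VortexSheet.tendsto_torusInt_mul hA hb h

/-- A function with constant derivative on a half line which tends to zero at infinity vanishes. -/
theorem eq_zero_of_hasDerivAt_const {f : ℝ → ℝ} {c : ℝ} (h : ∀ r, 0 < r → HasDerivAt f c r)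
    (hf : Tendsto f atTop (𝓝 0)) {r : ℝ} (hr : 0 < r) : f r = 0 := by
  have h1 : ∀ x, 0 < x → f x - c * x = f r - c * r := by
    have hd : ∀ x ∈ Ioi (0 : ℝ), HasDerivAt (fun x => f x - c * x) 0 x := fun x hx => by
      simpa using (h x hx).fun_sub ((hasDerivAt_id x).const_mul c)
    intro x hx
    exact isOpen_Ioi.is_const_of_deriv_eq_zero isPreconnected_Ioi
      (fun y hy => (hd y hy).differentiableAt.differentiableWithinAt)
      (fun y hy => (hd y hy).deriv) hx hr
  -- `c` is the increment of `f` over any unit step, and these increments tend to 0.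
  have h2 : c = 0 := by
    have h3 : Tendsto (fun x => f (x + 1) - f x) atTop (𝓝 (0 - 0)) :=
      (hf.comp (tendsto_atTop_add_const_right _ 1 tendsto_id)).sub hf
    have h4 : Tendsto (fun _ : ℝ => c) atTop (𝓝 (0 - 0)) := h3.congr' (by
      filter_upwards [eventually_gt_atTop 0] with x hx
      linarith [h1 x hx, h1 (x + 1) (by linarith)])
    simpa using tendsto_nhds_unique tendsto_const_nhds h4
  have h5 : Tendsto (fun _ : ℝ => f r) atTop (𝓝 0) := hf.congr' (by
    filter_upwards [eventually_gt_atTop 0] with x hx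
    have := h1 x hx
    simpa [h2] using this)
  exact tendsto_nhds_unique tendsto_const_nhds h5

theorem cont3_divSource {χ : ℝ → ℝ} {ξ : Fin 2 → ℝ} {ψ : ℕ → FrontFun} {k : ℕ} {t y₃ : ℝ}
    {D : ℝ → ℝ → ℝ → ℕ → Fin 3 → Fin 3 → ℝ} {E : ℝ → ℝ → ℝ → ℕ → Fin 3 → ℝ}
    (hψ : ∀ ℓ, Cont3 (ψ ℓ t)) (hψ' : ∀ ℓ j, Cont3 ((ψ ℓ).dTan j t)) (hψθ : ∀ ℓ, Cont3 ((ψ ℓ).dθ t))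
    (hK : ∀ ℓ, Cont3 fun y₁ y₂ θ => chiCoeff χ ψ ℓ t y₁ y₂ y₃ θ)
    (hL : ∀ ℓ, Cont3 fun y₁ y₂ θ => chiDotCoeff χ ψ ℓ t y₁ y₂ y₃ θ)
    (hD : ∀ ℓ α β, Cont3 fun y₁ y₂ θ => D y₁ y₂ θ ℓ α β)
    (hE : ∀ ℓ α, Cont3 fun y₁ y₂ θ => E y₁ y₂ θ ℓ α) :
    Cont3 fun y₁ y₂ θ => divSource χ ξ ψ k t y₁ y₂ y₃ θ (D y₁ y₂ θ) (E y₁ y₂ θ) := by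
  unfold Cont3 at *
  simp only [divSource, sum₂, sum₃]
  refine (((((Continuous.neg ?_).add ?_).add ?_).add ?_).add ?_).add ?_
  · exact continuous_finsetSum _ fun α _ => hD _ _ _
  · exact continuous_finsetSum _ fun p _ => (hψθ _).mul (continuous_finsetSum _ fun j _ =>
      continuous_const.mul (hE _ _))
  · exact continuous_finsetSum _ fun p _ => continuous_finsetSum _ fun j _ => (hψ' _ _).mul (hE _ _)
  · exact continuous_finsetSum _ fun p _ => continuous_finsetSum _ fun q _ =>
      ((hK _).mul (hψθ _)).mul (continuous_finsetSum _ fun j _ => continuous_const.mul (hD _ _ _))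
  · exact continuous_finsetSum _ fun p _ => continuous_finsetSum _ fun q _ =>
      (hK _).mul (continuous_finsetSum _ fun j _ => (hψ' _ _).mul (hD _ _ _))
  · exact continuous_finsetSum _ fun p _ => continuous_finsetSum _ fun q _ =>
      ((hL _).mul (hψ _)).mul (hD _ _ _)

namespace MemStar

variable {σ : Side} {T t : ℝ} {f : StarFun}

theorem cont3 (hf : MemStar σ T f) (ht : t ∈ Icc 0 T) {y₃ : ℝ} (hy : y₃ ∈ Icc σ.lo σ.hi) {Y : ℝ}
    (hY : 0 ≤ σ.sgn * Y) : Cont3 fun y₁ y₂ θ => f t y₁ y₂ y₃ Y θ :=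
  ContDiffOn.cont3 (hf.contDiffOn_slice ht hY) hy

theorem cont3_dy (hf : MemStar σ T f) (ht : t ∈ Icc 0 T) {y₃ : ℝ} (hy : y₃ ∈ Ioo σ.lo σ.hi) {Y : ℝ}
    (hY : 0 ≤ σ.sgn * Y) (β : Fin 3) : Cont3 fun y₁ y₂ θ => f.dy β t y₁ y₂ y₃ Y θ := by
  have hy' := Ioo_subset_Icc_self hy
  have hs := hf.contDiffOn_slice ht hY
  fin_cases β
  · exact ContDiffOn.cont3 (contDiffOn_dTan (k := 0) σ.lo_lt_hi hs (by simp) 0) hy'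
  · exact ContDiffOn.cont3 (contDiffOn_dTan (k := 0) σ.lo_lt_hi hs (by simp) 1) hy'
  · have h1 : Cont3 ((f.slice t Y).dFirst (Icc σ.lo σ.hi) y₃) :=
      ContDiffOn.cont3 (contDiffOn_dFirst (k := 0) σ.lo_lt_hi hs (by simp)) hy'
    have h2 : (f.slice t Y).dFirst (Icc σ.lo σ.hi) y₃
        = fun y₁ y₂ θ => f.dy 2 t y₁ y₂ y₃ Y θ := by
      funext y₁ y₂ θ
      exact derivWithin_of_mem_nhds (Icc_mem_nhds hy.1 hy.2)
    rw [h2] at h1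
    exact h1

end MemStar

/-- The differentiation lemmas are stated over compact intervals, while Y₃ ranges over a half line;
a small interval around Y₃ suffices for derivatives there. -/
theorem Side.exists_Icc_subset (σ : Side) {Y : ℝ} (hY : 0 < σ.sgn * Y) :
    ∃ a b, a < Y ∧ Y < b ∧ ∀ x ∈ Icc a b, 0 < σ.sgn * x := by
  obtain ⟨ε, hε, h⟩ := (nhds_basis_Icc_pos Y).mem_iff.1 (σ.isOpen_pos.mem_nhds hY)
  exact ⟨Y - ε, Y + ε, by linarith, by linarith, fun x hx => h hx⟩

theorem MemStar.cont3_dY₃ {σ : Side} {T t : ℝ} {f : StarFun} (hf : MemStar σ T f) (ht : t ∈ Icc 0 T)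
    {y₃ : ℝ} (hy : y₃ ∈ Icc σ.lo σ.hi) {Y : ℝ} (hY : 0 < σ.sgn * Y) :
    Cont3 fun y₁ y₂ θ => f.dY₃ t y₁ y₂ y₃ Y θ := by
  obtain ⟨a, b, ha, hb, hab⟩ := σ.exists_Icc_subset hY
  have hs := hf.contDiffOn_fastSlice ht hy (I := Icc a b) fun x hx => (hab x hx).le
  have h1 : Cont3 ((f.fastSlice t y₃).dFirst (Icc a b) Y) :=
    ContDiffOn.cont3 (contDiffOn_dFirst (k := 0) (ha.trans hb) hs (by simp)) ⟨ha.le, hb.le⟩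
  have h2 : (f.fastSlice t y₃).dFirst (Icc a b) Y = fun y₁ y₂ θ => f.dY₃ t y₁ y₂ y₃ Y θ := by
    funext y₁ y₂ θ
    exact derivWithin_of_mem_nhds (Icc_mem_nhds ha hb)
  rw [h2] at h1
  exact h1

namespace IsSmoothFamily

variable {T : ℝ} {m : ℕ} {χ : ℝ → ℝ} {ξ : Fin 2 → ℝ} {ψ : ℕ → FrontFun} {V : VectorProfiles}
  {σ : Side} {t : ℝ}

theorem contDiffOn_starDefect (h : IsSmoothFamily T m χ ξ ψ V σ) (ht : t ∈ Icc 0 T) {N : StarFun}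
    (hN : MemStar σ T N) (n : ℕ) {a b : ℝ → ℝ} (ha : ContDiff ℝ ∞ a) (hb : ContDiff ℝ ∞ b)
    {I : Set ℝ} (haI : ∀ s ∈ I, a s ∈ Icc σ.lo σ.hi) (hbI : ∀ s ∈ I, 0 ≤ σ.sgn * b s) :
    ContDiffOn ℝ ∞ ((starDefect ξ ψ V N n).along t a b).uncurried (slab I) := by
  have h1 : ∀ α, PSContDiffOn ∞ (fun p : ℝ × ℝ × ℝ × ℝ =>
      starSeries V α t p.2.1 p.2.2.1 (a p.1) (b p.1) p.2.2.2) (slab I) := fun α k => by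
    simp only [starSeries, coeff_mk]
    exact (h.star k α).contDiffOn_along ht ha hb haI hbI
  exact (hN.contDiffOn_along ht ha hb haI hbI).sub
    ((psContDiffOn_sum _ fun j _ => (h.psContDiffOn_slope ht j _).mul (h1 j.castSucc)) n)

theorem cont3_coeff_slope (h : IsSmoothFamily T m χ ξ ψ V σ) (ht : t ∈ Icc 0 T) (j : Fin 2)
    (n : ℕ) : Cont3 fun y₁ y₂ θ => coeff n (frontSlope ξ ψ j t y₁ y₂ θ) :=
  -- The slope does not involve y₃, so the slab over the one-point interval [0, 0] is enough.
  ContDiffOn.cont3 (f := fun _ y₁ y₂ θ => coeff n (frontSlope ξ ψ j t y₁ y₂ θ)) (a := 0) (b := 0)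
    (h.psContDiffOn_slope ht j _ n) (left_mem_Icc.2 le_rfl)

theorem cont3_slope_mul (h : IsSmoothFamily T m χ ξ ψ V σ) (ht : t ∈ Icc 0 T) (n : ℕ)
    {S : Fin 2 → ℕ → ℝ → ℝ → ℝ → ℝ} (hS : ∀ j ℓ, Cont3 (S j ℓ)) :
    Cont3 fun y₁ y₂ θ => coeff n (∑ j : Fin 2, frontSlope ξ ψ j t y₁ y₂ θ
      * PowerSeries.mk fun ℓ => S j ℓ y₁ y₂ θ) := by
  simp only [map_sum, coeff_mul, coeff_mk]
  exact cont3_sum _ fun j _ => cont3_sum _ fun p _ => (h.cont3_coeff_slope ht j _).mul (hS _ _)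

theorem cont3_chiCoeff (h : IsSmoothFamily T m χ ξ ψ V σ) (ht : t ∈ Icc 0 T) (y₃ : ℝ) (ℓ : ℕ) :
    Cont3 fun y₁ y₂ θ => chiCoeff χ ψ ℓ t y₁ y₂ y₃ θ :=
  ContDiffOn.cont3 (f := fun s y₁ y₂ θ => chiCoeff χ ψ ℓ t y₁ y₂ s θ) (a := y₃) (b := y₃)
    (h.psContDiffOn_chi ht _ ℓ) (left_mem_Icc.2 le_rfl)

theorem cont3_chiDotCoeff (h : IsSmoothFamily T m χ ξ ψ V σ) (ht : t ∈ Icc 0 T) (y₃ : ℝ) (ℓ : ℕ) :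
    Cont3 fun y₁ y₂ θ => chiDotCoeff χ ψ ℓ t y₁ y₂ y₃ θ :=
  ContDiffOn.cont3 (f := fun s y₁ y₂ θ => chiDotCoeff χ ψ ℓ t y₁ y₂ s θ) (a := y₃) (b := y₃)
    (((h.psContDiffOn_front ht _).shift h.cutoff.smooth contDiffOn_fst).formalComp
      (contDiff_deriv_of_smooth h.cutoff.smooth) contDiffOn_fst ℓ) (left_mem_Icc.2 le_rfl)

theorem cont3_res_dy (h : IsSmoothFamily T m χ ξ ψ V σ) (ht : t ∈ Icc 0 T) {y₃ : ℝ}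
    (hy : y₃ ∈ Ioo σ.lo σ.hi) (ℓ : ℕ) (α β : Fin 3) :
    Cont3 fun y₁ y₂ θ => (V.res ℓ α).toStar.dy β t y₁ y₂ y₃ 0 θ := by
  have hy' := Ioo_subset_Icc_self hy
  have hs := (h.res ℓ α).contDiffOn_slice ht
  fin_cases β
  · exact ContDiffOn.cont3 (contDiffOn_dTan (k := 0) σ.lo_lt_hi hs (by simp) 0) hy'
  · exact ContDiffOn.cont3 (contDiffOn_dTan (k := 0) σ.lo_lt_hi hs (by simp) 1) hy'
  · have h1 : Cont3 (((V.res ℓ α).slice t).dFirst (Icc σ.lo σ.hi) y₃) :=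
      ContDiffOn.cont3 (contDiffOn_dFirst (k := 0) σ.lo_lt_hi hs (by simp)) hy'
    have h2 : ((V.res ℓ α).slice t).dFirst (Icc σ.lo σ.hi) y₃
        = fun y₁ y₂ θ => (V.res ℓ α).toStar.dy 2 t y₁ y₂ y₃ 0 θ := by
      funext y₁ y₂ θ
      exact derivWithin_of_mem_nhds (Icc_mem_nhds hy.1 hy.2)
    rw [h2] at h1
    exact h1

theorem cont3_divSource (h : IsSmoothFamily T m χ ξ ψ V σ) (ht : t ∈ Icc 0 T) (y₃ : ℝ) (k : ℕ)
    {D : ℝ → ℝ → ℝ → ℕ → Fin 3 → Fin 3 → ℝ} {E : ℝ → ℝ → ℝ → ℕ → Fin 3 → ℝ}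
    (hD : ∀ ℓ α β, Cont3 fun y₁ y₂ θ => D y₁ y₂ θ ℓ α β)
    (hE : ∀ ℓ α, Cont3 fun y₁ y₂ θ => E y₁ y₂ θ ℓ α) :
    Cont3 fun y₁ y₂ θ => divSource χ ξ ψ k t y₁ y₂ y₃ θ (D y₁ y₂ θ) (E y₁ y₂ θ) :=
  VortexSheet.cont3_divSource (fun ℓ => ContDiffOn.cont3 (h.front ℓ).contDiffOn ht)
    (fun ℓ j => ContDiffOn.cont3 ((h.front ℓ).contDiffOn_dTan h.T_pos j) ht)
    (fun ℓ => ContDiffOn.cont3 ((h.front ℓ).contDiffOn_dθ h.T_pos) ht)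
    (h.cont3_chiCoeff ht y₃) (h.cont3_chiDotCoeff ht y₃) hD hE

theorem dY₃_starDefect (h : IsSmoothFamily T m χ ξ ψ V σ) (ht : t ∈ Icc 0 T) {N : StarFun}
    (hN : MemStar σ T N) (n : ℕ) (y₁ y₂ : ℝ) {y₃ : ℝ} (hy : y₃ ∈ Icc σ.lo σ.hi) {Y : ℝ}
    (hY : 0 < σ.sgn * Y) (θ : ℝ) :
    (starDefect ξ ψ V N n).dY₃ t y₁ y₂ y₃ Y θ = N.dY₃ t y₁ y₂ y₃ Y θ
      - coeff n (∑ j : Fin 2, frontSlope ξ ψ j t y₁ y₂ θ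
        * PowerSeries.mk fun ℓ => (V.star ℓ j.castSucc).dY₃ t y₁ y₂ y₃ Y θ) := by
  have h1 : ∀ α, PSHasDerivAt (fun r => starSeries V α t y₁ y₂ y₃ r θ)
      (PowerSeries.mk fun ℓ => (V.star ℓ α).dY₃ t y₁ y₂ y₃ Y θ) Y := fun α k => by
    simp only [starSeries, coeff_mk]
    exact ((h.star k α).hasDerivAt_dY₃ ht y₁ y₂ hy hY θ).differentiableAt.hasDerivAt
  exact ((hN.hasDerivAt_dY₃ ht y₁ y₂ hy hY θ).differentiableAt.hasDerivAt.fun_sub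
    ((psHasDerivAt_sum Finset.univ fun j _ => (h1 (Fin.castSucc j)).const_mul
      (frontSlope ξ ψ j t y₁ y₂ θ)) n)).deriv

theorem dy_starDefect (h : IsSmoothFamily T m χ ξ ψ V σ) (ht : t ∈ Icc 0 T) {N : StarFun}
    (hN : MemStar σ T N) (n : ℕ) (y₁ y₂ : ℝ) {y₃ : ℝ} (hy : y₃ ∈ Ioo σ.lo σ.hi) {Y : ℝ}
    (hY : 0 ≤ σ.sgn * Y) (θ : ℝ) :
    (starDefect ξ ψ V N n).dy 2 t y₁ y₂ y₃ Y θ = N.dy 2 t y₁ y₂ y₃ Y θ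
      - coeff n (∑ j : Fin 2, frontSlope ξ ψ j t y₁ y₂ θ
        * PowerSeries.mk fun ℓ => (V.star ℓ j.castSucc).dy 2 t y₁ y₂ y₃ Y θ) := by
  have h1 : ∀ α, PSHasDerivAt (fun r => starSeries V α t y₁ y₂ r Y θ)
      (PowerSeries.mk fun ℓ => (V.star ℓ α).dy 2 t y₁ y₂ y₃ Y θ) y₃ := fun α k => by
    simp only [starSeries, coeff_mk]
    exact ((h.star k α).hasDerivAt_dy ht y₁ y₂ hy hY θ).differentiableAt.hasDerivAt
  exact ((hN.hasDerivAt_dy ht y₁ y₂ hy hY θ).differentiableAt.hasDerivAt.fun_sub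
    ((psHasDerivAt_sum Finset.univ fun j _ => (h1 (Fin.castSucc j)).const_mul
      (frontSlope ξ ψ j t y₁ y₂ θ)) n)).deriv

/-- Each term of the flux is a coefficient of the slope, independent of Y₃ and bounded on the torus,
times a profile that decays uniformly. -/
theorem tendsto_starDefect (h : IsSmoothFamily T m χ ξ ψ V σ) (ht : t ∈ Icc 0 T) {N : StarFun}
    (hN : MemStar σ T N) (n : ℕ) {y₃ : ℝ} (hy : y₃ ∈ Icc σ.lo σ.hi) :
    Tendsto (fun r => torusInt fun y₁ y₂ θ => starDefect ξ ψ V N n t y₁ y₂ y₃ (σ.sgn * r) θ)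
      atTop (𝓝 0) := by
  have h1 : ∀ r, 0 ≤ r → torusInt (fun y₁ y₂ θ => starDefect ξ ψ V N n t y₁ y₂ y₃ (σ.sgn * r) θ)
      = torusInt (fun y₁ y₂ θ => 1 * N t y₁ y₂ y₃ (σ.sgn * r) θ)
        - ∑ j : Fin 2, ∑ p ∈ Finset.HasAntidiagonal.antidiagonal n, torusInt fun y₁ y₂ θ =>
          coeff p.1 (frontSlope ξ ψ j t y₁ y₂ θ)
            * V.star p.2 j.castSucc t y₁ y₂ y₃ (σ.sgn * r) θ := by
    intro r hr
    have hY : 0 ≤ σ.sgn * (σ.sgn * r) := by rwa [σ.sgn_mul_sgn_mul]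
    have h2 : ∀ (j : Fin 2) (p : ℕ × ℕ), Cont3 fun y₁ y₂ θ =>
        coeff p.1 (frontSlope ξ ψ j t y₁ y₂ θ)
          * V.star p.2 j.castSucc t y₁ y₂ y₃ (σ.sgn * r) θ := fun j p =>
      (h.cont3_coeff_slope ht j _).mul ((h.star _ _).cont3 ht hy hY)
    simp only [starDefect, starFlux, starSeries, map_sum, coeff_mul, coeff_mk, one_mul]
    rw [torusInt_sub (hN.cont3 ht hy hY) (cont3_sum _ fun j _ => cont3_sum _ fun p _ => h2 j p),
      torusInt_sum _ fun j _ => cont3_sum _ fun p _ => h2 j p]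
    congr 1
    exact Finset.sum_congr rfl fun j _ => torusInt_sum _ fun p _ => h2 j p
  have h3 := (hN.tendsto_torusInt_mul ht hy (cont3_const 1)).sub
    (tendsto_finsetSum Finset.univ fun (j : Fin 2) _ => tendsto_finsetSum
      (Finset.HasAntidiagonal.antidiagonal n) fun p _ =>
        (h.star p.2 j.castSucc).tendsto_torusInt_mul ht hy (h.cont3_coeff_slope (ξ := ξ) ht j p.1))
  simp only [Finset.sum_const_zero, sub_zero] at h3
  refine h3.congr' ?_
  filter_upwards [eventually_ge_atTop 0] with r hr using (h1 r hr).symm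

end IsSmoothFamily

/-! ### The mean normal flux of the surface waves near the front. -/

namespace IsSmoothFamily

variable {T : ℝ} {m : ℕ} {χ : ℝ → ℝ} {ξ : Fin 2 → ℝ} {ψ : ℕ → FrontFun} {V : VectorProfiles}
  {σ : Side} {t : ℝ}

/-- If the mean of the normal flux of order `k` of the surface waves vanishes near the front, so
does its normal derivative. -/
theorem torusInt_dy_starDefect (h : IsSmoothFamily T m χ ξ ψ V σ) (ht : t ∈ Icc 0 T) {N : StarFun}
    (hN : MemStar σ T N) (n : ℕ) {Y : ℝ} (hY : 0 ≤ σ.sgn * Y)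
    (h0 : ∀ y₃ ∈ Ioo σ.lo σ.hi, |y₃| < 1 / 3 →
      torusInt (fun y₁ y₂ θ => starDefect ξ ψ V N n t y₁ y₂ y₃ Y θ) = 0)
    {y₃ : ℝ} (hy : y₃ ∈ Ioo σ.lo σ.hi) (hy' : |y₃| < 1 / 3) :
    torusInt (fun y₁ y₂ θ => (starDefect ξ ψ V N n).dy 2 t y₁ y₂ y₃ Y θ) = 0 := by
  have hs : ContDiffOn ℝ 1 ((starDefect ξ ψ V N n).along t id fun _ => Y).uncurried
      (slab (Icc σ.lo σ.hi)) :=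
    (h.contDiffOn_starDefect ht hN n contDiff_id contDiff_const (fun s hs => hs)
      fun _ _ => hY).of_le (by exact_mod_cast le_top)
  have h1 := (hasDerivWithinAt_torusInt σ.lo_lt_hi hs (Ioo_subset_Icc_self hy)).hasDerivAt
    (Icc_mem_nhds hy.1 hy.2)
  have h2 : (fun r => torusInt (((starDefect ξ ψ V N n).along t id fun _ => Y) r)) =ᶠ[𝓝 y₃]
      fun _ => 0 := by
    filter_upwards [isOpen_Ioo.mem_nhds hy, (isOpen_lt continuous_abs continuous_const).mem_nhds
      hy'] with r hr hr' using h0 r hr hr'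
  have h3 := h1.unique ((hasDerivAt_const y₃ (0 : ℝ)).congr_of_eventuallyEq h2)
  rw [← h3]
  refine torusInt_congr fun y₁ y₂ θ => ?_
  exact (derivWithin_of_mem_nhds (Icc_mem_nhds hy.1 hy.2)).symm

/-- The surface wave part of the source near the front. -/
theorem divSource_star_eq (h : IsSmoothFamily T m χ ξ ψ V σ) (ht : t ∈ Icc 0 T) (k : ℕ) (y₁ y₂ : ℝ)
    {y₃ : ℝ} (hy : y₃ ∈ Ioo σ.lo σ.hi) (hy' : |y₃| < 1 / 3) {Y : ℝ} (hY : 0 ≤ σ.sgn * Y) (θ : ℝ) :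
    divSource χ ξ ψ k t y₁ y₂ y₃ θ (fun ℓ α β => (V.star ℓ α).dy β t y₁ y₂ y₃ Y θ)
        (fun ℓ α => (V.star ℓ α).dY₃ t y₁ y₂ y₃ Y θ)
      = coeff (k + 2) (∑ j : Fin 2, frontSlope ξ ψ j t y₁ y₂ θ
          * PowerSeries.mk fun ℓ => (V.star ℓ j.castSucc).dY₃ t y₁ y₂ y₃ Y θ)
        - ((starDefect ξ ψ V (V.star k 2) (k + 1)).dy 2 t y₁ y₂ y₃ Y θ
          + ((V.star k 0).dy 0 t y₁ y₂ y₃ Y θ + (V.star k 1).dy 1 t y₁ y₂ y₃ Y θ)) := by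
  rw [divSource_eq_coeff, chiSeries_eq_one h.cutoff ψ t y₁ y₂ θ hy',
    chiDotSeries_eq_zero h.cutoff ψ t y₁ y₂ θ hy',
    h.dy_starDefect ht (h.star k 2) (k + 1) y₁ y₂ hy hY θ, Fin.sum_univ_three (f := fun α =>
      (V.star k α).dy α t y₁ y₂ y₃ Y θ)]
  simp only [one_mul, zero_mul, mul_zero, add_zero]
  ring

/-- The recurrence for the mean normal flux of the surface waves near the front. -/
theorem torusInt_starDefect_succ (h : IsSmoothFamily T m χ ξ ψ V σ) (ht : t ∈ Icc 0 T) (k : ℕ)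
    {N : StarFun} (hN : MemStar σ T N)
    (hdiv : ∀ y₃ ∈ Ioo σ.lo σ.hi, ∀ Y, 0 < σ.sgn * Y →
      torusInt (fun y₁ y₂ θ => N.dY₃ t y₁ y₂ y₃ Y θ)
        = torusInt fun y₁ y₂ θ => fastDivSource χ ξ ψ V k t y₁ y₂ y₃ Y θ)
    (ih : ∀ y₃ ∈ Ioo σ.lo σ.hi, |y₃| < 1 / 3 → ∀ Y, 0 < σ.sgn * Y →
      torusInt (fun y₁ y₂ θ => starDefect ξ ψ V (V.star k 2) (k + 1) t y₁ y₂ y₃ Y θ) = 0)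
    {y₃ : ℝ} (hy : y₃ ∈ Ioo σ.lo σ.hi) (hy' : |y₃| < 1 / 3) {Y : ℝ} (hY : 0 < σ.sgn * Y) :
    torusInt (fun y₁ y₂ θ => starDefect ξ ψ V N (k + 2) t y₁ y₂ y₃ Y θ) = 0 := by
  have hyc := Ioo_subset_Icc_self hy
  -- The mean of the residual source may depend on y₃ but not on Y₃. It need not be known to vanish:
  -- no residual constraint is available for k = m, and the decay argument settles all orders alike.
  set c : ℝ := torusInt fun y₁ y₂ θ => divSource χ ξ ψ k t y₁ y₂ y₃ θ
    (fun ℓ α β => (V.res ℓ α).toStar.dy β t y₁ y₂ y₃ 0 θ) (fun _ _ => 0) with hc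
  have hval : ∀ Y, 0 < σ.sgn * Y →
      torusInt (fun y₁ y₂ θ => (starDefect ξ ψ V N (k + 2)).dY₃ t y₁ y₂ y₃ Y θ) = c := by
    intro Y hY
    have hG : Cont3 fun y₁ y₂ θ => coeff (k + 2) (∑ j : Fin 2, frontSlope ξ ψ j t y₁ y₂ θ
        * PowerSeries.mk fun ℓ => (V.star ℓ j.castSucc).dY₃ t y₁ y₂ y₃ Y θ) :=
      h.cont3_slope_mul ht _ fun j ℓ => (h.star ℓ j.castSucc).cont3_dY₃ ht hyc hY
    have hres := h.cont3_divSource (χ := χ) (ξ := ξ) ht y₃ k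
      (fun ℓ α β => h.cont3_res_dy ht hy ℓ α β) (E := fun _ _ _ _ _ => 0) fun _ _ => cont3_const 0
    have hstar := h.cont3_divSource (χ := χ) (ξ := ξ) ht y₃ k
      (fun ℓ α β => (h.star ℓ α).cont3_dy ht hy hY.le β)
      fun ℓ α => (h.star ℓ α).cont3_dY₃ ht hyc hY
    have hd0 := (h.star k 0).cont3_dy ht hy hY.le 0
    have hd1 := (h.star k 1).cont3_dy ht hy hY.le 1
    have hd2 : Cont3 fun y₁ y₂ θ =>
        (starDefect ξ ψ V (V.star k 2) (k + 1)).dy 2 t y₁ y₂ y₃ Y θ := by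
      simp only [h.dy_starDefect ht (h.star k 2) (k + 1) _ _ hy hY.le]
      exact ((h.star k 2).cont3_dy ht hy hY.le 2).sub
        (h.cont3_slope_mul ht _ fun j ℓ => (h.star ℓ j.castSucc).cont3_dy ht hy hY.le 2)
    have hz0 : torusInt (fun y₁ y₂ θ => (V.star k 0).dy 0 t y₁ y₂ y₃ Y θ) = 0 :=
      torusInt_dTan_eq_zero σ.lo_lt_hi (((h.star k 0).contDiffOn_slice ht hY.le).of_le
        (by exact_mod_cast le_top)) hyc ((h.star k 0).periodic ht hyc hY.le) 0
    have hz1 : torusInt (fun y₁ y₂ θ => (V.star k 1).dy 1 t y₁ y₂ y₃ Y θ) = 0 :=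
      torusInt_dTan_eq_zero σ.lo_lt_hi (((h.star k 1).contDiffOn_slice ht hY.le).of_le
        (by exact_mod_cast le_top)) hyc ((h.star k 1).periodic ht hyc hY.le) 1
    have hz2 := h.torusInt_dy_starDefect ht (h.star k 2) (k + 1) hY.le
      (fun y hy hy' => ih y hy hy' Y hY) hy hy'
    -- The terms in ∂_{Y₃}V_⋆ cancel, the tangential derivatives have zero mean, and the ∂_{y₃}
    -- terms form the normal derivative of the previous defect, whose mean vanishes by `ih`.
    rw [torusInt_congr fun y₁ y₂ θ => h.dY₃_starDefect ht hN (k + 2) y₁ y₂ hyc hY θ,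
      torusInt_sub (hN.cont3_dY₃ ht hyc hY) hG, hdiv y₃ hy Y hY,
      torusInt_congr fun y₁ y₂ θ => h.fastDivSource_split ht y₁ y₂ hy hY.le θ k,
      torusInt_add hres hstar,
      torusInt_congr fun y₁ y₂ θ => h.divSource_star_eq ht k y₁ y₂ hy hy' hY.le θ,
      torusInt_sub hG (hd2.add (hd0.add hd1)), torusInt_add hd2 (hd0.add hd1),
      torusInt_add hd0 hd1, hz0, hz1, hz2]
    ring
  have hderiv : ∀ Y, 0 < σ.sgn * Y → HasDerivAt
      (fun Y => torusInt fun y₁ y₂ θ => starDefect ξ ψ V N (k + 2) t y₁ y₂ y₃ Y θ) c Y := by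
    intro Y hY
    obtain ⟨a, b, ha, hb, hab⟩ := σ.exists_Icc_subset hY
    have hs : ContDiffOn ℝ 1 ((starDefect ξ ψ V N (k + 2)).along t (fun _ => y₃) id).uncurried
        (slab (Icc a b)) :=
      (h.contDiffOn_starDefect ht hN (k + 2) contDiff_const contDiff_id (fun _ _ => hyc)
        fun s hs => (hab s hs).le).of_le (by exact_mod_cast le_top)
    have h1 := (hasDerivWithinAt_torusInt (ha.trans hb) hs ⟨ha.le, hb.le⟩).hasDerivAt
      (Icc_mem_nhds ha hb)
    rw [← hval Y hY]
    refine h1.congr_deriv (torusInt_congr fun y₁ y₂ θ => ?_)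
    exact derivWithin_of_mem_nhds (Icc_mem_nhds ha hb)
  -- The variable r = σY₃ turns both half lines into r > 0, at the price of the factor `σ.sgn` in
  -- the derivative.
  have hfin := eq_zero_of_hasDerivAt_const (f := fun r => torusInt fun y₁ y₂ θ =>
    starDefect ξ ψ V N (k + 2) t y₁ y₂ y₃ (σ.sgn * r) θ) (c := c * σ.sgn)
    (fun r hr => by
      have h1 := hderiv (σ.sgn * r) (by rwa [σ.sgn_mul_sgn_mul])
      have h2 : HasDerivAt (fun r => σ.sgn * r) σ.sgn r := by
        simpa using (hasDerivAt_id r).const_mul σ.sgn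
      exact h1.comp r h2)
    (h.tendsto_starDefect ht hN (k + 2) hyc) hY
  simpa only [σ.sgn_mul_sgn_mul] using hfin

/-- The terms ξ_j ∂_θ V_j of the constraint have zero mean by periodicity, and the residual part of
V₃ does not depend on Y₃. -/
theorem torusInt_dY₃_star (h : IsSmoothFamily T m χ ξ ψ V σ) (ht : t ∈ Icc 0 T) {k : ℕ} (hk : k < m)
    {y₃ : ℝ} (hy : y₃ ∈ Ioo σ.lo σ.hi) {Y : ℝ} (hY : 0 < σ.sgn * Y) :
    torusInt (fun y₁ y₂ θ => (V.star (k + 1) 2).dY₃ t y₁ y₂ y₃ Y θ)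
      = torusInt fun y₁ y₂ θ => fastDivSource χ ξ ψ V k t y₁ y₂ y₃ Y θ := by
  have hyc := Ioo_subset_Icc_self hy
  have hs : ∀ α, ContDiffOn ℝ 1 ((V.full (k + 1) α).slice t Y).uncurried
      (slab (Icc σ.lo σ.hi)) := fun α =>
    (((h.res (k + 1) α).contDiffOn_slice ht).add
      ((h.star (k + 1) α).contDiffOn_slice ht hY.le)).of_le (by exact_mod_cast le_top)
  have hp : ∀ α, Periodic3 ((V.full (k + 1) α).slice t Y y₃) := fun α => by
    have h1 := (h.res (k + 1) α).periodic ht hyc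
    have h2 := (h.star (k + 1) α).periodic ht hyc hY.le
    constructor <;> intro y₁ y₂ θ
    · exact congrArg₂ (· + ·) (h1.y₁ y₁ y₂ θ) (h2.y₁ y₁ y₂ θ)
    · exact congrArg₂ (· + ·) (h1.y₂ y₁ y₂ θ) (h2.y₂ y₁ y₂ θ)
    · exact congrArg₂ (· + ·) (h1.θ y₁ y₂ θ) (h2.θ y₁ y₂ θ)
  have hcθ : ∀ α, Cont3 fun y₁ y₂ θ => (V.full (k + 1) α).dθ t y₁ y₂ y₃ Y θ := fun α =>
    ContDiffOn.cont3 (contDiffOn_dθ (k := 0) σ.lo_lt_hi (hs α) (by simp)) hyc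
  have hzθ : ∀ α, torusInt (fun y₁ y₂ θ => (V.full (k + 1) α).dθ t y₁ y₂ y₃ Y θ) = 0 := fun α =>
    torusInt_dθ_eq_zero σ.lo_lt_hi (hs α) hyc (hp α)
  have hcj : ∀ j : Fin 2, Cont3 fun y₁ y₂ θ =>
      ξ j * (V.full (k + 1) j.castSucc).dθ t y₁ y₂ y₃ Y θ := fun j => (cont3_const _).mul (hcθ _)
  rw [← torusInt_congr fun y₁ y₂ θ => h.div k hk t ht y₁ y₂ y₃ hy Y hY θ]
  simp only [dY₃_full]
  rw [torusInt_add ((h.star _ _).cont3_dY₃ ht hyc hY) (cont3_sum _ fun j _ => hcj j),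
    torusInt_sum _ fun j _ => hcj j]
  simp only [torusInt_const_mul, hzθ, mul_zero, Finset.sum_const_zero, add_zero]

/-- Induction on the order. At order 0 there is no surface wave and the flux of order 1 vanishes
because the slopes start at order 2; each further order uses one constraint. -/
theorem torusInt_starDefect (h : IsSmoothFamily T m χ ξ ψ V σ) (ht : t ∈ Icc 0 T) {k : ℕ}
    (hk : k ≤ m) {y₃ : ℝ} (hy : y₃ ∈ Ioo σ.lo σ.hi) (hy' : |y₃| < 1 / 3) {Y : ℝ}
    (hY : 0 < σ.sgn * Y) :
    torusInt (fun y₁ y₂ θ => starDefect ξ ψ V (V.star k 2) (k + 1) t y₁ y₂ y₃ Y θ) = 0 := by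
  induction k generalizing y₃ Y with
  | zero =>
    rw [← torusInt_zero]
    refine torusInt_congr fun y₁ y₂ θ => ?_
    have h1 : starFlux ξ ψ V (0 + 1) t y₁ y₂ y₃ Y θ = 0 :=
      X_pow_dvd_iff.1 (Finset.dvd_sum fun j _ => Dvd.dvd.mul_right (h.X_sq_dvd_slope j t y₁ y₂ θ) _)
        _ (by norm_num)
    simp [starDefect, h1, h.star_zero]
  | succ k ih =>
    exact h.torusInt_starDefect_succ ht k (h.star (k + 1) 2)
      (fun y hy Y hY => h.torusInt_dY₃_star ht hk hy hY)
      (fun y hy hy' Y hY => ih (by omega) hy hy' hY) hy hy' hY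

/-- The mean of the normal fast corrector at the front. -/
theorem torusInt_normalFastMean (h : IsSmoothFamily T m χ ξ ψ V σ) (ht : t ∈ Icc 0 T)
    {w : ℝ → ℝ → ℝ → ℝ → ℝ → ℝ} (hw : IsNormalFastMean χ ξ ψ V σ T m w) :
    torusInt (fun y₁ y₂ _ => w t y₁ y₂ 0 0)
      = torusInt fun y₁ y₂ θ => starFlux ξ ψ V (m + 2) t y₁ y₂ 0 0 θ := by
  set N : StarFun := fun t y₁ y₂ y₃ Y _ => w t y₁ y₂ y₃ Y with hNdef
  have hN : MemStar σ T N := hw.mem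
  have hdiv : ∀ y₃ ∈ Ioo σ.lo σ.hi, ∀ Y, 0 < σ.sgn * Y →
      torusInt (fun y₁ y₂ θ => N.dY₃ t y₁ y₂ y₃ Y θ)
        = torusInt fun y₁ y₂ θ => fastDivSource χ ξ ψ V m t y₁ y₂ y₃ Y θ := by
    intro y₃ hy Y hY
    have h1 : ∀ y₁ y₂ θ, N.dY₃ t y₁ y₂ y₃ Y θ
        = mean fun θ => fastDivSource χ ξ ψ V m t y₁ y₂ y₃ Y θ :=
      fun y₁ y₂ _ => hw.eqn t ht y₁ y₂ y₃ hy Y hY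
    have hpi : (2 * Real.pi) ≠ 0 := Real.two_pi_pos.ne'
    rw [torusInt_congr h1]
    simp only [torusInt, mean, intervalIntegral.integral_const, sub_zero, smul_eq_mul,
      mul_inv_cancel_left₀ hpi]
  -- The identity is known only for y₃ and Y₃ off the interface, so the corner is approached along
  -- the diagonal y₃ = Y₃ = σr. The bound 1/4 keeps y₃ in I^± and below 1/3 in modulus.
  have hmain : ∀ r ∈ Ioo (0 : ℝ) (1 / 4), torusInt (fun y₁ y₂ θ =>
      starDefect ξ ψ V N (m + 2) t y₁ y₂ (σ.sgn * r) (σ.sgn * r) θ) = 0 := by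
    intro r hr
    have hy : σ.sgn * r ∈ Ioo σ.lo σ.hi := by
      cases σ <;> simp only [Side.sgn, Side.lo, Side.hi, mem_Ioo] <;>
        constructor <;> linarith [hr.1, hr.2]
    have hy' : |σ.sgn * r| < 1 / 3 := by
      rw [abs_lt]
      cases σ <;> simp only [Side.sgn] <;> constructor <;> linarith [hr.1, hr.2]
    exact h.torusInt_starDefect_succ ht m hN hdiv
      (fun y hy hy' Y hY => h.torusInt_starDefect ht le_rfl hy hy' hY) hy hy'
      (by rw [σ.sgn_mul_sgn_mul]; exact hr.1)
  have hcd : ContDiff ℝ ∞ fun r : ℝ => σ.sgn * r := contDiff_const.mul contDiff_id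
  have hs := h.contDiffOn_starDefect (ξ := ξ) ht hN (m + 2) hcd hcd (I := Icc 0 (1 / 4))
    (fun r hr => by
      cases σ <;> simp only [Side.sgn, Side.lo, Side.hi, mem_Icc] <;>
        constructor <;> linarith [hr.1, hr.2])
    fun r hr => by rw [σ.sgn_mul_sgn_mul]; exact hr.1
  have h4 : (0 : ℝ) < 1 / 4 := by norm_num
  have hd := (hasDerivWithinAt_torusInt h4 (hs.of_le (by exact_mod_cast le_top))
    (left_mem_Icc.2 h4.le)).continuousWithinAt
  have := left_nhdsWithin_Ioo_neBot h4
  have hz := tendsto_nhds_unique ((hd.mono Ioo_subset_Icc_self).tendsto.congr' (by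
    filter_upwards [self_mem_nhdsWithin] with r hr using hmain r hr))
    (tendsto_const_nhds (x := (0 : ℝ)))
  have h0 : (0 : ℝ) ∈ Icc σ.lo σ.hi := by cases σ <;> simp [Side.lo, Side.hi]
  have h0' : 0 ≤ σ.sgn * 0 := by simp
  have hG : Cont3 fun y₁ y₂ θ => starFlux ξ ψ V (m + 2) t y₁ y₂ 0 0 θ :=
    h.cont3_slope_mul ht _ fun j ℓ => (h.star ℓ j.castSucc).cont3 ht h0 h0'
  rw [← sub_eq_zero, ← torusInt_sub (hN.cont3 ht h0 h0') hG]
  refine Eq.trans (torusInt_congr fun y₁ y₂ θ => ?_) hz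
  simp only [StarFun.along, starDefect, mul_zero, hNdef]

end IsSmoothFamily

/-! ### The jump source and the values of the two fluxes. -/

namespace IsSmoothFamily

variable {T : ℝ} {m : ℕ} {χ : ℝ → ℝ} {ξ : Fin 2 → ℝ} {ψ : ℕ → FrontFun} {V : VectorProfiles}
  {σ : Side} {t : ℝ}

theorem zero_mem (σ : Side) : (0 : ℝ) ∈ Icc σ.lo σ.hi := by
  cases σ <;> simp [Side.lo, Side.hi]

theorem cont3_dθ (h : IsSmoothFamily T m χ ξ ψ V σ) (ht : t ∈ Icc 0 T) (ℓ : ℕ) :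
    Cont3 ((ψ ℓ).dθ t) :=
  ContDiffOn.cont3 ((h.front ℓ).contDiffOn_dθ h.T_pos) ht

theorem torusInt_dθ_front (h : IsSmoothFamily T m χ ξ ψ V σ) (ht : t ∈ Icc 0 T) (ℓ : ℕ) :
    torusInt ((ψ ℓ).dθ t) = 0 :=
  torusInt_dθ_eq_zero h.T_pos (h.contDiffOn_front_one ℓ) ht ((h.front ℓ).periodic ht)

end IsSmoothFamily

theorem sum₂_eq_add_sum₂Pos (n : ℕ) (f : ℕ → ℕ → ℝ) : sum₂ n f = f n 0 + sum₂Pos n f := by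
  classical
  simp only [sum₂, sum₂Pos]
  rw [← Finset.sum_filter_add_sum_filter_not _ (fun p : ℕ × ℕ => 1 ≤ p.2), add_comm]
  congr 1
  have : (Finset.HasAntidiagonal.antidiagonal n).filter (fun p : ℕ × ℕ => ¬ 1 ≤ p.2)
      = {(n, 0)} := by
    ext ⟨a, b⟩
    simp only [Finset.mem_filter, Finset.HasAntidiagonal.mem_antidiagonal, Finset.mem_singleton,
      Prod.mk.injEq]
    omega
  rw [this, Finset.sum_singleton]

namespace IsSmoothFamily

variable {T : ℝ} {m : ℕ} {χ : ℝ → ℝ} {ξ : Fin 2 → ℝ} {ψ : ℕ → FrontFun} {V : VectorProfiles}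
  {σ : Side} {t : ℝ}

theorem full_zero (h : IsSmoothFamily T m χ ξ ψ V σ) (α : Fin 3) (t y₁ y₂ y₃ Y θ : ℝ) :
    V.full 0 α t y₁ y₂ y₃ Y θ = V.base α := by
  simp [VectorProfiles.full, h.res_zero, h.star_zero]

/-- The jump source term as a coefficient of a formal series. -/
theorem jumpSource_eq (h : IsSmoothFamily T m χ ξ ψ V σ) (t y₁ y₂ θ : ℝ) :
    jumpSource ξ ψ V m t y₁ y₂ θ
      = (coeff (m + 2) (∑ j : Fin 2, frontSlope ξ ψ j t y₁ y₂ θ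
          * resSeries V j.castSucc t 0 y₁ y₂ θ) + starFlux ξ ψ V (m + 2) t y₁ y₂ 0 0 θ)
        - (∑ j : Fin 2, ξ j * V.base j.castSucc) * (ψ (m + 2)).dθ t y₁ y₂ θ := by
  have h1 := sum₂_source_eq ξ ψ t y₁ y₂ θ (m + 1) fun ℓ α => V.full ℓ α t y₁ y₂ 0 0 θ
  -- The terms with ℓ₂ = 0 pair the fronts with the constant state: in the sum of order m + 1 they
  -- give the transport term of the jump source, in the sum of order m + 2 the surplus term in ∂_θ
  -- ψ^{m+2}.
  rw [sum₂_eq_add_sum₂Pos, sum₂_eq_add_sum₂Pos (m + 1)] at h1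
  have h2 : ∀ α, (PowerSeries.mk fun ℓ => V.full ℓ α t y₁ y₂ 0 0 θ)
      = resSeries V α t 0 y₁ y₂ θ + starSeries V α t y₁ y₂ 0 0 θ := fun α => by
    ext k; simp [resSeries, starSeries, VectorProfiles.full, ResFun.slice]
  simp only [h2, h.full_zero, mul_add, Finset.sum_add_distrib, map_add] at h1
  rw [starFlux, ← h1, jumpSource]
  simp only [Fin.sum_univ_two]
  ring

theorem cont3_resFlux (h : IsSmoothFamily T m χ ξ ψ V σ) (ht : t ∈ Icc 0 T) (n : ℕ) :
    Cont3 fun y₁ y₂ θ => coeff n (∑ j : Fin 2, frontSlope ξ ψ j t y₁ y₂ θ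
      * resSeries V j.castSucc t 0 y₁ y₂ θ) :=
  h.cont3_slope_mul ht _ fun j ℓ =>
    ContDiffOn.cont3 ((h.res ℓ j.castSucc).contDiffOn_slice ht) (zero_mem σ)

theorem cont3_starFlux (h : IsSmoothFamily T m χ ξ ψ V σ) (ht : t ∈ Icc 0 T) (n : ℕ) :
    Cont3 fun y₁ y₂ θ => starFlux ξ ψ V n t y₁ y₂ 0 0 θ :=
  h.cont3_slope_mul ht _ fun j ℓ =>
    (h.star ℓ j.castSucc).cont3 ht (zero_mem σ) (by simp)

theorem cont3_jumpSource (h : IsSmoothFamily T m χ ξ ψ V σ) (ht : t ∈ Icc 0 T) :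
    Cont3 (jumpSource ξ ψ V m t) := by
  have : jumpSource ξ ψ V m t = _ := funext fun y₁ => funext fun y₂ => funext fun θ =>
    h.jumpSource_eq t y₁ y₂ θ
  rw [this]
  exact ((h.cont3_resFlux ht _).add (h.cont3_starFlux ht _)).sub
    ((cont3_const _).mul (h.cont3_dθ ht (m + 2)))

theorem torusInt_jumpSource (h : IsSmoothFamily T m χ ξ ψ V σ) (ht : t ∈ Icc 0 T) :
    torusInt (jumpSource ξ ψ V m t)
      = torusInt (fun y₁ y₂ θ => coeff (m + 2) (∑ j : Fin 2, frontSlope ξ ψ j t y₁ y₂ θ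
          * resSeries V j.castSucc t 0 y₁ y₂ θ))
        + torusInt fun y₁ y₂ θ => starFlux ξ ψ V (m + 2) t y₁ y₂ 0 0 θ := by
  rw [torusInt_congr (h.jumpSource_eq t), torusInt_sub
    ((h.cont3_resFlux ht _).add (h.cont3_starFlux ht _))
    ((cont3_const _).mul (h.cont3_dθ ht (m + 2))),
    torusInt_add (h.cont3_resFlux ht _) (h.cont3_starFlux ht _), torusInt_const_mul,
    h.torusInt_dθ_front ht]
  ring

/-- The mean over `Γ₀` of a source term of the form `mean g - w`. -/
theorem integralΓ₀_sub_normalFastMean (h : IsSmoothFamily T m χ ξ ψ V σ) (ht : t ∈ Icc 0 T)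
    {w : ℝ → ℝ → ℝ → ℝ → ℝ → ℝ} (hw : IsNormalFastMean χ ξ ψ V σ T m w) {g : ℝ → ℝ → ℝ → ℝ}
    (hg : Cont3 g) :
    integralΓ₀ (fun y₁ y₂ => mean (fun θ => g y₁ y₂ θ) - w t y₁ y₂ 0 0)
      = (2 * Real.pi)⁻¹ * (torusInt g
        - torusInt fun y₁ y₂ θ => starFlux ξ ψ V (m + 2) t y₁ y₂ 0 0 θ) := by
  have hwc : Cont3 fun y₁ y₂ _ => w t y₁ y₂ 0 0 := hw.mem.cont3 ht (zero_mem σ) (by simp)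
  have h1 : ∀ y₁ y₂, mean (fun θ => g y₁ y₂ θ) - w t y₁ y₂ 0 0
      = mean fun θ => g y₁ y₂ θ - w t y₁ y₂ 0 0 := by
    intro y₁ y₂
    have hpi : (2 * Real.pi) ≠ 0 := Real.two_pi_pos.ne'
    rw [mean, mean, intervalIntegral.integral_sub ((hg.inner _ _).intervalIntegrable _ _)
      (continuous_const.intervalIntegrable _ _), intervalIntegral.integral_const, mul_sub,
      sub_zero, smul_eq_mul, inv_mul_cancel_left₀ hpi]
  simp only [h1]
  rw [integralΓ₀_mean, torusInt_sub hg hwc, h.torusInt_normalFastMean ht hw]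

/-- With R and S the mean residual and surface fluxes, the interior gives -σR, the jump source σ(R +
S) and the corrector -σS. In the velocity case the time derivative of the front is added. -/
theorem magneticFlux_eq_zero (h : IsSmoothFamily T m χ ξ ψ V σ) (ht : t ∈ Icc 0 T)
    {w : ℝ → ℝ → ℝ → ℝ → ℝ → ℝ} (hw : IsNormalFastMean χ ξ ψ V σ T m w) :
    magneticFlux σ χ ξ ψ V m w t = 0 := by
  have h1 := h.integralΓ₀_sub_normalFastMean ht hw (h.cont3_jumpSource ht)
  simp only [magneticFlux, slowJump₂]
  rw [h1, h.torusInt_jumpSource ht, h.integral_slowDivSource ht]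
  ring

end IsSmoothFamily

theorem slowMeanRate_eq {T t : ℝ} (hT : 0 < T) (ht : t ∈ Icc 0 T) {f : FrontFun}
    (hf : MemFront T f) : slowMeanRate T f t = (2 * Real.pi)⁻¹ * torusInt (f.dt T t) := by
  have h1 : ContDiffOn ℝ 1 f.uncurried (slab (Icc 0 T)) :=
    hf.contDiffOn.of_le (by exact_mod_cast le_top)
  have h2 : ∀ y₁ y₂, derivWithin (fun s => mean (fun θ => f s y₁ y₂ θ)) (Icc 0 T) t
      = mean fun θ => f.dt T t y₁ y₂ θ := fun y₁ y₂ =>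
    ((hasDerivWithinAt_integral_θ hT h1 ht y₁ y₂).const_mul _).derivWithin
      (uniqueDiffOn_Icc hT t ht)
  simp only [slowMeanRate, h2]
  exact integralΓ₀_mean _

theorem derivWithin_totalMean {T t : ℝ} (hT : 0 < T) (ht : t ∈ Icc 0 T) {f : FrontFun}
    (hf : MemFront T f) : derivWithin (totalMean f) (Icc 0 T) t = torusInt (f.dt T t) :=
  (hasDerivWithinAt_torusInt hT (hf.contDiffOn.of_le (by exact_mod_cast le_top)) ht).derivWithin
    (uniqueDiffOn_Icc hT t ht)

theorem IsSmoothFamily.velocityFlux_eq {T : ℝ} {m : ℕ} {χ : ℝ → ℝ} {ξ : Fin 2 → ℝ}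
    {ψ : ℕ → FrontFun} {V : VectorProfiles} {σ : Side} {t : ℝ}
    (h : IsSmoothFamily T m χ ξ ψ V σ) (ht : t ∈ Icc 0 T)
    {w : ℝ → ℝ → ℝ → ℝ → ℝ → ℝ} (hw : IsNormalFastMean χ ξ ψ V σ T m w) :
    velocityFlux σ T χ ξ ψ V m w t = σ.sgn * slowMeanRate T (ψ (m + 1)) t := by
  have hdt : Cont3 ((ψ (m + 1)).dt T t) :=
    ContDiffOn.cont3 (contDiffOn_dFirst (k := 0) h.T_pos (h.front (m + 1)).contDiffOn (by simp)) ht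
  have h1 := h.integralΓ₀_sub_normalFastMean ht hw (hdt.add (h.cont3_jumpSource ht))
  simp only [velocityFlux, slowJump₁, jumpSourceVelocity]
  rw [h1, torusInt_add hdt (h.cont3_jumpSource ht), h.torusInt_jumpSource ht,
    h.integral_slowDivSource ht, slowMeanRate_eq h.T_pos ht (h.front (m + 1))]
  ring

/-- The Fredholm condition on one side, given the value of the flux. -/
theorem fredholm_iff {σ : Side} {T : ℝ} (hT : 0 < T) {m : ℕ} {χ : ℝ → ℝ} {ξ : Fin 2 → ℝ}
    {ψ : ℕ → FrontFun} {V : VectorProfiles} {w : ℝ → ℝ → ℝ → ℝ → ℝ → ℝ}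
    (hψ : MemFront T (ψ (m + 1)))
    (h : ∀ t ∈ Icc 0 T, velocityFlux σ T χ ξ ψ V m w t
      = σ.sgn * slowMeanRate T (ψ (m + 1)) t) :
    Fredholm σ T χ ξ ψ V m w ↔ TotalMeanAffine T (ψ (m + 1)) := by
  -- The sign of the side times the normalisation of the θ-mean: on [0, T] the flux is this nonzero
  -- constant times the derivative of the total mean.
  set c : ℝ := σ.sgn * (2 * Real.pi)⁻¹ with hc
  have hc0 : c ≠ 0 := mul_ne_zero σ.sgn_ne_zero (inv_ne_zero Real.two_pi_pos.ne')
  have h1 : ∀ t ∈ Icc 0 T, velocityFlux σ T χ ξ ψ V m w t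
      = c * derivWithin (totalMean (ψ (m + 1))) (Icc 0 T) t := fun t ht => by
    rw [h t ht, slowMeanRate_eq hT ht hψ, derivWithin_totalMean hT ht hψ, hc, mul_assoc]
  refine forall₂_congr fun t ht => ⟨fun H => ?_, fun H => ?_⟩
  · have h2 := H.const_mul c⁻¹
    rw [mul_zero] at h2
    refine h2.congr (fun s hs => ?_) ?_
    · rw [h1 s hs, inv_mul_cancel_left₀ hc0]
    · rw [h1 t ht, inv_mul_cancel_left₀ hc0]
  · have h2 := H.const_mul c
    rw [mul_zero] at h2
    exact h2.congr h1 (h1 t ht)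

/-! ### Truncation of the fronts and of the profiles -/

/-- The fronts of orders at most `m + 1`. -/
def truncFront (m : ℕ) (ψ : ℕ → FrontFun) (ℓ : ℕ) : FrontFun :=
  if ℓ ≤ m + 1 then ψ ℓ else 0

/-- The profiles of orders at most `m`. -/
def VectorProfiles.trunc (m : ℕ) (V : VectorProfiles) : VectorProfiles where
  base := V.base
  res ℓ α := if ℓ ≤ m then V.res ℓ α else 0
  star ℓ α := if ℓ ≤ m then V.star ℓ α else 0

theorem truncFront_of_le {m ℓ : ℕ} (h : ℓ ≤ m + 1) (ψ : ℕ → FrontFun) :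
    truncFront m ψ ℓ = ψ ℓ := if_pos h

theorem VectorProfiles.trunc_res_of_le {m ℓ : ℕ} (h : ℓ ≤ m) (V : VectorProfiles) (α : Fin 3) :
    (V.trunc m).res ℓ α = V.res ℓ α := if_pos h

theorem VectorProfiles.trunc_star_of_le {m ℓ : ℕ} (h : ℓ ≤ m) (V : VectorProfiles) (α : Fin 3) :
    (V.trunc m).star ℓ α = V.star ℓ α := if_pos h

theorem VectorProfiles.trunc_full_of_le {m ℓ : ℕ} (h : ℓ ≤ m) (V : VectorProfiles) (α : Fin 3) :
    (V.trunc m).full ℓ α = V.full ℓ α := by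
  unfold VectorProfiles.full
  rw [V.trunc_res_of_le h, V.trunc_star_of_le h]

/-- Causality of the formal solution: its coefficients below order n depend only on those of Ψ below
order n. Hence the coefficients of χ(x₃) and χ'(x₃) up to order m + 1 do not see the truncated
fronts. -/
theorem X_pow_dvd_shift_sub_shift (χ : ℝ → ℝ) (y₃ : ℝ) {Ψ Φ : PowerSeries ℝ} {n : ℕ}
    (h : X ^ n ∣ Ψ - Φ) : X ^ n ∣ shift χ y₃ Ψ - shift χ y₃ Φ := by
  have happ : ∀ k, X ^ n ∣ shiftApprox χ y₃ Ψ k - shiftApprox χ y₃ Φ k := by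
    intro k
    induction k with
    | zero => simp [shiftApprox]
    | succ k ih =>
      have h1 := X_pow_dvd_formalComp_sub χ y₃ ih
      have h2 : shiftApprox χ y₃ Ψ (k + 1) - shiftApprox χ y₃ Φ (k + 1)
          = (formalComp χ y₃ (shiftApprox χ y₃ Ψ k) - formalComp χ y₃ (shiftApprox χ y₃ Φ k)) * Ψ
            + formalComp χ y₃ (shiftApprox χ y₃ Φ k) * (Ψ - Φ) := by
        simp only [shiftApprox]; ring
      rw [h2]
      exact dvd_add (Dvd.dvd.mul_right h1 _) (Dvd.dvd.mul_left h _)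
  rw [X_pow_dvd_iff]
  intro k hk
  have := X_pow_dvd_iff.1 (happ k) k hk
  simpa only [map_sub, coeff_shift] using this

theorem coeff_formalComp_truncFront (g χ : ℝ → ℝ) (ψ : ℕ → FrontFun) {m ℓ : ℕ} (h : ℓ ≤ m + 1)
    (t y₁ y₂ y₃ θ : ℝ) :
    coeff ℓ (formalComp g y₃ (shift χ y₃ (frontSeries (truncFront m ψ) t y₁ y₂ θ)))
      = coeff ℓ (formalComp g y₃ (shift χ y₃ (frontSeries ψ t y₁ y₂ θ))) := by
  have h1 : X ^ (m + 2) ∣ frontSeries (truncFront m ψ) t y₁ y₂ θ - frontSeries ψ t y₁ y₂ θ := by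
    rw [X_pow_dvd_iff]
    intro k hk
    simp only [frontSeries, map_sub, coeff_mk, truncFront_of_le (by omega : k ≤ m + 1), sub_self]
  have h2 := X_pow_dvd_iff.1 (X_pow_dvd_formalComp_sub g y₃ (X_pow_dvd_shift_sub_shift χ y₃ h1)) ℓ
    (by omega)
  rwa [map_sub, sub_eq_zero] at h2

theorem chiCoeff_truncFront (χ : ℝ → ℝ) (ψ : ℕ → FrontFun) {m ℓ : ℕ} (h : ℓ ≤ m + 1) :
    chiCoeff χ (truncFront m ψ) ℓ = chiCoeff χ ψ ℓ := by
  funext t y₁ y₂ y₃ θ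
  exact coeff_formalComp_truncFront χ χ ψ h t y₁ y₂ y₃ θ

theorem chiDotCoeff_truncFront (χ : ℝ → ℝ) (ψ : ℕ → FrontFun) {m ℓ : ℕ} (h : ℓ ≤ m + 1) :
    chiDotCoeff χ (truncFront m ψ) ℓ = chiDotCoeff χ ψ ℓ := by
  funext t y₁ y₂ y₃ θ
  exact coeff_formalComp_truncFront (deriv χ) χ ψ h t y₁ y₂ y₃ θ

/-- A nonzero term has front index i ≥ 2 and profile index j ≥ 1; with i + j ≤ m + 2 this forces j ≤
m and i ≤ m + 1, so no truncated front or profile occurs. The other two congruence lemmas use the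
same count. -/
theorem sum₂_congr_of_le {m n : ℕ} (hn : n ≤ m + 2) {F F' : ℕ → ℕ → ℝ}
    (h0 : ∀ i j, i ≤ 1 → F i j = 0 ∧ F' i j = 0) (h1 : ∀ i, F i 0 = 0 ∧ F' i 0 = 0)
    (h : ∀ i j, i ≤ m + 1 → j ≤ m → F i j = F' i j) : sum₂ n F = sum₂ n F' := by
  refine Finset.sum_congr rfl fun ⟨i, j⟩ hp => ?_
  have hp' : i + j = n := Finset.HasAntidiagonal.mem_antidiagonal.1 hp
  rcases le_or_gt i 1 with hi | hi
  · rw [(h0 i j hi).1, (h0 i j hi).2]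
  · rcases Nat.eq_zero_or_pos j with rfl | hj
    · rw [(h1 i).1, (h1 i).2]
    · exact h i j (by omega) (by omega)

theorem sum₂Pos_congr_of_le {m n : ℕ} (hn : n ≤ m + 2) {F F' : ℕ → ℕ → ℝ}
    (h0 : ∀ i j, i ≤ 1 → F i j = 0 ∧ F' i j = 0)
    (h : ∀ i j, i ≤ m + 1 → j ≤ m → F i j = F' i j) : sum₂Pos n F = sum₂Pos n F' := by
  refine Finset.sum_congr rfl fun ⟨i, j⟩ hp => ?_
  rw [Finset.mem_filter, Finset.HasAntidiagonal.mem_antidiagonal] at hp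
  obtain ⟨hp', hj⟩ : i + j = n ∧ 1 ≤ j := hp
  rcases le_or_gt i 1 with hi | hi
  · rw [(h0 i j hi).1, (h0 i j hi).2]
  · exact h i j (by omega) (by omega)

theorem sum₃_congr_of_le {m n : ℕ} (hn : n ≤ m + 2) {F F' : ℕ → ℕ → ℕ → ℝ}
    (h0 : ∀ i j k, j ≤ 1 → F i j k = 0 ∧ F' i j k = 0) (h1 : ∀ i j, F i j 0 = 0 ∧ F' i j 0 = 0)
    (h : ∀ i j k, i ≤ m + 1 → j ≤ m + 1 → k ≤ m → F i j k = F' i j k) :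
    sum₃ n F = sum₃ n F' := by
  refine Finset.sum_congr rfl fun ⟨i, l⟩ hp => Finset.sum_congr rfl fun ⟨j, k⟩ hq => ?_
  have hp' : i + l = n := Finset.HasAntidiagonal.mem_antidiagonal.1 hp
  have hq' : j + k = l := Finset.HasAntidiagonal.mem_antidiagonal.1 hq
  rcases le_or_gt j 1 with hj | hj
  · rw [(h0 i j k hj).1, (h0 i j k hj).2]
  · rcases Nat.eq_zero_or_pos k with rfl | hk
    · rw [(h1 i j).1, (h1 i j).2]
    · exact h i j k (by omega) (by omega) (by omega)

section Trunc

variable {T : ℝ} {m : ℕ} {χ : ℝ → ℝ} {ξ : Fin 2 → ℝ} {ψ : ℕ → FrontFun} {V : VectorProfiles}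
  {σ : Side}

theorem IsFrontFamily.eq_zero_of_le_one (hψ : IsFrontFamily T m ψ) {ℓ : ℕ} (h : ℓ ≤ 1) :
    ψ ℓ = 0 ∧ truncFront m ψ ℓ = 0 := by
  rw [truncFront_of_le (by omega)]
  interval_cases ℓ
  · exact ⟨hψ.zero, hψ.zero⟩
  · exact ⟨hψ.one, hψ.one⟩

theorem VectorProfiles.IsAdmissible.full_zero (hV : V.IsAdmissible σ T m) (α : Fin 3) :
    V.full 0 α = fun _ _ _ _ _ _ => V.base α := by
  funext t y₁ y₂ y₃ Y θ
  simp [VectorProfiles.full, hV.res_zero, hV.star_zero]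

theorem dy_const (c : ℝ) (β : Fin 3) : StarFun.dy (fun _ _ _ _ _ _ => c) β = 0 := by
  funext t y₁ y₂ y₃ Y θ
  fin_cases β <;> simp [StarFun.dy]

theorem dY₃_const (c : ℝ) : StarFun.dY₃ (fun _ _ _ _ _ _ => c) = 0 := by
  funext t y₁ y₂ y₃ Y θ
  simp [StarFun.dY₃]

theorem divSource_truncFront (hψ : IsFrontFamily T m ψ) {k : ℕ} (hk : k ≤ m) (t y₁ y₂ y₃ θ : ℝ)
    {D D' : ℕ → Fin 3 → Fin 3 → ℝ} {E E' : ℕ → Fin 3 → ℝ} (hD : ∀ ℓ ≤ m, D ℓ = D' ℓ)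
    (hE : ∀ ℓ ≤ m, E ℓ = E' ℓ) (hD0 : D' 0 = 0) (hE0 : E' 0 = 0) :
    divSource χ ξ (truncFront m ψ) k t y₁ y₂ y₃ θ D E = divSource χ ξ ψ k t y₁ y₂ y₃ θ D' E' := by
  have hD0' : D 0 = 0 := (hD 0 (Nat.zero_le _)).trans hD0
  have hE0' : E 0 = 0 := (hE 0 (Nat.zero_le _)).trans hE0
  have hz := fun {ℓ : ℕ} (h : ℓ ≤ 1) => hψ.eq_zero_of_le_one h
  have hd := IsSmoothFamily.dTan_zero_fun
  have hθ := IsSmoothFamily.dθ_zero_fun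
  unfold divSource
  congr 1
  · congr 1
    · congr 1
      · congr 1
        · rw [hD k hk]
          congr 1
          refine sum₂_congr_of_le (by omega : k + 2 ≤ m + 2) (fun i j hi => ?_) (fun i => ?_)
            fun i j hi hj => ?_
          · simp [hz hi, hθ]
          · simp [hE0, hE0']
          · simp only [truncFront_of_le hi, hE j hj]
        · refine sum₂_congr_of_le (by omega : k + 1 ≤ m + 2) (fun i j hi => ?_) (fun i => ?_)
            fun i j hi hj => ?_
          · simp [hz hi, hd]
          · simp [hE0, hE0']
          · simp only [truncFront_of_le hi, hE j hj]
      · refine sum₃_congr_of_le (by omega : k + 1 ≤ m + 2) (fun i j l hj => ?_) (fun i j => ?_)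
            fun i j l hi hj hl => ?_
        · simp [hz hj, hθ]
        · simp [hD0, hD0']
        · simp only [truncFront_of_le hj, hD l hl, chiCoeff_truncFront χ ψ hi]
    · refine sum₃_congr_of_le (by omega : k ≤ m + 2) (fun i j l hj => ?_) (fun i j => ?_)
            fun i j l hi hj hl => ?_
      · simp [hz hj, hd]
      · simp [hD0, hD0']
      · simp only [truncFront_of_le hj, hD l hl, chiCoeff_truncFront χ ψ hi]
  · refine sum₃_congr_of_le (by omega : k ≤ m + 2) (fun i j l hj => ?_) (fun i j => ?_)
            fun i j l hi hj hl => ?_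
    · simp [hz hj]
    · simp [hD0, hD0']
    · simp only [truncFront_of_le hj, hD l hl, chiDotCoeff_truncFront χ ψ hi]

theorem fastDivSource_trunc (hψ : IsFrontFamily T m ψ) (hV : V.IsAdmissible σ T m) {k : ℕ}
    (hk : k ≤ m) :
    fastDivSource χ ξ (truncFront m ψ) (V.trunc m) k = fastDivSource χ ξ ψ V k := by
  funext t y₁ y₂ y₃ Y θ
  rw [fastDivSource_eq, fastDivSource_eq]
  refine divSource_truncFront hψ hk t y₁ y₂ y₃ θ (fun ℓ hℓ => ?_) (fun ℓ hℓ => ?_) ?_ ?_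
  · funext α β; rw [V.trunc_full_of_le hℓ]
  · funext α; rw [V.trunc_full_of_le hℓ]
  · funext α β; rw [hV.full_zero, dy_const]; rfl
  · funext α; rw [hV.full_zero, dY₃_const]; rfl

theorem slowDivSource_trunc (hψ : IsFrontFamily T m ψ) (hV : V.IsAdmissible σ T m) :
    slowDivSource χ ξ (truncFront m ψ) (V.trunc m) m = slowDivSource χ ξ ψ V m := by
  have hz := fun {ℓ : ℕ} (h : ℓ ≤ 1) => hψ.eq_zero_of_le_one h
  have hd := IsSmoothFamily.dTan_zero_fun
  have hθ := IsSmoothFamily.dθ_zero_fun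
  have hr : ∀ α t y₁ y₂ y₃ θ, (V.res 0 α).dy₃ t y₁ y₂ y₃ θ = 0
      ∧ ((V.trunc m).res 0 α).dy₃ t y₁ y₂ y₃ θ = 0 := fun α t y₁ y₂ y₃ θ => by
    rw [V.trunc_res_of_le (Nat.zero_le m), hV.res_zero]
    simp [ResFun.dy₃]
  funext t y₁ y₂ y₃
  unfold slowDivSource
  congr 1
  funext θ
  congr 1
  · congr 1
    · refine sum₃_congr_of_le le_rfl (fun i j l hj => ?_) (fun i j => ?_)
            fun i j l hi hj hl => ?_
      · simp [hz hj, hθ]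
      · simp [hr]
      · simp only [truncFront_of_le hj, V.trunc_res_of_le hl, chiCoeff_truncFront χ ψ hi]
    · refine sum₃_congr_of_le (by omega : m + 1 ≤ m + 2) (fun i j l hj => ?_) (fun i j => ?_)
            fun i j l hi hj hl => ?_
      · simp [hz hj, hd]
      · simp [hr]
      · simp only [truncFront_of_le hj, V.trunc_res_of_le hl, chiCoeff_truncFront χ ψ hi]
  · refine sum₃_congr_of_le (by omega : m + 1 ≤ m + 2) (fun i j l hj => ?_) (fun i j => ?_)
            fun i j l hi hj hl => ?_
    · simp [hz hj]
    · simp [hr]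
    · simp only [truncFront_of_le hj, V.trunc_res_of_le hl, chiDotCoeff_truncFront χ ψ hi]

theorem jumpSource_trunc (hψ : IsFrontFamily T m ψ) :
    jumpSource ξ (truncFront m ψ) (V.trunc m) m = jumpSource ξ ψ V m := by
  have hz := fun {ℓ : ℕ} (h : ℓ ≤ 1) => hψ.eq_zero_of_le_one h
  have hd := IsSmoothFamily.dTan_zero_fun
  have hθ := IsSmoothFamily.dθ_zero_fun
  funext t y₁ y₂ θ
  unfold jumpSource
  congr 1
  · congr 1
    · rw [truncFront_of_le le_rfl]; rfl
    · refine sum₂Pos_congr_of_le le_rfl (fun i j hi => ?_) fun i j hi hj => ?_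
      · simp [hz hi, hθ]
      · simp only [truncFront_of_le hi, V.trunc_full_of_le hj]
  · refine sum₂Pos_congr_of_le (by omega : m + 1 ≤ m + 2) (fun i j hi => ?_) fun i j hi hj => ?_
    · simp [hz hi, hd]
    · simp only [truncFront_of_le hi, V.trunc_full_of_le hj]

theorem velocityFlux_trunc (hψ : IsFrontFamily T m ψ) (hV : V.IsAdmissible σ T m)
    (w : ℝ → ℝ → ℝ → ℝ → ℝ → ℝ) : velocityFlux σ T χ ξ (truncFront m ψ) (V.trunc m) m w
      = velocityFlux σ T χ ξ ψ V m w := by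
  funext t
  simp only [velocityFlux, slowJump₁, jumpSourceVelocity, slowDivSource_trunc hψ hV,
    jumpSource_trunc hψ, truncFront_of_le le_rfl]

theorem magneticFlux_trunc (hψ : IsFrontFamily T m ψ) (hV : V.IsAdmissible σ T m)
    (w : ℝ → ℝ → ℝ → ℝ → ℝ → ℝ) : magneticFlux σ χ ξ (truncFront m ψ) (V.trunc m) m w
      = magneticFlux σ χ ξ ψ V m w := by
  funext t
  simp only [magneticFlux, slowJump₂, slowDivSource_trunc hψ hV, jumpSource_trunc hψ]

theorem memFront_zero (T : ℝ) : MemFront T 0 :=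
  ⟨contDiffOn_const (c := (0 : ℝ)), fun _ _ _ _ _ => rfl, fun _ _ _ _ _ => rfl,
    fun _ _ _ _ _ => rfl⟩

theorem memRes_const (σ : Side) (T c : ℝ) : MemRes σ T fun _ _ _ _ _ => c :=
  ⟨contDiffOn_const, fun _ _ _ _ _ _ _ => rfl, fun _ _ _ _ _ _ _ => rfl,
    fun _ _ _ _ _ _ _ => rfl⟩

theorem memStar_zero (σ : Side) (T : ℝ) : MemStar σ T 0 := by
  have h0 : StarFun.uncurried 0 = fun _ => (0 : ℝ) := rfl
  refine ⟨?_, ⟨1, one_pos, fun n => ⟨0, fun p _ => ?_⟩⟩, fun _ _ _ _ _ _ _ _ _ => rfl,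
    fun _ _ _ _ _ _ _ _ _ => rfl, fun _ _ _ _ _ _ _ _ _ => rfl⟩
  · rw [h0]; exact contDiffOn_const
  · rw [h0, iteratedFDerivWithin_fun_zero]
    simp

/-- The truncated families satisfy all the assumptions, at all orders. -/
theorem isSmoothFamily_trunc (hT : 0 < T) (hχ : IsCutoff χ) (hψ : IsFrontFamily T m ψ)
    (hV : V.IsAdmissible σ T m) (hdiv : FastDivergence χ ξ ψ V σ T m) :
    IsSmoothFamily T m χ ξ (truncFront m ψ) (V.trunc m) σ where
  T_pos := hT
  cutoff := hχ
  front_zero := (hψ.eq_zero_of_le_one (Nat.zero_le 1)).2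
  front_one := (hψ.eq_zero_of_le_one le_rfl).2
  front ℓ := by
    rcases le_or_gt ℓ 1 with h1 | h1
    · rw [(hψ.eq_zero_of_le_one h1).2]; exact memFront_zero T
    · unfold truncFront
      split_ifs with h
      · exact hψ.mem ℓ h1 h
      · exact memFront_zero T
  res_zero α := by rw [V.trunc_res_of_le (Nat.zero_le m)]; exact hV.res_zero α
  star_zero α := by rw [V.trunc_star_of_le (Nat.zero_le m)]; exact hV.star_zero α
  res ℓ α := by
    rcases Nat.eq_zero_or_pos ℓ with rfl | h1
    · rw [V.trunc_res_of_le (Nat.zero_le m), hV.res_zero]; exact memRes_const σ T _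
    · rcases le_or_gt ℓ m with h | h
      · rw [V.trunc_res_of_le h]; exact hV.mem_res ℓ h1 h α
      · have : (V.trunc m).res ℓ α = 0 := if_neg (by omega)
        rw [this]; exact memRes_const σ T 0
  star ℓ α := by
    rcases Nat.eq_zero_or_pos ℓ with rfl | h1
    · rw [V.trunc_star_of_le (Nat.zero_le m), hV.star_zero]; exact memStar_zero σ T
    · rcases le_or_gt ℓ m with h | h
      · rw [V.trunc_star_of_le h]; exact hV.mem_star ℓ h1 h α
      · have : (V.trunc m).star ℓ α = 0 := if_neg (by omega)
        rw [this]; exact memStar_zero σ T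
  res_gt ℓ h α := if_neg (by omega)
  div k hk := by
    rw [fastDivSource_trunc hψ hV hk.le]
    simp only [V.trunc_full_of_le (by omega : k + 1 ≤ m)]
    exact hdiv k hk

theorem isNormalFastMean_trunc (hψ : IsFrontFamily T m ψ) (hV : V.IsAdmissible σ T m)
    {w : ℝ → ℝ → ℝ → ℝ → ℝ → ℝ} (hw : IsNormalFastMean χ ξ ψ V σ T m w) :
    IsNormalFastMean χ ξ (truncFront m ψ) (V.trunc m) σ T m w :=
  ⟨hw.mem, by rw [fastDivSource_trunc hψ hV le_rfl]; exact hw.eqn⟩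

end Trunc

end VortexSheet

end

theorem mainTheorem9 (T : ℝ) (hT : 0 < T) (m : ℕ) (hm : 1 ≤ m)
    (χ : ℝ → ℝ) (hχ : VortexSheet.IsCutoff χ) (ξ : Fin 2 → ℝ)
    (ψ : ℕ → VortexSheet.FrontFun) (hψ : VortexSheet.IsFrontFamily T m ψ)
    (u H : VortexSheet.Side → VortexSheet.VectorProfiles)
    (hu : ∀ σ, (u σ).IsAdmissible σ T m) (hH : ∀ σ, (H σ).IsAdmissible σ T m)
    (hdivu : ∀ σ, VortexSheet.FastDivergence χ ξ ψ (u σ) σ T m)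
    (hdivH : ∀ σ, VortexSheet.FastDivergence χ ξ ψ (H σ) σ T m)
    (wu wH : VortexSheet.Side → ℝ → ℝ → ℝ → ℝ → ℝ → ℝ)
    (hwu : ∀ σ, VortexSheet.IsNormalFastMean χ ξ ψ (u σ) σ T m (wu σ))
    (hwH : ∀ σ, VortexSheet.IsNormalFastMean χ ξ ψ (H σ) σ T m (wH σ)) :
    (∀ σ, ∀ t ∈ Set.Icc 0 T,
      VortexSheet.velocityFlux σ T χ ξ ψ (u σ) m (wu σ) t
        = σ.sgn * VortexSheet.slowMeanRate T (ψ (m + 1)) t) ∧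
    (∀ σ, ∀ t ∈ Set.Icc 0 T, VortexSheet.magneticFlux σ χ ξ ψ (H σ) m (wH σ) t = 0) ∧
    ((∀ σ, VortexSheet.Fredholm σ T χ ξ ψ (u σ) m (wu σ)) ↔
      VortexSheet.TotalMeanAffine T (ψ (m + 1))) ∧
    (∀ σ, VortexSheet.Fredholm σ T χ ξ ψ (u σ) m (wu σ) ↔
      VortexSheet.TotalMeanAffine T (ψ (m + 1))) := by
  have hvel : ∀ σ, ∀ t ∈ Set.Icc 0 T, VortexSheet.velocityFlux σ T χ ξ ψ (u σ) m (wu σ) t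
      = σ.sgn * VortexSheet.slowMeanRate T (ψ (m + 1)) t := fun σ t ht => by
    -- The evaluation holds for the truncated family, and truncation changes neither the flux nor
    -- the front of order m + 1.
    have h := (VortexSheet.isSmoothFamily_trunc hT hχ hψ (hu σ) (hdivu σ)).velocityFlux_eq ht
      (VortexSheet.isNormalFastMean_trunc hψ (hu σ) (hwu σ))
    rwa [VortexSheet.velocityFlux_trunc hψ (hu σ), VortexSheet.truncFront_of_le le_rfl] at h
  have hfred : ∀ σ, VortexSheet.Fredholm σ T χ ξ ψ (u σ) m (wu σ) ↔
      VortexSheet.TotalMeanAffine T (ψ (m + 1)) := fun σ =>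
    VortexSheet.fredholm_iff hT (hψ.mem (m + 1) (by omega) le_rfl) (hvel σ)
  refine ⟨hvel, fun σ t ht => ?_, ?_, hfred⟩
  · have h := (VortexSheet.isSmoothFamily_trunc hT hχ hψ (hH σ) (hdivH σ)).magneticFlux_eq_zero ht
      (VortexSheet.isNormalFastMean_trunc hψ (hH σ) (hwH σ))
    rwa [VortexSheet.magneticFlux_trunc hψ (hH σ)] at h
  · exact ⟨fun h => (hfred .plus).1 (h .plus), fun h σ => (hfred σ).2 h⟩
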